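/- Let $0<q<1$ and let $\mathcal A=\mathcal A(SU_q(2))$ be the unital complex $*$-algebra generated by $a,b$ with relations $$ba=q\,ab,\quad b^*a=q\,ab^*,\quad bb^*=b^*b,\quad a^*a+q^2b^*b=1,\quad aa^*+bb^*=1 .$$ **Quantum disks.** Let $\pi_\pm$ be the $*$-representations of $\mathcal A$ on $\ell^2(\mathbb N)$ with $\pi_\pm(a)\varepsilon_x=\sqrt{1-q^{2x+2}}\,\varepsilon_{x+1}$ and $\pi_\pm(b)\varepsilon_x=\pm q^x\varepsilon_x$. Let $r_\pm:\mathcal A\to\mathcal A(D^2_{q\pm}):=\mathcal A/\ker\pi_\pm$ be the quotient maps. Let $\mathcal A(S^1)$ be the $*$-algebra of Laurent polynomials in a unitary $u$. Let $\otimes$ between these algebras be the algebraic tensor product over $\mathbb C$. **Spinors.** Let $\mathcal H$ be the Hilbert space with orthonormal basis $|j\mu n{\uparrow}\rangle$ ($j=0,\frac12,1,\dots$; $\mu=-j,\dots,j$; $n=-j-\frac12,\dots,j+\frac12$) and $|j\mu n{\downarrow}\rangle$ ($j=\frac12,1,\dots$; $\mu=-j,\dots,j$; $n=-j+\frac12,\dots,j-\frac12$).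 Write $|j\mu n\rangle\!\rangle$ for the pair of these two vectors (up, down), where absent vectors are $0$. The entry in row $s'$ and column $s$ of a $2\times2$ matrix is the coefficient from spin $s$ to spin $s'$. Put $j^\pm=j\pm\frac12$, $\mu^\pm=\mu\pm\frac12$, $n^\pm=n\pm\frac12$ and $[N]=(q^{-N}-q^N)/(q^{-1}-q)$. Define bounded operators $a_\pm,b_\pm$ on $\mathcal H$ by $$a_+|j\mu n\rangle\!\rangle=q^{(\mu+n-\frac12)/2}[j+\mu+1]^{\frac12}\begin{pmatrix}q^{-j-\frac12}\frac{[j+n+\frac32]^{1/2}}{[2j+2]}&0\\ q^{\frac12}\frac{[j-n+\frac12]^{1/2}}{[2j+1][2j+2]}&q^{-j}\frac{[j+n+\frac12]^{1/2}}{[2j+1]}\end{pmatrix}|j^+\mu^+n^+\rangle\!\rangle,$$ $$a_-|j\mu n\rangle\!\rangle=q^{(\mu+n-\frac12)/2}[j-\mu]^{\frac12}\begin{pmatrix}q^{j+1}\frac{[j-n+\frac12]^{1/2}}{[2j+1]}&-q^{\frac12}\frac{[j+n+\frac12]^{1/2}}{[2j][2j+1]}\\0&q^{j+\frac12}\frac{[j-n-\frac12]^{1/2}}{[2j]}\end{pmatrix}|j^-\mu^+n^+\rangle\!\rangle,$$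 $$b_+|j\mu n\rangle\!\rangle=q^{(\mu+n-\frac12)/2}[j+\mu+1]^{\frac12}\begin{pmatrix}\frac{[j-n+\frac32]^{1/2}}{[2j+2]}&0\\-q^{-j-1}\frac{[j+n+\frac12]^{1/2}}{[2j+1][2j+2]}&q^{-\frac12}\frac{[j-n+\frac12]^{1/2}}{[2j+1]}\end{pmatrix}|j^+\mu^+n^-\rangle\!\rangle,$$ $$b_-|j\mu n\rangle\!\rangle=q^{(\mu+n-\frac12)/2}[j-\mu]^{\frac12}\begin{pmatrix}-q^{-\frac12}\frac{[j+n+\frac12]^{1/2}}{[2j+1]}&-q^{j}\frac{[j-n+\frac12]^{1/2}}{[2j][2j+1]}\\0&-\frac{[j+n-\frac12]^{1/2}}{[2j]}\end{pmatrix}|j^-\mu^+n^-\rangle\!\rangle .$$ The spinor representation is $\pi(a)=a_++a_-$, $\pi(b)=b_++b_-$; identify $\mathcal A$ with the $*$-algebra $\pi(\mathcal A)$ of operators generated by $\pi(a)$ and $\pi(b)$. **The algebra $\mathcal B$.** Let $D$ be the diagonal operator with eigenvalue $2j+\frac32$ on $|j\mu n{\uparrow}\rangle$ and $-2j-\frac12$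 on $|j\mu n{\downarrow}\rangle$, and let $P^\uparrow,P^\downarrow$ be the projectors onto the closed spans of the up and of the down vectors. For bounded $T$ that preserves $\operatorname{Dom}|D|$ and for which $|D|T-T|D|$ extends to a bounded operator, let $\delta(T)$ be that extension. Let $\mathcal B$ be the ($*$-)algebra of operators generated by all $\delta^n(\mathcal A)$, $n\ge0$. Put $$\tilde a_\pm=P^\uparrow a_\pm P^\uparrow+P^\downarrow a_\pm P^\downarrow,\qquad\tilde b_\pm=P^\uparrow b_\pm P^\uparrow+P^\downarrow b_\pm P^\downarrow .$$ **Smoothing operators.** Let $\mathcal H^\infty=\bigcap_{s\ge0}\operatorname{Dom}(1+D^2)^{s/2}$. For real $\alpha$, let $OP^\alpha$ be the set of linear maps $T:\mathcal H^\infty\to\mathcal H^\infty$ such that $|D|^{-\alpha}T$ extends to a bounded operator in $\bigcap_n\operatorname{Dom}\delta^n$. Put $OP^{-\infty}=\bigcap_{\alpha\le0}OP^\alpha$. **The embedding.** Identify $\mathcal H$ with a closed subspace $\mathcal H'$ of $\ell^2(\mathbb N)\otimes\ell^2(\mathbb N)\otimes\ell^2(\mathbb Z)\otimes\mathbb C^2$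 (Hilbert space tensor product) by sending $|j\mu n{\uparrow}\rangle$ to $\varepsilon_{j+\mu}\otimes\varepsilon_{j+n+1/2}\otimes\varepsilon_{2j}\otimes{\uparrow}$ and $|j\mu n{\downarrow}\rangle$ to $\varepsilon_{j+\mu}\otimes\varepsilon_{j+n-1/2}\otimes\varepsilon_{2j}\otimes{\downarrow}$. Let $Q$ be the orthogonal projector onto $\mathcal H'$. The algebra $\mathcal A(D^2_{q+})\otimes\mathcal A(D^2_{q-})\otimes\mathcal A(S^1)$ acts on $\ell^2(\mathbb N)\otimes\ell^2(\mathbb N)\otimes\ell^2(\mathbb Z)$ through $\pi_+$, $\pi_-$ and the shift $u\,\varepsilon_m=\varepsilon_{m+1}$. **Statement.** The $*$-algebra $\mathcal B$ is generated by $\tilde a_\pm$, $\tilde b_\pm$, $P^\downarrow a_+P^\uparrow+P^\uparrow a_-P^\downarrow$ and $P^\downarrow b_+P^\uparrow+P^\uparrow b_-P^\downarrow$. There is a unique unital $*$-homomorphism $$\rho:\mathcal B\to\mathcal A(D^2_{q+})\otimes\mathcal A(D^2_{q-})\otimes\mathcal A(S^1)$$ such that $$\rho(\tilde a_+)=r_+(a)\otimes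 r_-(a)\otimes u,\qquad\rho(\tilde a_-)=-q\,r_+(b)\otimes r_-(b^*)\otimes u^*,$$ $$\rho(\tilde b_+)=-r_+(a)\otimes r_-(b)\otimes u,\qquad\rho(\tilde b_-)=-r_+(b)\otimes r_-(a^*)\otimes u^*,$$ $$\rho(P^\downarrow a_+P^\uparrow+P^\uparrow a_-P^\downarrow)=0,\qquad\rho(P^\downarrow b_+P^\uparrow+P^\uparrow b_-P^\downarrow)=0 .$$ Its range, which is by definition the algebra $\mathcal A(S_q^*)$ of the cosphere bundle, is the $*$-subalgebra generated by the four elements $\rho(\tilde a_\pm)$, $\rho(\tilde b_\pm)$ displayed above. For every $T\in\mathcal B$, $$T-Q(\rho(T)\otimes1_2)Q\in OP^{-\infty},$$ where $Q(\rho(T)\otimes1_2)Q$ is regarded as an operator on $\mathcal H=\mathcal H'$. -/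

import Mathlib

noncomputable section
open scoped TensorProduct ComplexConjugate InnerProductSpace

namespace QSU2

/-- The Hilbert space `ℓ²(ι)`. -/
abbrev Ell2 (ι : Type) : Type := lp (fun _ : ι => ℂ) 2

open Classical in
/-- The standard orthonormal basis of `ℓ²(ι)`. -/
def basisVec {ι : Type} (i : ι) : Ell2 ι := lp.single 2 i 1

theorem two_toReal : (2 : ENNReal).toReal = 2 := by norm_num

theorem sum_sq_le {ι : Type} (f : Ell2 ι) (s : Finset ι) : ∑ i ∈ s, ‖f i‖ ^ 2 ≤ ‖f‖ ^ 2 := by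
  have h := lp.sum_rpow_le_norm_rpow (p := 2) (by norm_num) f s
  simpa [two_toReal] using h

theorem memℓp_of_sum_sq {ι : Type} {f : ι → ℂ} {C : ℝ}
    (h : ∀ s : Finset ι, ∑ i ∈ s, ‖f i‖ ^ 2 ≤ C) : Memℓp f 2 := by
  refine memℓp_gen' (C := C) fun s => ?_
  simpa [two_toReal] using h s

theorem norm_le_of_sum_sq {ι : Type} (f : Ell2 ι) {C : ℝ} (hC : 0 ≤ C)
    (h : ∀ s : Finset ι, ∑ i ∈ s, ‖f i‖ ^ 2 ≤ C ^ 2) : ‖f‖ ≤ C := by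
  refine lp.norm_le_of_forall_sum_le (p := 2) (by norm_num) hC fun s => ?_
  simpa [two_toReal] using h s

/-- A linear map into coordinate functions with an `ℓ²` bound is a bounded operator. -/
def mkOp {ι κ : Type} (F : Ell2 ι →ₗ[ℂ] (κ → ℂ)) (C : ℝ) (hC : 0 ≤ C)
    (h : ∀ (f : Ell2 ι) (s : Finset κ), ∑ k ∈ s, ‖F f k‖ ^ 2 ≤ (C * ‖f‖) ^ 2) :
    Ell2 ι →L[ℂ] Ell2 κ :=
  LinearMap.mkContinuous
    { toFun := fun f => ⟨F f, memℓp_of_sum_sq (h f)⟩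
      map_add' := fun f g => Subtype.ext (F.map_add f g)
      map_smul' := fun c f => Subtype.ext (F.map_smul c f) } C
    fun f => norm_le_of_sum_sq _ (by positivity) (h f)

theorem mkOp_apply {ι κ : Type} (F : Ell2 ι →ₗ[ℂ] (κ → ℂ)) (C : ℝ) (hC : 0 ≤ C)
    (h : ∀ (f : Ell2 ι) (s : Finset κ), ∑ k ∈ s, ‖F f k‖ ^ 2 ≤ (C * ‖f‖) ^ 2)
    (f : Ell2 ι) (k : κ) : mkOp F C hC h f k = F f k := rfl

/-- `conj (w i) * f (σ i)`, read as `0` where `σ i` is undefined. -/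
def pullback {ι κ : Type} (w : ι → ℂ) (σ : ι → Option κ) : Ell2 κ →ₗ[ℂ] (ι → ℂ) where
  toFun f i := conj (w i) * (σ i).elim 0 (fun k => f k)
  map_add' f g := by ext i; cases h : σ i <;> simp [h, mul_add]
  map_smul' c f := by ext i; cases h : σ i <;> simp [h, mul_left_comm]

theorem pullback_bound {ι κ : Type} (w : ι → ℂ) (σ : ι → Option κ) (C : ℝ)
    (hw : ∀ i, ‖w i‖ ≤ C) (hσ : ∀ i i' k, σ i = some k → σ i' = some k → i = i')
    (f : Ell2 κ) (s : Finset ι) :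
    ∑ i ∈ s, ‖pullback w σ f i‖ ^ 2 ≤ (|C| * ‖f‖) ^ 2 := by
  classical
  have h1 : ∀ i, ‖pullback w σ f i‖ ^ 2 ≤ |C| ^ 2 * (σ i).elim 0 (fun k => ‖f k‖ ^ 2) := by
    intro i
    cases h : σ i with
    | none => simp [pullback, h]
    | some k =>
      have : ‖w i‖ ^ 2 ≤ |C| ^ 2 := by
        have := (hw i).trans (le_abs_self C); gcongr
      simp only [pullback, LinearMap.coe_mk, AddHom.coe_mk, h, Option.elim_some, norm_mul,
        RCLike.norm_conj, mul_pow]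
      gcongr
  have h2 : ∑ i ∈ s, (σ i).elim 0 (fun k => ‖f k‖ ^ 2) ≤ ‖f‖ ^ 2 := by
    have : ∑ i ∈ s, (σ i).elim 0 (fun k => ‖f k‖ ^ 2)
        = ∑ k ∈ s.filterMap σ (fun a a' b hb hb' => hσ a a' b hb hb'), ‖f k‖ ^ 2 := by
      induction s using Finset.induction_on with
      | empty => simp
      | insert a s ha ih =>
        rw [Finset.sum_insert ha, ih]
        cases h : σ a with
        | none =>
          simp only [Option.elim_none, zero_add]
          refine Finset.sum_congr ?_ fun _ _ => rfl
          ext k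
          simp [h]
        | some k =>
          have hk : k ∉ s.filterMap σ (fun a a' b hb hb' => hσ a a' b hb hb') := by
            simp only [Finset.mem_filterMap, not_exists, not_and]
            intro i hi hik
            exact ha (hσ _ _ _ h hik ▸ hi)
          simp only [Option.elim_some]
          refine (Finset.sum_insert (f := fun k => ‖f k‖ ^ 2) hk).symm.trans ?_
          refine Finset.sum_congr ?_ fun _ _ => rfl
          ext l
          simp [h, eq_comm]
    rw [this]
    exact sum_sq_le f _
  calc ∑ i ∈ s, ‖pullback w σ f i‖ ^ 2
      ≤ ∑ i ∈ s, |C| ^ 2 * (σ i).elim 0 (fun k => ‖f k‖ ^ 2) := Finset.sum_le_sum fun i _ => h1 i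
    _ = |C| ^ 2 * ∑ i ∈ s, (σ i).elim 0 (fun k => ‖f k‖ ^ 2) := by rw [Finset.mul_sum]
    _ ≤ |C| ^ 2 * ‖f‖ ^ 2 := by gcongr
    _ = (|C| * ‖f‖) ^ 2 := by ring

/-- The bounded operator `(f ↦ conj (w i) * f (σ i))`. -/
def pullOp {ι κ : Type} (w : ι → ℂ) (σ : ι → Option κ) (hw : ∃ C, ∀ i, ‖w i‖ ≤ C)
    (hσ : ∀ i i' k, σ i = some k → σ i' = some k → i = i') : Ell2 κ →L[ℂ] Ell2 ι :=
  mkOp (pullback w σ) |hw.choose| (abs_nonneg _) (pullback_bound w σ _ hw.choose_spec hσ)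

/-- The bounded operator with `e_i ↦ w i • e_{σ i}`, where `e_{σ i}` is read as `0` if `σ i` is
undefined (see `shiftOp_basisVec`). -/
def shiftOp {ι κ : Type} (w : ι → ℂ) (σ : ι → Option κ) (hw : ∃ C, ∀ i, ‖w i‖ ≤ C)
    (hσ : ∀ i i' k, σ i = some k → σ i' = some k → i = i') : Ell2 ι →L[ℂ] Ell2 κ :=
  ContinuousLinearMap.adjoint (pullOp w σ hw hσ)

theorem apply_eq_inner {ι : Type} (g : Ell2 ι) (k : ι) : g k = ⟪(basisVec k : Ell2 ι), g⟫_ℂ := by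
  classical
  rw [basisVec, lp.inner_single_left]; simp

theorem basisVec_self {ι : Type} (i : ι) : (basisVec i : Ell2 ι) i = 1 := by
  simp [basisVec]

theorem basisVec_ne {ι : Type} {i j : ι} (h : j ≠ i) : (basisVec i : Ell2 ι) j = 0 := by
  simp [basisVec, h]

theorem shiftOp_basisVec {ι κ : Type} (w : ι → ℂ) (σ : ι → Option κ) (hw : ∃ C, ∀ i, ‖w i‖ ≤ C)
    (hσ : ∀ i i' k, σ i = some k → σ i' = some k → i = i') (i : ι) :
    shiftOp w σ hw hσ (basisVec i) = w i • (σ i).elim 0 basisVec := by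
  ext k
  have h1 : shiftOp w σ hw hσ (basisVec i) k = conj (pullOp w σ hw hσ (basisVec k) i) := by
    rw [apply_eq_inner, shiftOp, ContinuousLinearMap.adjoint_inner_right,
      apply_eq_inner (pullOp w σ hw hσ (basisVec k)) i, inner_conj_symm]
  have h2 : pullOp w σ hw hσ (basisVec k) i
      = conj (w i) * (σ i).elim 0 (fun l => (basisVec k : Ell2 κ) l) := rfl
  rw [h1, h2]
  cases h : σ i with
  | none => simp
  | some l =>
    by_cases hkl : k = l
    · subst hkl; simp [basisVec_self]
    · simp [basisVec_ne hkl, basisVec_ne (Ne.symm hkl)]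

/-- Bounded operators that agree on the orthonormal basis are equal. -/
theorem clm_ext {ι κ : Type} {S T : Ell2 ι →L[ℂ] Ell2 κ}
    (h : ∀ i, S (basisVec i) = T (basisVec i)) : S = T := by
  classical
  ext1 f
  have hf := lp.hasSum_single (p := 2) (by norm_num) f
  have e : ∀ i, (lp.single 2 i (f i) : Ell2 ι) = f i • basisVec i := by
    intro i
    rw [basisVec, ← lp.single_smul]; simp
  have h1 := hf.mapL S
  have h2 := hf.mapL T
  have : (fun i => S (lp.single 2 i (f i))) = fun i => T (lp.single 2 i (f i)) := by
    funext i
    rw [e, map_smul, map_smul, h]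
  rw [this] at h1
  exact h1.unique h2

/-- The slice `a ↦ f (a, b)` of `f`, for a splitting `κ ≃ α × β` of the index set. -/
def slice {α β κ : Type} (e : κ ≃ α × β) (b : β) : Ell2 κ →L[ℂ] Ell2 α :=
  pullOp (fun _ => 1) (fun a => some (e.symm (a, b))) ⟨1, by simp⟩ (by
    intro a a' k h h'
    have := e.symm.injective (Option.some.inj (h.trans h'.symm))
    exact (Prod.ext_iff.mp this).1)

theorem slice_apply {α β κ : Type} (e : κ ≃ α × β) (b : β) (f : Ell2 κ) (a : α) :
    slice e b f a = f (e.symm (a, b)) := by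
  change conj (1 : ℂ) * f (e.symm (a, b)) = _
  simp

theorem norm_sq_eq {ι : Type} (f : Ell2 ι) : HasSum (fun i => ‖f i‖ ^ 2) (‖f‖ ^ 2) := by
  have h := lp.hasSum_norm (p := 2) (by norm_num) f
  simpa [two_toReal] using h

theorem sum_slice_le {α β κ : Type} (e : κ ≃ α × β) (B : Finset β) (f : Ell2 κ) :
    ∑ b ∈ B, ‖slice e b f‖ ^ 2 ≤ ‖f‖ ^ 2 := by
  classical
  have h := hasSum_sum (s := B) fun b _ => norm_sq_eq (slice e b f)
  refine hasSum_le_of_sum_le h fun A => ?_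
  have h2 : ∑ a ∈ A, ∑ b ∈ B, ‖slice e b f a‖ ^ 2
      = ∑ k ∈ (A ×ˢ B).map e.symm.toEmbedding, ‖f k‖ ^ 2 := by
    rw [Finset.sum_map, Finset.sum_product]
    simp [slice_apply]
  rw [h2]
  exact sum_sq_le f _

/-- Coordinates of `(S ⊗ 1) f`. -/
def amplifyFun {α β κ : Type} (e : κ ≃ α × β) (S : Ell2 α →L[ℂ] Ell2 α) :
    Ell2 κ →ₗ[ℂ] (κ → ℂ) where
  toFun f k := S (slice e (e k).2 f) (e k).1
  map_add' f g := by ext k; simp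
  map_smul' c f := by ext k; simp

theorem amplify_bound {α β κ : Type} (e : κ ≃ α × β) (S : Ell2 α →L[ℂ] Ell2 α) (f : Ell2 κ)
    (s : Finset κ) : ∑ k ∈ s, ‖amplifyFun e S f k‖ ^ 2 ≤ (‖S‖ * ‖f‖) ^ 2 := by
  classical
  set t := s.map e.toEmbedding with ht
  calc ∑ k ∈ s, ‖amplifyFun e S f k‖ ^ 2
      = ∑ x ∈ t, ‖S (slice e x.2 f) x.1‖ ^ 2 := by rw [ht, Finset.sum_map]; rfl
    _ ≤ ∑ x ∈ (t.image Prod.fst) ×ˢ (t.image Prod.snd), ‖S (slice e x.2 f) x.1‖ ^ 2 :=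
        Finset.sum_le_sum_of_subset_of_nonneg Finset.subset_product fun _ _ _ => by positivity
    _ = ∑ b ∈ t.image Prod.snd, ∑ a ∈ t.image Prod.fst, ‖S (slice e b f) a‖ ^ 2 := by
        rw [Finset.sum_product_right]
    _ ≤ ∑ b ∈ t.image Prod.snd, ‖S‖ ^ 2 * ‖slice e b f‖ ^ 2 := by
        refine Finset.sum_le_sum fun b _ => (sum_sq_le _ _).trans ?_
        rw [← mul_pow]
        gcongr
        exact S.le_opNorm _
    _ ≤ (‖S‖ * ‖f‖) ^ 2 := by
        rw [← Finset.mul_sum, mul_pow]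
        gcongr
        exact sum_slice_le e _ f

/-- For a splitting `κ ≃ α × β` of the index set, i.e. `ℓ²(κ) ≅ ℓ²(α) ⊗ ℓ²(β)`, the map
`S ↦ S ⊗ 1` from operators on `ℓ²(α)` to operators on `ℓ²(κ)`:
`((S ⊗ 1) f) (a, b) = (S (f (·, b))) a`. -/
def amplify {α β κ : Type} (e : κ ≃ α × β) :
    (Ell2 α →L[ℂ] Ell2 α) →ₗ[ℂ] (Ell2 κ →L[ℂ] Ell2 κ) where
  toFun S := mkOp (amplifyFun e S) ‖S‖ (norm_nonneg S) (amplify_bound e S)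
  map_add' S T := by ext f k; simp [mkOp_apply, amplifyFun]
  map_smul' c S := by ext f k; simp [mkOp_apply, amplifyFun]


/-! ### The coordinate algebra of quantum `SU(2)` -/

/-- Values of the deformation parameter: `0 < q < 1`. -/
abbrev Par : Type := Set.Ioo (0 : ℝ) 1

/-- The opposite algebra of `A` with conjugated scalars: conjugate-linear anti-endomorphisms of `A`
are the algebra homomorphisms `A → ConjOp A`. -/
def ConjOp (A : Type) : Type := Aᵐᵒᵖ

instance ConjOp.ring (A : Type) [Ring A] : Ring (ConjOp A) := inferInstanceAs (Ring Aᵐᵒᵖ)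

instance ConjOp.algebra (A : Type) [Ring A] [Algebra ℂ A] : Algebra ℂ (ConjOp A) :=
  ((algebraMap ℂ Aᵐᵒᵖ).comp (starRingEnd ℂ)).toAlgebra' fun c x => Algebra.commutes (conj c) x

/-- The element `x` of `A` seen in `ConjOp A`. -/
def ConjOp.op {A : Type} (x : A) : ConjOp A := MulOpposite.op x

/-- The underlying element of `A`. -/
def ConjOp.unop {A : Type} (x : ConjOp A) : A := MulOpposite.unop x

section ConjOp

theorem ConjOp.unop_op {A : Type} (x : A) : (ConjOp.op x).unop = x := rfl

theorem ConjOp.op_mul {A : Type} [Ring A] (x y : A) :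
    ConjOp.op x * ConjOp.op y = ConjOp.op (y * x) := rfl

theorem ConjOp.op_add {A : Type} [Ring A] (x y : A) :
    ConjOp.op x + ConjOp.op y = ConjOp.op (x + y) := rfl

theorem ConjOp.op_one {A : Type} [Ring A] : (1 : ConjOp A) = ConjOp.op 1 := rfl

variable {A : Type} [Ring A] [Algebra ℂ A]

theorem ConjOp.smul_op (c : ℂ) (x : A) : c • ConjOp.op x = ConjOp.op (conj c • x) := by
  rw [Algebra.smul_def]
  change MulOpposite.op (algebraMap ℂ A (conj c)) * MulOpposite.op x = MulOpposite.op _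
  rw [← MulOpposite.op_mul, Algebra.smul_def, Algebra.commutes]

theorem ConjOp.unop_smul (c : ℂ) (x : ConjOp A) : (c • x).unop = conj c • x.unop :=
  congrArg ConjOp.unop (ConjOp.smul_op c x.unop)

end ConjOp

/-- The generators `a, b, a^*, b^*`. -/
inductive Gen : Type
  | a | b | aStar | bStar

/-- The free complex algebra on the letters `a, b, a^*, b^*`. -/
abbrev FreeGen : Type := FreeAlgebra ℂ Gen

/-- A letter as an element of the free algebra. -/
abbrev gen (x : Gen) : FreeGen := FreeAlgebra.ι ℂ x

open Gen in
/-- The defining relations of `A(SU_q(2))`, with their adjoints. -/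
inductive SURel (q : ℝ) : FreeGen → FreeGen → Prop
  | ba : SURel q (gen b * gen a) ((q : ℂ) • (gen a * gen b))
  | ba_adj : SURel q (gen aStar * gen bStar) ((q : ℂ) • (gen bStar * gen aStar))
  | bsa : SURel q (gen bStar * gen a) ((q : ℂ) • (gen a * gen bStar))
  | bsa_adj : SURel q (gen aStar * gen b) ((q : ℂ) • (gen b * gen aStar))
  | bb : SURel q (gen b * gen bStar) (gen bStar * gen b)
  | sphere : SURel q (gen aStar * gen a + (q : ℂ) ^ 2 • (gen bStar * gen b)) 1
  | sphere' : SURel q (gen a * gen aStar + gen b * gen bStar) 1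

/-- The algebra `A(SU_q(2))`. -/
def SUq2 (q : ℝ) : Type := RingQuot (SURel q)

instance (q : ℝ) : Ring (SUq2 q) := inferInstanceAs (Ring (RingQuot (SURel q)))
instance (q : ℝ) : Algebra ℂ (SUq2 q) := inferInstanceAs (Algebra ℂ (RingQuot (SURel q)))

namespace SUq2
variable (q : ℝ)

/-- The quotient map from the free algebra. -/
def mk : FreeGen →ₐ[ℂ] SUq2 q := RingQuot.mkAlgHom ℂ (SURel q)

theorem mk_surjective : Function.Surjective (mk q) := RingQuot.mkAlgHom_surjective ℂ (SURel q)

theorem mk_rel {x y : FreeGen} (h : SURel q x y) : mk q x = mk q y := RingQuot.mkAlgHom_rel ℂ h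

/-- The universal property of `A(SU_q(2))` as an algebra. -/
def lift {C : Type} [Ring C] [Algebra ℂ C] (f : Gen → C)
    (h : ∀ ⦃x y⦄, SURel q x y → FreeAlgebra.lift ℂ f x = FreeAlgebra.lift ℂ f y) :
    SUq2 q →ₐ[ℂ] C :=
  RingQuot.liftAlgHom ℂ ⟨FreeAlgebra.lift ℂ f, h⟩

theorem lift_mk {C : Type} [Ring C] [Algebra ℂ C] (f : Gen → C)
    (h : ∀ ⦃x y⦄, SURel q x y → FreeAlgebra.lift ℂ f x = FreeAlgebra.lift ℂ f y) (x : FreeGen) :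
    lift q f h (mk q x) = FreeAlgebra.lift ℂ f x :=
  RingQuot.liftAlgHom_mkAlgHom_apply ℂ _ h x

/-- The involution on letters. -/
def genStar : Gen → Gen
  | .a => .aStar
  | .b => .bStar
  | .aStar => .a
  | .bStar => .b

/-- The letter `x` sent to `x^*` in `ConjOp`. -/
def starVal (x : Gen) : ConjOp (SUq2 q) := ConjOp.op (mk q (gen (genStar x)))

theorem starVal_rel ⦃x y : FreeGen⦄ (hxy : SURel q x y) :
    FreeAlgebra.lift ℂ (starVal q) x = FreeAlgebra.lift ℂ (starVal q) y := by
  cases hxy with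
  | ba =>
    have h := congrArg ConjOp.op (mk_rel q (SURel.ba_adj (q := q)))
    simpa [-Complex.coe_smul, starVal, genStar, ConjOp.op_mul, ConjOp.smul_op] using h
  | ba_adj =>
    have h := congrArg ConjOp.op (mk_rel q (SURel.ba (q := q)))
    simpa [-Complex.coe_smul, starVal, genStar, ConjOp.op_mul, ConjOp.smul_op] using h
  | bsa =>
    have h := congrArg ConjOp.op (mk_rel q (SURel.bsa_adj (q := q)))
    simpa [-Complex.coe_smul, starVal, genStar, ConjOp.op_mul, ConjOp.smul_op] using h
  | bsa_adj =>
    have h := congrArg ConjOp.op (mk_rel q (SURel.bsa (q := q)))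
    simpa [-Complex.coe_smul, starVal, genStar, ConjOp.op_mul, ConjOp.smul_op] using h
  | bb =>
    have h := congrArg ConjOp.op (mk_rel q (SURel.bb (q := q)))
    simpa [-Complex.coe_smul, starVal, genStar, ConjOp.op_mul, ConjOp.smul_op] using h
  | sphere =>
    have h := congrArg ConjOp.op (mk_rel q (SURel.sphere (q := q)))
    simpa [-Complex.coe_smul, starVal, genStar, ConjOp.op_mul, ConjOp.smul_op, ConjOp.op_add, ConjOp.op_one] using h
  | sphere' =>
    have h := congrArg ConjOp.op (mk_rel q (SURel.sphere' (q := q)))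
    simpa [-Complex.coe_smul, starVal, genStar, ConjOp.op_mul, ConjOp.smul_op, ConjOp.op_add, ConjOp.op_one] using h

/-- The involution of `A(SU_q(2))` as a homomorphism into `ConjOp`. -/
def starHom : SUq2 q →ₐ[ℂ] ConjOp (SUq2 q) := lift q (starVal q) (starVal_rel q)

instance : Star (SUq2 q) := ⟨fun x => (starHom q x).unop⟩

theorem star_def (x : SUq2 q) : star x = (starHom q x).unop := rfl

theorem star_gen (x : Gen) : star (mk q (gen x)) = mk q (gen (genStar x)) := by
  rw [star_def, starHom, lift_mk, FreeAlgebra.lift_ι_apply, starVal, ConjOp.unop_op]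

theorem star_mul' (x y : SUq2 q) : star (x * y) = star y * star x := by
  simp only [star_def, map_mul]; rfl

theorem star_add' (x y : SUq2 q) : star (x + y) = star x + star y := by
  simp only [star_def, map_add]; rfl

theorem star_smul' (c : ℂ) (x : SUq2 q) : star (c • x) = conj c • star x := by
  simp only [star_def, map_smul, ConjOp.unop_smul]

theorem star_one' : star (1 : SUq2 q) = 1 := by
  simp only [star_def, map_one]; rfl

/-- Induction on elements of `A(SU_q(2))`. -/
theorem induction {P : SUq2 q → Prop} (hc : ∀ c : ℂ, P (c • 1)) (hg : ∀ x, P (mk q (gen x)))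
    (hm : ∀ x y, P x → P y → P (x * y)) (ha : ∀ x y, P x → P y → P (x + y)) (x : SUq2 q) : P x := by
  obtain ⟨x, rfl⟩ := mk_surjective q x
  induction x using FreeAlgebra.induction with
  | grade0 r => rw [Algebra.algebraMap_eq_smul_one, map_smul, map_one]; exact hc r
  | grade1 x => exact hg x
  | mul x y hx hy => rw [map_mul]; exact hm _ _ hx hy
  | add x y hx hy => rw [map_add]; exact ha _ _ hx hy

instance : StarRing (SUq2 q) where
  star_involutive := by
    refine induction q (fun c => ?_) (fun x => ?_) (fun x y hx hy => ?_) (fun x y hx hy => ?_)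
    · simp [star_smul', star_one']
    · rw [star_gen, star_gen]; cases x <;> rfl
    · rw [star_mul', star_mul', hx, hy]
    · rw [star_add', star_add', hx, hy]
  star_mul := star_mul' q
  star_add := star_add' q

instance : StarModule ℂ (SUq2 q) := ⟨star_smul' q⟩

/-- The generator `a` of `A(SU_q(2))`. -/
def a : SUq2 q := mk q (gen Gen.a)

/-- The generator `b` of `A(SU_q(2))`. -/
def b : SUq2 q := mk q (gen Gen.b)

theorem star_a : star (a q) = mk q (gen Gen.aStar) := star_gen q _
theorem star_b : star (b q) = mk q (gen Gen.bStar) := star_gen q _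

/-- A pair of elements of a `*`-algebra that satisfies the relations of `A(SU_q(2))`. -/
structure IsPair {C : Type} [Ring C] [StarRing C] [Algebra ℂ C] (α β : C) : Prop where
  ba : β * α = (q : ℂ) • (α * β)
  bsa : star β * α = (q : ℂ) • (α * star β)
  bb : β * star β = star β * β
  sphere : star α * α + (q : ℂ) ^ 2 • (star β * β) = 1
  sphere' : α * star α + β * star β = 1

/-- Images of the letters under the `*`-homomorphism with `a ↦ α`, `b ↦ β`. -/
def genVal {C : Type} [Star C] (α β : C) : Gen → C
  | .a => α
  | .b => β
  | .aStar => star α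
  | .bStar => star β

theorem genVal_rel {C : Type} [Ring C] [StarRing C] [Algebra ℂ C] [StarModule ℂ C] {α β : C}
    (h : IsPair q α β) ⦃x y : FreeGen⦄ (hxy : SURel q x y) :
    FreeAlgebra.lift ℂ (genVal α β) x = FreeAlgebra.lift ℂ (genVal α β) y := by
  have h1 := h.ba
  have h2 := h.bsa
  have h1' := congrArg star h1
  have h2' := congrArg star h2
  cases hxy with
  | ba => simpa [-Complex.coe_smul, genVal] using h1
  | ba_adj => simpa [-Complex.coe_smul, genVal] using h1'
  | bsa => simpa [-Complex.coe_smul, genVal] using h2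
  | bsa_adj => simpa [-Complex.coe_smul, genVal] using h2'
  | bb => simpa [-Complex.coe_smul, genVal] using h.bb
  | sphere => simpa [-Complex.coe_smul, genVal] using h.sphere
  | sphere' => simpa [-Complex.coe_smul, genVal] using h.sphere'

/-- The universal property of `A(SU_q(2))` as a `*`-algebra. -/
def starLift {C : Type} [Ring C] [StarRing C] [Algebra ℂ C] [StarModule ℂ C] (α β : C)
    (h : IsPair q α β) : SUq2 q →⋆ₐ[ℂ] C where
  __ := lift q (genVal α β) (genVal_rel q h)
  map_star' := by
    intro x
    change lift q (genVal α β) (genVal_rel q h) (star x)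
      = star (lift q (genVal α β) (genVal_rel q h) x)
    revert x
    refine induction q (fun c => ?_) (fun x => ?_) (fun x y hx hy => ?_) (fun x y hx hy => ?_)
    · simp [star_smul]
    · rw [star_gen, lift_mk, lift_mk, FreeAlgebra.lift_ι_apply, FreeAlgebra.lift_ι_apply]
      cases x <;> simp [genVal, genStar]
    · rw [star_mul, map_mul, map_mul, star_mul, hx, hy]
    · rw [star_add, map_add, map_add, star_add, hx, hy]

theorem starLift_a {C : Type} [Ring C] [StarRing C] [Algebra ℂ C] [StarModule ℂ C] (α β : C)
    (h : IsPair q α β) : starLift q α β h (a q) = α := by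
  change lift q (genVal α β) _ (mk q (gen Gen.a)) = _
  rw [lift_mk, FreeAlgebra.lift_ι_apply]; rfl

theorem starLift_b {C : Type} [Ring C] [StarRing C] [Algebra ℂ C] [StarModule ℂ C] (α β : C)
    (h : IsPair q α β) : starLift q α β h (b q) = β := by
  change lift q (genVal α β) _ (mk q (gen Gen.b)) = _
  rw [lift_mk, FreeAlgebra.lift_ι_apply]; rfl

end SUq2

/-! ### The representations `π_±` and the quantum disks -/

section Disk
variable (q : Par) (ε : ℤˣ)

/-- `a ε_x = √(1 - q^(2x+2)) ε_{x+1}` on `ℓ²(ℕ)`. -/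
def diskA : Ell2 ℕ →L[ℂ] Ell2 ℕ :=
  shiftOp (fun x => (√(1 - (q : ℝ) ^ (2 * x + 2)) : ℝ)) (fun x => some (x + 1))
    ⟨1, fun x => by
      have h0 : (0 : ℝ) ≤ (q : ℝ) ^ (2 * x + 2) := pow_nonneg q.2.1.le _
      rw [Complex.norm_real, Real.norm_of_nonneg (Real.sqrt_nonneg _)]
      exact Real.sqrt_le_one.mpr (by linarith)⟩
    (fun i i' k h h' => by simp at h h'; omega)

/-- `b ε_x = ± q^x ε_x` on `ℓ²(ℕ)`. -/
def diskB : Ell2 ℕ →L[ℂ] Ell2 ℕ :=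
  shiftOp (fun x => ((ε : ℤ) : ℂ) * ((q : ℝ) : ℂ) ^ x) some
    ⟨1, fun x => by
      have h0 : ‖((ε : ℤ) : ℂ)‖ = 1 := by rcases Int.units_eq_one_or ε with h | h <;> simp [h]
      have h1 : ‖(((q : ℝ) : ℂ))‖ ≤ 1 := by
        rw [Complex.norm_real, Real.norm_of_nonneg q.2.1.le]; exact q.2.2.le
      rw [norm_mul, norm_pow, h0, one_mul]
      exact pow_le_one₀ (norm_nonneg _) h1⟩
    (fun i i' k h h' => by simp at h h'; omega)

theorem diskA_basis (x : ℕ) : diskA q (basisVec x)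
    = ((√(1 - (q : ℝ) ^ (2 * x + 2)) : ℝ) : ℂ) • basisVec (x + 1) :=
  shiftOp_basisVec _ _ _ _ _

theorem diskB_basis (x : ℕ) : diskB q ε (basisVec x)
    = (((ε : ℤ) : ℂ) * ((q : ℝ) : ℂ) ^ x) • basisVec x :=
  shiftOp_basisVec _ _ _ _ _

theorem adjoint_basisVec_apply {ι κ : Type} (T : Ell2 ι →L[ℂ] Ell2 κ) (k : κ) (i : ι) :
    (ContinuousLinearMap.adjoint T (basisVec k)) i = conj (T (basisVec i) k) := by
  rw [apply_eq_inner, ContinuousLinearMap.adjoint_inner_right, apply_eq_inner (T _) k,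
    inner_conj_symm]

theorem star_diskA_basis_zero : star (diskA q) (basisVec 0) = 0 := by
  ext i
  rw [ContinuousLinearMap.star_eq_adjoint, adjoint_basisVec_apply, diskA_basis]
  simp [-Complex.coe_smul, basisVec_ne (show (0 : ℕ) ≠ i + 1 by omega)]

theorem star_diskA_basis_succ (x : ℕ) : star (diskA q) (basisVec (x + 1))
    = ((√(1 - (q : ℝ) ^ (2 * x + 2)) : ℝ) : ℂ) • basisVec x := by
  ext i
  rw [ContinuousLinearMap.star_eq_adjoint, adjoint_basisVec_apply, diskA_basis]
  by_cases h : i = x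
  · subst h; simp [-Complex.coe_smul, basisVec_self]
  · simp [-Complex.coe_smul, basisVec_ne h, basisVec_ne (show x + 1 ≠ i + 1 by omega)]

theorem star_diskB : star (diskB q ε) = diskB q ε := by
  refine clm_ext fun x => ?_
  ext i
  rw [ContinuousLinearMap.star_eq_adjoint, adjoint_basisVec_apply, diskB_basis, diskB_basis]
  by_cases h : i = x
  · subst h; simp [-Complex.coe_smul, basisVec_self]
  · simp [-Complex.coe_smul, basisVec_ne h, basisVec_ne (Ne.symm h)]

theorem sqrt_mul_sqrt_disk (x : ℕ) : ((√(1 - (q : ℝ) ^ (2 * x + 2)) : ℝ) : ℂ)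
    * ((√(1 - (q : ℝ) ^ (2 * x + 2)) : ℝ) : ℂ) = 1 - ((q : ℝ) : ℂ) ^ (2 * x + 2) := by
  have : (q : ℝ) ^ (2 * x + 2) ≤ 1 := pow_le_one₀ q.2.1.le q.2.2.le
  rw [← Complex.ofReal_mul, Real.mul_self_sqrt (by linarith)]
  push_cast; rfl

theorem sign_mul_sign : ((ε : ℤ) : ℂ) * ((ε : ℤ) : ℂ) = 1 := by
  rcases Int.units_eq_one_or ε with h | h <;> simp [h]

theorem disk_isPair : SUq2.IsPair (q : ℝ) (diskA q) (diskB q ε) := by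
  have hε := sign_mul_sign ε
  have hba : diskB q ε * diskA q = (((q : ℝ) : ℂ)) • (diskA q * diskB q ε) := by
    refine clm_ext fun x => ?_
    simp only [mul_apply_eq_comp, smul_apply, diskA_basis,
      diskB_basis, map_smul, smul_smul]
    congr 1
    ring
  refine ⟨hba, ?_, ?_, ?_, ?_⟩
  · rw [star_diskB]; exact hba
  · rw [star_diskB]
  · rw [star_diskB]
    refine clm_ext fun x => ?_
    simp only [mul_apply_eq_comp, smul_apply, diskA_basis,
      diskB_basis, map_smul, smul_smul, add_apply, star_diskA_basis_succ,
      one_apply_eq_self, ← add_smul, sqrt_mul_sqrt_disk]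
    convert one_smul ℂ _ using 2
    linear_combination ((q : ℝ) : ℂ) ^ (2 * x + 2) * hε
  · rw [star_diskB]
    refine clm_ext fun x => ?_
    cases x with
    | zero =>
      simp only [mul_apply_eq_comp, diskB_basis, map_smul, smul_smul,
        add_apply, star_diskA_basis_zero, map_zero, zero_add,
        one_apply_eq_self]
      convert one_smul ℂ _ using 2
      linear_combination hε
    | succ x =>
      simp only [mul_apply_eq_comp, diskA_basis,
        diskB_basis, map_smul, smul_smul, add_apply, star_diskA_basis_succ,
        one_apply_eq_self, ← add_smul, sqrt_mul_sqrt_disk]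
      convert one_smul ℂ _ using 2
      linear_combination ((q : ℝ) : ℂ) ^ (2 * x + 2) * hε

/-- The representations `π_±` of `A(SU_q(2))` on `ℓ²(ℕ)`; the sign is `ε`. -/
def diskRep : SUq2 (q : ℝ) →⋆ₐ[ℂ] (Ell2 ℕ →L[ℂ] Ell2 ℕ) :=
  SUq2.starLift (q : ℝ) (diskA q) (diskB q ε) (disk_isPair q ε)

/-- The ideal `ker π_±`. -/
def diskIdeal : Ideal (SUq2 (q : ℝ)) := RingHom.ker (diskRep q ε)

instance : (diskIdeal q ε).IsTwoSided := inferInstanceAs (RingHom.ker (diskRep q ε)).IsTwoSided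

/-- The algebra `A(D²_{q±}) = A(SU_q(2)) / ker π_±` of the quantum disk. -/
def Disk : Type := SUq2 (q : ℝ) ⧸ diskIdeal q ε

instance : Ring (Disk q ε) := inferInstanceAs (Ring (SUq2 (q : ℝ) ⧸ diskIdeal q ε))
instance : Algebra ℂ (Disk q ε) := inferInstanceAs (Algebra ℂ (SUq2 (q : ℝ) ⧸ diskIdeal q ε))

/-- The quotient map as an algebra homomorphism. -/
def diskMk : SUq2 (q : ℝ) →ₐ[ℂ] Disk q ε := Ideal.Quotient.mkₐ ℂ (diskIdeal q ε)

theorem diskMk_surjective : Function.Surjective (diskMk q ε) :=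
  Ideal.Quotient.mkₐ_surjective ℂ (diskIdeal q ε)

theorem diskMk_eq_zero {x : SUq2 (q : ℝ)} : diskMk q ε x = 0 ↔ diskRep q ε x = 0 :=
  (Ideal.Quotient.eq_zero_iff_mem (I := diskIdeal q ε)).trans (RingHom.mem_ker (f := diskRep q ε))

/-- The involution of the quotient. -/
instance : Star (Disk q ε) :=
  ⟨Quotient.lift (fun x => diskMk q ε (star x)) fun x y h => by
    have h1 : diskMk q ε (x - y) = 0 := by
      rw [map_sub, sub_eq_zero]; exact Quotient.sound h
    rw [← sub_eq_zero, ← map_sub, ← star_sub, diskMk_eq_zero, map_star,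
      (diskMk_eq_zero q ε).mp h1, star_zero]⟩

theorem star_diskMk (x : SUq2 (q : ℝ)) : star (diskMk q ε x) = diskMk q ε (star x) := rfl

instance : StarRing (Disk q ε) where
  star_involutive x := by
    obtain ⟨x, rfl⟩ := diskMk_surjective q ε x
    simp [star_diskMk]
  star_mul x y := by
    obtain ⟨x, rfl⟩ := diskMk_surjective q ε x
    obtain ⟨y, rfl⟩ := diskMk_surjective q ε y
    rw [← map_mul, star_diskMk, star_mul, map_mul]; rfl
  star_add x y := by
    obtain ⟨x, rfl⟩ := diskMk_surjective q ε x
    obtain ⟨y, rfl⟩ := diskMk_surjective q ε y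
    rw [← map_add, star_diskMk, star_add, map_add]; rfl

instance : StarModule ℂ (Disk q ε) where
  star_smul c x := by
    obtain ⟨x, rfl⟩ := diskMk_surjective q ε x
    rw [← map_smul, star_diskMk, star_smul, map_smul]; rfl

/-- The quotient map `r_± : A(SU_q(2)) → A(D²_{q±})`. -/
def r : SUq2 (q : ℝ) →⋆ₐ[ℂ] Disk q ε where
  __ := diskMk q ε
  map_star' _ := rfl

/-- The faithful representation of `A(D²_{q±})` on `ℓ²(ℕ)` induced by `π_±`. -/
def diskAct : Disk q ε →ₐ[ℂ] (Ell2 ℕ →L[ℂ] Ell2 ℕ) :=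
  Ideal.Quotient.liftₐ (diskIdeal q ε) (diskRep q ε : SUq2 (q : ℝ) →ₐ[ℂ] _)
    fun _ h => (RingHom.mem_ker (f := diskRep q ε)).mp h

theorem diskAct_r (x : SUq2 (q : ℝ)) : diskAct q ε (r q ε x) = diskRep q ε x := rfl

end Disk

/-! ### The circle -/

/-- The algebra `A(S¹)` of Laurent polynomials in the unitary `u`. -/
abbrev CircleAlg : Type := LaurentPolynomial ℂ

/-- The generator `u`. -/
def u : CircleAlg := LaurentPolynomial.T 1

/-- The involution of `A(S¹)`: `(∑ cₘ uᵐ)^* = ∑ conj cₘ u⁻ᵐ`. -/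
instance : StarRing CircleAlg where
  star f := LaurentPolynomial.invert (AddMonoidAlgebra.mapRingHom ℤ (starRingEnd ℂ) f)
  star_involutive f := by ext n; simp
  star_mul f g := by rw [map_mul, map_mul, mul_comm]
  star_add f g := by rw [map_add, map_add]

theorem coeff_star (f : CircleAlg) (n : ℤ) : (star f).coeff n = conj (f.coeff (-n)) := by
  change (LaurentPolynomial.invert (AddMonoidAlgebra.mapRingHom ℤ (starRingEnd ℂ) f)).coeff n = _
  simp

theorem star_u : star u = LaurentPolynomial.T (-1) := by
  ext n
  rw [coeff_star, u]
  simp [apply_ite, neg_eq_iff_eq_neg, eq_comm]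

instance : StarModule ℂ CircleAlg where
  star_smul c f := by ext n; simp [coeff_star]

/-- The translation `ε_k ↦ ε_{k+m}` of `ℓ²(ℤ)`. -/
def translate (m : ℤ) : Ell2 ℤ →L[ℂ] Ell2 ℤ :=
  shiftOp (fun _ => 1) (fun k => some (k + m)) ⟨1, by simp⟩
    (fun i i' k h h' => by simp at h h'; omega)

/-- The action of `A(S¹)` on `ℓ²(ℤ)`, the square-summable Fourier series: `u` is the shift
`ε_k ↦ ε_{k+1}`. -/
def circleAct : CircleAlg →ₗ[ℂ] (Ell2 ℤ →L[ℂ] Ell2 ℤ) :=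
  Finsupp.linearCombination ℂ translate ∘ₗ (AddMonoidAlgebra.coeffLinearEquiv ℂ).toLinearMap

/-! ### The target of the symbol map and its action -/

/-- `A(D²_{q+}) ⊗ A(D²_{q-}) ⊗ A(S¹)`. -/
abbrev SymbolAlg (q : Par) : Type := Disk q 1 ⊗[ℂ] (Disk q (-1) ⊗[ℂ] CircleAlg)

/-- Labels `(x, y, 2j, s)` of the basis of `ℓ²(ℕ) ⊗ ℓ²(ℕ) ⊗ ℓ²(ℤ) ⊗ ℂ²`. -/
abbrev BigIdx : Type := ℕ × ℕ × ℤ × Fin 2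

/-- Splitting off the first leg. -/
def leg₁ : BigIdx ≃ ℕ × (ℕ × ℤ × Fin 2) := Equiv.refl _

/-- Splitting off the second leg. -/
def leg₂ : BigIdx ≃ ℕ × (ℕ × ℤ × Fin 2) where
  toFun k := (k.2.1, k.1, k.2.2)
  invFun k := (k.2.1, k.1, k.2.2)
  left_inv _ := rfl
  right_inv _ := rfl

/-- Splitting off the third leg. -/
def leg₃ : BigIdx ≃ ℤ × (ℕ × ℕ × Fin 2) where
  toFun k := (k.2.2.1, k.1, k.2.1, k.2.2.2)
  invFun k := (k.2.1, k.2.2.1, k.1, k.2.2.2)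
  left_inv _ := rfl
  right_inv _ := rfl

/-- The operator `z ⊗ 1₂` on `ℓ²(ℕ) ⊗ ℓ²(ℕ) ⊗ ℓ²(ℤ) ⊗ ℂ²`, for `z` in
`A(D²_{q+}) ⊗ A(D²_{q-}) ⊗ A(S¹)`. On elementary tensors it is
`(π_+(x) ⊗ 1) (1 ⊗ π_-(y) ⊗ 1) (1 ⊗ f(V) ⊗ 1)`. -/
def symbolAct (q : Par) : SymbolAlg q →ₗ[ℂ] (Ell2 BigIdx →L[ℂ] Ell2 BigIdx) :=
  LinearMap.mul' ℂ _ ∘ₗ TensorProduct.map (amplify leg₁ ∘ₗ (diskAct q 1).toLinearMap)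
    (LinearMap.mul' ℂ _ ∘ₗ TensorProduct.map (amplify leg₂ ∘ₗ (diskAct q (-1)).toLinearMap)
      (amplify leg₃ ∘ₗ circleAct))

theorem symbolAct_tmul (q : Par) (x : Disk q 1) (y : Disk q (-1)) (f : CircleAlg) :
    symbolAct q (x ⊗ₜ (y ⊗ₜ f)) = amplify leg₁ (diskAct q 1 x) *
      (amplify leg₂ (diskAct q (-1) y) * amplify leg₃ (circleAct f)) := rfl

/-! ### The spinor representation -/

/-- The numbers `j = J/2`, `μ = M/2`, `n = N/2` label a basis spinor: `j = 0, 1/2, 1, …`,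
`μ = -j, …, j`, and `n = -(j + 1/2), …, j + 1/2` for `↑` (`s = 0`),
`n = -(j - 1/2), …, j - 1/2` for `↓` (`s = 1`), in steps of one. -/
def IsSpinLabel (J M N : ℤ) (s : Fin 2) : Prop :=
  0 ≤ J ∧ |M| ≤ J ∧ Even (J - M) ∧ |N| ≤ (if s = 0 then J + 1 else J - 1) ∧ Even (J + 1 - N)

/-- Labels of the orthonormal basis `|j μ n ↑⟩`, `|j μ n ↓⟩`, with `j = J/2`, `μ = M/2`,
`n = N/2`. -/
structure SpinIdx : Type where
  J : ℤ
  M : ℤ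
  N : ℤ
  s : Fin 2
  isLabel : IsSpinLabel J M N s

theorem SpinIdx.ext' {k l : SpinIdx} (h1 : k.J = l.J) (h2 : k.M = l.M) (h3 : k.N = l.N)
    (h4 : k.s = l.s) : k = l := by
  cases k; cases l; simp_all

/-- The half-integer `j`. -/
def SpinIdx.j (k : SpinIdx) : ℝ := k.J / 2

/-- The half-integer `μ`. -/
def SpinIdx.μ (k : SpinIdx) : ℝ := k.M / 2

/-- The half-integer `n`. -/
def SpinIdx.n (k : SpinIdx) : ℝ := k.N / 2

/-- The Hilbert space of spinors. -/
abbrev Spinor : Type := Ell2 SpinIdx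

/-- Bounded operators on the Hilbert space of spinors. -/
abbrev BSpinor : Type := Spinor →L[ℂ] Spinor

open Classical in
/-- The label with the given entries, if there is one. -/
def mkIdx (J M N : ℤ) (s : Fin 2) : Option SpinIdx :=
  if h : IsSpinLabel J M N s then some ⟨J, M, N, s, h⟩ else none

theorem mkIdx_some {J M N : ℤ} {s : Fin 2} {k : SpinIdx} (h : mkIdx J M N s = some k) :
    k.J = J ∧ k.M = M ∧ k.N = N ∧ k.s = s := by
  unfold mkIdx at h
  split_ifs at h
  cases h
  exact ⟨rfl, rfl, rfl, rfl⟩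

/-- The vector `|j μ n s⟩` with `j = J/2`, `μ = M/2`, `n = N/2`, read as `0` if the label does not
occur. -/
def ket (J M N : ℤ) (s : Fin 2) : Spinor := (mkIdx J M N s).elim 0 basisVec

/-- The column `s` of the coefficient matrix `m j μ n` is bounded over the labels with spin `s`. -/
def MatBounded (m : ℝ → ℝ → ℝ → Matrix (Fin 2) (Fin 2) ℝ) : Prop :=
  ∃ C, ∀ j μ n : ℝ, 0 ≤ j → |μ| ≤ j →
    (|n| ≤ j + 1 / 2 → ∀ s', |m j μ n s' 0| ≤ C) ∧
    (1 / 2 ≤ j → |n| ≤ j - 1 / 2 → ∀ s', |m j μ n s' 1| ≤ C)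

theorem MatBounded.idx {m : ℝ → ℝ → ℝ → Matrix (Fin 2) (Fin 2) ℝ} (hm : MatBounded m) :
    ∃ C, 0 ≤ C ∧ ∀ (k : SpinIdx) (s' : Fin 2), |m k.j k.μ k.n s' k.s| ≤ C := by
  obtain ⟨C, hC⟩ := hm
  have key : ∀ (k : SpinIdx) (s' : Fin 2), |m k.j k.μ k.n s' k.s| ≤ C := by
    rintro ⟨J, M, N, s, h0, h1, -, h2, -⟩ s'
    have r0 : (0 : ℝ) ≤ J := by exact_mod_cast h0
    have r1 : |(M : ℝ)| ≤ J := by exact_mod_cast h1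
    have hj : (0 : ℝ) ≤ (J : ℝ) / 2 := by positivity
    have hμ : |(M : ℝ) / 2| ≤ (J : ℝ) / 2 := by rw [abs_div, abs_two]; linarith
    have hs : s = 0 ∨ s = 1 := by omega
    rcases hs with rfl | rfl
    · refine (hC _ _ _ hj hμ).1 ?_ s'
      have r2 : |(N : ℝ)| ≤ J + 1 := by simp at h2; exact_mod_cast h2
      simp only [SpinIdx.n, abs_div, abs_two]; linarith
    · have h3 : (1 : ℤ) ≤ J := by simp at h2; have := abs_nonneg N; omega
      have r3 : (1 : ℝ) ≤ J := by exact_mod_cast h3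
      refine (hC _ _ _ hj hμ).2 (by linarith) ?_ s'
      have r2 : |(N : ℝ)| ≤ J - 1 := by
        rw [if_neg (by decide)] at h2
        exact_mod_cast h2
      simp only [SpinIdx.n, abs_div, abs_two]; linarith
  exact ⟨|C|, abs_nonneg C, fun k s' => (key k s').trans (le_abs_self C)⟩

/-- The part of `spinOp` from spin `s` to spin `s'`. -/
def spinOpPart (m : ℝ → ℝ → ℝ → Matrix (Fin 2) (Fin 2) ℝ) (dJ dM dN : ℤ) (hm : MatBounded m)
    (s s' : Fin 2) : BSpinor :=
  shiftOp (fun k => if k.s = s then ((m k.j k.μ k.n s' s : ℝ) : ℂ) else 0)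
    (fun k => if k.s = s then mkIdx (k.J + dJ) (k.M + dM) (k.N + dN) s' else none)
    (by
      obtain ⟨C, hC0, hC⟩ := hm.idx
      refine ⟨C, fun k => ?_⟩
      by_cases h : k.s = s
      · subst h
        simpa using hC k s'
      · simpa [h] using hC0)
    (by
      intro i i' k h h'
      by_cases hi : i.s = s
      · by_cases hi' : i'.s = s
        · rw [if_pos hi] at h
          rw [if_pos hi'] at h'
          have e := mkIdx_some h
          have e' := mkIdx_some h'
          exact SpinIdx.ext' (by omega) (by omega) (by omega) (hi.trans hi'.symm)
        · simp [hi'] at h'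
      · simp [hi] at h)

/-- The bounded operator
`|j μ n s⟩ ↦ ∑_{s'} m(j, μ, n)_{s' s} |j + dJ/2, μ + dM/2, n + dN/2, s'⟩`
(see `spinOp_basisVec`). -/
def spinOp (m : ℝ → ℝ → ℝ → Matrix (Fin 2) (Fin 2) ℝ) (dJ dM dN : ℤ) (hm : MatBounded m) :
    BSpinor :=
  ∑ s, ∑ s', spinOpPart m dJ dM dN hm s s'

theorem spinOp_basisVec (m : ℝ → ℝ → ℝ → Matrix (Fin 2) (Fin 2) ℝ) (dJ dM dN : ℤ)
    (hm : MatBounded m) (k : SpinIdx) :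
    spinOp m dJ dM dN hm (basisVec k)
      = ∑ s', ((m k.j k.μ k.n s' k.s : ℝ) : ℂ) • ket (k.J + dJ) (k.M + dM) (k.N + dN) s' := by
  have h : ∀ s s', spinOpPart m dJ dM dN hm s s' (basisVec k) = if k.s = s then
      ((m k.j k.μ k.n s' k.s : ℝ) : ℂ) • ket (k.J + dJ) (k.M + dM) (k.N + dN) s' else 0 := by
    intro s s'
    rw [spinOpPart, shiftOp_basisVec]
    by_cases hs : k.s = s
    · subst hs; simp [-Complex.coe_smul, ket]
    · simp [hs]
  simp only [spinOp, sum_apply, h]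
  rw [Finset.sum_eq_single k.s (fun s _ hs => by simp [Ne.symm hs]) (by simp)]
  simp

/-! #### The coefficients -/

/-- The `q`-integer `[N] = (q^{-N} - q^N) / (q^{-1} - q)`. -/
def qInt (q N : ℝ) : ℝ := (q ^ (-N) - q ^ N) / (q⁻¹ - q)

section Coeff
variable (q : ℝ)

/-- Coefficient matrix of `a_+`. The entry `(s', s)` is the coefficient from spin `s` to spin `s'`,
where `0` is `↑` and `1` is `↓`. -/
def aPlusMat (j μ n : ℝ) : Matrix (Fin 2) (Fin 2) ℝ :=
  (q ^ ((μ + n - 1 / 2) / 2) * √(qInt q (j + μ + 1))) •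
    !![q ^ (-j - 1 / 2) * (√(qInt q (j + n + 3 / 2)) / qInt q (2 * j + 2)), 0;
       q ^ (1 / 2 : ℝ) * (√(qInt q (j - n + 1 / 2)) / (qInt q (2 * j + 1) * qInt q (2 * j + 2))),
       q ^ (-j) * (√(qInt q (j + n + 1 / 2)) / qInt q (2 * j + 1))]

/-- Coefficient matrix of `a_-`. -/
def aMinusMat (j μ n : ℝ) : Matrix (Fin 2) (Fin 2) ℝ :=
  (q ^ ((μ + n - 1 / 2) / 2) * √(qInt q (j - μ))) •
    !![q ^ (j + 1) * (√(qInt q (j - n + 1 / 2)) / qInt q (2 * j + 1)),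
       -(q ^ (1 / 2 : ℝ) * (√(qInt q (j + n + 1 / 2)) / (qInt q (2 * j) * qInt q (2 * j + 1))));
       0, q ^ (j + 1 / 2) * (√(qInt q (j - n - 1 / 2)) / qInt q (2 * j))]

/-- Coefficient matrix of `b_+`. -/
def bPlusMat (j μ n : ℝ) : Matrix (Fin 2) (Fin 2) ℝ :=
  (q ^ ((μ + n - 1 / 2) / 2) * √(qInt q (j + μ + 1))) •
    !![√(qInt q (j - n + 3 / 2)) / qInt q (2 * j + 2), 0;
       -(q ^ (-j - 1) * (√(qInt q (j + n + 1 / 2)) / (qInt q (2 * j + 1) * qInt q (2 * j + 2)))),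
       q ^ (-(1 / 2) : ℝ) * (√(qInt q (j - n + 1 / 2)) / qInt q (2 * j + 1))]

/-- Coefficient matrix of `b_-`. -/
def bMinusMat (j μ n : ℝ) : Matrix (Fin 2) (Fin 2) ℝ :=
  (q ^ ((μ + n - 1 / 2) / 2) * √(qInt q (j - μ))) •
    !![-(q ^ (-(1 / 2) : ℝ) * (√(qInt q (j + n + 1 / 2)) / qInt q (2 * j + 1))),
       -(q ^ j * (√(qInt q (j - n + 1 / 2)) / (qInt q (2 * j) * qInt q (2 * j + 1))));
       0, -(√(qInt q (j + n - 1 / 2)) / qInt q (2 * j))]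

variable {q}

theorem inv_sub_pos (h0 : 0 < q) (h1 : q < 1) : 0 < q⁻¹ - q := by
  have : 1 < q⁻¹ := (one_lt_inv₀ h0).mpr h1
  linarith

theorem sqrt_qInt_le (h0 : 0 < q) (h1 : q < 1) (A : ℝ) : √(qInt q A) ≤ √((q⁻¹ - q)⁻¹) * q ^ (-A / 2) := by
  have hc := inv_sub_pos h0 h1
  have h : qInt q A ≤ (q⁻¹ - q)⁻¹ * q ^ (-A) := by
    rw [qInt, div_eq_inv_mul]
    have := Real.rpow_nonneg h0.le A
    gcongr
    linarith
  refine (Real.sqrt_le_sqrt h).trans ?_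
  rw [Real.sqrt_mul (by positivity), Real.rpow_div_two_eq_sqrt _ h0.le, Real.sqrt_eq_rpow (q ^ (-A)),
    ← Real.rpow_mul h0.le, Real.sqrt_eq_rpow q, ← Real.rpow_mul h0.le]
  ring_nf
  rfl

theorem qInt_inv_le (h0 : 0 < q) (h1 : q < 1) {C : ℝ} (hC : 1 ≤ C) : 0 ≤ (qInt q C)⁻¹ ∧ (qInt q C)⁻¹ ≤ q ^ (C - 1) := by
  have hc := inv_sub_pos h0 h1
  have h : q ^ (1 - C) ≤ qInt q C := by
    rw [qInt, le_div_iff₀ hc, mul_sub]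
    have e1 : q ^ (1 - C) * q⁻¹ = q ^ (-C) := by
      rw [← Real.rpow_neg_one q, ← Real.rpow_add h0]; congr 1; ring
    have e2 : q ^ (1 - C) * q = q ^ (2 - C) := by
      nth_rewrite 2 [← Real.rpow_one q]
      rw [← Real.rpow_add h0]; congr 1; ring
    have e3 : q ^ C ≤ q ^ (2 - C) := Real.rpow_le_rpow_of_exponent_ge h0 h1.le (by linarith)
    rw [e1, e2]; linarith
  have hp : 0 < q ^ (1 - C) := Real.rpow_pos_of_pos h0 _
  refine ⟨inv_nonneg.mpr (hp.le.trans h), ?_⟩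
  calc (qInt q C)⁻¹ ≤ (q ^ (1 - C))⁻¹ := inv_anti₀ hp h
    _ = q ^ (C - 1) := by rw [← Real.rpow_neg h0.le]; congr 1; ring

theorem coeff_bound (h0 : 0 < q) (h1 : q < 1) (α A β B C : ℝ) (hC : 1 ≤ C) (hE : -4 ≤ α - A / 2 + β - B / 2 + C) :
    |q ^ α * √(qInt q A) * (q ^ β * (√(qInt q B) / qInt q C))| ≤ (q⁻¹ - q)⁻¹ * q ^ (-6 : ℝ) := by
  have hc := inv_sub_pos h0 h1
  obtain ⟨i0, i1⟩ := qInt_inv_le h0 h1 hC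
  have pα := Real.rpow_pos_of_pos h0 α
  have pβ := Real.rpow_pos_of_pos h0 β
  rw [div_eq_mul_inv, abs_of_nonneg (by positivity)]
  calc q ^ α * √(qInt q A) * (q ^ β * (√(qInt q B) * (qInt q C)⁻¹))
      ≤ q ^ α * (√((q⁻¹ - q)⁻¹) * q ^ (-A / 2)) *
        (q ^ β * ((√((q⁻¹ - q)⁻¹) * q ^ (-B / 2)) * q ^ (C - 1))) := by
        have := sqrt_qInt_le h0 h1 A
        have := sqrt_qInt_le h0 h1 B
        gcongr
    _ = (√((q⁻¹ - q)⁻¹) * √((q⁻¹ - q)⁻¹)) *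
        (q ^ α * q ^ (-A / 2) * q ^ β * q ^ (-B / 2) * q ^ (C - 1)) := by ring
    _ = (q⁻¹ - q)⁻¹ * q ^ (α + -A / 2 + β + -B / 2 + (C - 1)) := by
        rw [Real.mul_self_sqrt (by positivity), Real.rpow_add h0, Real.rpow_add h0,
          Real.rpow_add h0, Real.rpow_add h0]
    _ ≤ (q⁻¹ - q)⁻¹ * q ^ (-6 : ℝ) := by
        refine mul_le_mul_of_nonneg_left ?_ (by positivity)
        exact Real.rpow_le_rpow_of_exponent_ge h0 h1.le (by linarith)

theorem coeff_bound' (h0 : 0 < q) (h1 : q < 1) (α A B C : ℝ) (hC : 1 ≤ C) (hE : -4 ≤ α - A / 2 - B / 2 + C) :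
    |q ^ α * √(qInt q A) * (√(qInt q B) / qInt q C)| ≤ (q⁻¹ - q)⁻¹ * q ^ (-6 : ℝ) := by
  have := coeff_bound h0 h1 α A 0 B C hC (by linarith)
  simpa using this

theorem coeff_bound₂ (h0 : 0 < q) (h1 : q < 1) (α A β B C D : ℝ) (hC : 1 ≤ C) (hD : 1 ≤ D)
    (hE : -4 ≤ α - A / 2 + β - B / 2 + C) :
    |q ^ α * √(qInt q A) * (q ^ β * (√(qInt q B) / (qInt q C * qInt q D)))|
      ≤ (q⁻¹ - q)⁻¹ * q ^ (-6 : ℝ) := by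
  obtain ⟨i0, i1⟩ := qInt_inv_le h0 h1 hD
  have i2 : (qInt q D)⁻¹ ≤ 1 := i1.trans (Real.rpow_le_one h0.le h1.le (by linarith))
  have e : q ^ α * √(qInt q A) * (q ^ β * (√(qInt q B) / (qInt q C * qInt q D)))
      = q ^ α * √(qInt q A) * (q ^ β * (√(qInt q B) / qInt q C)) * (qInt q D)⁻¹ := by
    rw [div_eq_mul_inv, div_eq_mul_inv, mul_inv]; ring
  rw [e, abs_mul, abs_of_nonneg i0]
  calc _ ≤ |q ^ α * √(qInt q A) * (q ^ β * (√(qInt q B) / qInt q C))| * 1 := by gcongr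
    _ ≤ _ := by rw [mul_one]; exact coeff_bound h0 h1 α A β B C hC hE

theorem coeff_bound_zero (h0 : 0 < q) (h1 : q < 1) : |(0 : ℝ)| ≤ (q⁻¹ - q)⁻¹ * q ^ (-6 : ℝ) := by
  have hc := inv_sub_pos h0 h1
  have := Real.rpow_pos_of_pos h0 (-6)
  rw [abs_zero]; positivity

theorem aPlus_bounded (h0 : 0 < q) (h1 : q < 1) : MatBounded (aPlusMat q) := by
  refine ⟨(q⁻¹ - q)⁻¹ * q ^ (-6 : ℝ), fun j μ n hj hμ => ⟨fun hn s' => ?_, fun hj' hn s' => ?_⟩⟩ <;>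
  · rw [abs_le] at hμ hn
    have hs : s' = 0 ∨ s' = 1 := by omega
    rcases hs with rfl | rfl <;>
    simp only [aPlusMat, Matrix.smul_apply, Matrix.of_apply, Matrix.cons_val', Matrix.cons_val_zero,
      Matrix.cons_val_one, Matrix.cons_val_fin_one, smul_eq_mul, mul_zero] <;>
    first
    | exact coeff_bound_zero h0 h1
    | exact coeff_bound h0 h1 _ _ _ _ _ (by linarith) (by linarith)
    | exact coeff_bound₂ h0 h1 _ _ _ _ _ _ (by linarith) (by linarith) (by linarith)

theorem aMinus_bounded (h0 : 0 < q) (h1 : q < 1) : MatBounded (aMinusMat q) := by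
  refine ⟨(q⁻¹ - q)⁻¹ * q ^ (-6 : ℝ), fun j μ n hj hμ => ⟨fun hn s' => ?_, fun hj' hn s' => ?_⟩⟩ <;>
  · rw [abs_le] at hμ hn
    have hs : s' = 0 ∨ s' = 1 := by omega
    rcases hs with rfl | rfl <;>
    simp only [aMinusMat, Matrix.smul_apply, Matrix.of_apply, Matrix.cons_val',
      Matrix.cons_val_zero, Matrix.cons_val_one, Matrix.cons_val_fin_one, smul_eq_mul, mul_zero,
      mul_neg, abs_neg] <;>
    first
    | exact coeff_bound_zero h0 h1
    | exact coeff_bound h0 h1 _ _ _ _ _ (by linarith) (by linarith)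
    | exact coeff_bound₂ h0 h1 _ _ _ _ _ _ (by linarith) (by linarith) (by linarith)

theorem bPlus_bounded (h0 : 0 < q) (h1 : q < 1) : MatBounded (bPlusMat q) := by
  refine ⟨(q⁻¹ - q)⁻¹ * q ^ (-6 : ℝ), fun j μ n hj hμ => ⟨fun hn s' => ?_, fun hj' hn s' => ?_⟩⟩ <;>
  · rw [abs_le] at hμ hn
    have hs : s' = 0 ∨ s' = 1 := by omega
    rcases hs with rfl | rfl <;>
    simp only [bPlusMat, Matrix.smul_apply, Matrix.of_apply, Matrix.cons_val',
      Matrix.cons_val_zero, Matrix.cons_val_one, Matrix.cons_val_fin_one, smul_eq_mul, mul_zero,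
      mul_neg, abs_neg] <;>
    first
    | exact coeff_bound_zero h0 h1
    | exact coeff_bound h0 h1 _ _ _ _ _ (by linarith) (by linarith)
    | exact coeff_bound' h0 h1 _ _ _ _ (by linarith) (by linarith)
    | exact coeff_bound₂ h0 h1 _ _ _ _ _ _ (by linarith) (by linarith) (by linarith)

theorem bMinus_bounded (h0 : 0 < q) (h1 : q < 1) : MatBounded (bMinusMat q) := by
  refine ⟨(q⁻¹ - q)⁻¹ * q ^ (-6 : ℝ), fun j μ n hj hμ => ⟨fun hn s' => ?_, fun hj' hn s' => ?_⟩⟩ <;>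
  · rw [abs_le] at hμ hn
    have hs : s' = 0 ∨ s' = 1 := by omega
    rcases hs with rfl | rfl <;>
    simp only [bMinusMat, Matrix.smul_apply, Matrix.of_apply, Matrix.cons_val',
      Matrix.cons_val_zero, Matrix.cons_val_one, Matrix.cons_val_fin_one, smul_eq_mul, mul_zero,
      mul_neg, abs_neg] <;>
    first
    | exact coeff_bound_zero h0 h1
    | exact coeff_bound h0 h1 _ _ _ _ _ (by linarith) (by linarith)
    | exact coeff_bound' h0 h1 _ _ _ _ (by linarith) (by linarith)
    | exact coeff_bound₂ h0 h1 _ _ _ _ _ _ (by linarith) (by linarith) (by linarith)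

end Coeff

/-! #### The operators -/

section Operators
variable (q : Par)

/-- `a_+`: shifts `j`, `μ`, `n` by `+1/2, +1/2, +1/2`. -/
def aPlus : BSpinor := spinOp (aPlusMat q) 1 1 1 (aPlus_bounded q.2.1 q.2.2)

/-- `a_-`: shifts `j`, `μ`, `n` by `-1/2, +1/2, +1/2`. -/
def aMinus : BSpinor := spinOp (aMinusMat q) (-1) 1 1 (aMinus_bounded q.2.1 q.2.2)

/-- `b_+`: shifts `j`, `μ`, `n` by `+1/2, +1/2, -1/2`. -/
def bPlus : BSpinor := spinOp (bPlusMat q) 1 1 (-1) (bPlus_bounded q.2.1 q.2.2)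

/-- `b_-`: shifts `j`, `μ`, `n` by `-1/2, +1/2, -1/2`. -/
def bMinus : BSpinor := spinOp (bMinusMat q) (-1) 1 (-1) (bMinus_bounded q.2.1 q.2.2)

/-- The algebra `A = A(SU_q(2))` represented on spinors: the unital `*`-algebra of operators
generated by `π(a) = a_+ + a_-` and `π(b) = b_+ + b_-`, i.e. the range of the spinor
representation. -/
def spinAlg : StarSubalgebra ℂ BSpinor :=
  StarAlgebra.adjoin ℂ {aPlus q + aMinus q, bPlus q + bMinus q}

/-- The projector `P^↑` (`s = 0`) or `P^↓` (`s = 1`). -/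
def spinProj (s : Fin 2) : BSpinor :=
  shiftOp (fun k => if k.s = s then 1 else 0) some
    ⟨1, fun k => by by_cases h : k.s = s <;> simp [h]⟩
    (fun i i' k h h' => by simp at h h'; rw [h, h'])

/-- The diagonal part `P^↑ T P^↑ + P^↓ T P^↓`. -/
def diagPart (T : BSpinor) : BSpinor :=
  spinProj 0 * T * spinProj 0 + spinProj 1 * T * spinProj 1

/-- The off-diagonal operator `P^↓ T₊ P^↑ + P^↑ T₋ P^↓`. -/
def offDiag (Tp Tm : BSpinor) : BSpinor :=
  spinProj 1 * Tp * spinProj 0 + spinProj 0 * Tm * spinProj 1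

end Operators

/-! ### The Dirac operator, the derivation `δ`, and smoothing operators -/

/-- The eigenvalue of the Dirac operator on `|j μ n s⟩`: `2j + 3/2` for `↑`, `-2j - 1/2` for
`↓`. -/
def diracEv (k : SpinIdx) : ℝ := if k.s = 0 then 2 * k.j + 3 / 2 else -2 * k.j - 1 / 2

/-- The diagonal operator with real eigenvalues `d k`, on its maximal domain. -/
def diagOp (d : SpinIdx → ℝ) : Spinor →ₗ.[ℂ] Spinor where
  domain :=
    { carrier := {ξ | Memℓp (fun k => (d k : ℂ) * ξ k) 2}
      add_mem' := fun {ξ η} h h' => by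
        have := h.add h'
        refine (congrArg (fun f : SpinIdx → ℂ => Memℓp f 2) ?_).mp this
        funext k; exact (mul_add _ _ _).symm
      zero_mem' := by
        refine (congrArg (fun f : SpinIdx → ℂ => Memℓp f 2) ?_).mp (zero_memℓp)
        funext k; exact (mul_zero _).symm
      smul_mem' := fun c ξ h => by
        have := h.const_smul c
        refine (congrArg (fun f : SpinIdx → ℂ => Memℓp f 2) ?_).mp this
        funext k; exact mul_left_comm _ _ _ }
  toFun :=
    { toFun := fun ξ => ⟨fun k => (d k : ℂ) * ξ.1 k, ξ.2⟩
      map_add' := fun ξ η => by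
        ext k; exact mul_add _ _ _
      map_smul' := fun c ξ => by
        ext k; exact mul_left_comm _ _ _ }

theorem diagOp_apply (d : SpinIdx → ℝ) (ξ : (diagOp d).domain) (k : SpinIdx) :
    diagOp d ξ k = (d k : ℂ) * (ξ : Spinor) k := rfl

/-- The Dirac operator `D`. -/
def dirac : Spinor →ₗ.[ℂ] Spinor := diagOp diracEv

/-- The real power `|D|^z`. -/
def absDiracPow (z : ℝ) : Spinor →ₗ.[ℂ] Spinor := diagOp fun k => |diracEv k| ^ z

/-- The modulus `|D| = (D²)^{1/2}`. -/
def absDirac : Spinor →ₗ.[ℂ] Spinor := diagOp fun k => |diracEv k|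

/-- `T` lies in the domain of `δ` and `δ(T) = S`: `T` preserves the domain of `|D|`, and
`|D| T - T |D|` extends to the bounded operator `S`. -/
def IsDelta (T S : BSpinor) : Prop :=
  ∀ ξ : absDirac.domain, ∃ h : T ξ ∈ absDirac.domain,
    absDirac ⟨T ξ, h⟩ - T (absDirac ξ) = S ξ

/-- `T` lies in the domain of `δⁿ` and `δⁿ(T) = S`. -/
def IsDeltaPow : ℕ → BSpinor → BSpinor → Prop
  | 0, T, S => S = T
  | n + 1, T, S => ∃ R, IsDeltaPow n T R ∧ IsDelta R S

/-- `T` lies in the smooth domain `⋂ₙ Dom δⁿ`. -/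
def InSmoothDomain (T : BSpinor) : Prop := ∀ n, ∃ S, IsDeltaPow n T S

/-- The space `𝓗^∞ = ⋂_{s ≥ 0} Dom (1 + D²)^{s/2}`. -/
def Hinf : Submodule ℂ Spinor :=
  ⨅ s : {s : ℝ // 0 ≤ s}, (diagOp fun k => (1 + diracEv k ^ 2) ^ ((s : ℝ) / 2)).domain

/-- `T : 𝓗^∞ → 𝓗^∞` lies in `OP^α`: `|D|^{-α} T` extends to a bounded operator in the smooth
domain of `δ`. -/
def IsOP (α : ℝ) (T : Hinf →ₗ[ℂ] Hinf) : Prop :=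
  ∃ S : BSpinor, InSmoothDomain S ∧
    ∀ ξ : Hinf, ∃ h : (T ξ : Spinor) ∈ (absDiracPow (-α)).domain,
      absDiracPow (-α) ⟨T ξ, h⟩ = S ξ

/-- The bounded operator `R` is smoothing: it restricts to an operator `𝓗^∞ → 𝓗^∞` in
`OP^{-∞} = ⋂_{α ≤ 0} OP^α`. -/
def IsSmoothing (R : BSpinor) : Prop :=
  ∃ T : Hinf →ₗ[ℂ] Hinf, (∀ ξ : Hinf, (T ξ : Spinor) = R ξ) ∧ ∀ α : ℝ, α ≤ 0 → IsOP α T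

/-! ### The algebra `𝓑` and the symbol map -/

/-- The algebra `𝓑` generated by all `δⁿ(A)`, `n ≥ 0`. -/
def algB (q : Par) : StarSubalgebra ℂ BSpinor :=
  StarAlgebra.adjoin ℂ (⋃ n : ℕ, {S | ∃ T ∈ spinAlg q, IsDeltaPow n T S})

/-- The label of `|j μ n s⟩` in `ℓ²(ℕ)_x ⊗ ℓ²(ℕ)_y ⊗ ℓ²(ℤ)_{2j} ⊗ ℂ²`: `x = j + μ`, and
`y = j + n + 1/2` for `↑`, `y = j + n - 1/2` for `↓`. -/
def relabel (k : SpinIdx) : BigIdx :=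
  (((k.J + k.M) / 2).toNat, ((k.J + k.N + (if k.s = 0 then 1 else -1)) / 2).toNat, k.J, k.s)

theorem relabel_injective : Function.Injective relabel := by
  rintro ⟨J, M, N, s, h0, h1, ⟨c, h2⟩, h3, ⟨d, h4⟩⟩
    ⟨J', M', N', s', h0', h1', ⟨c', h2'⟩, h3', ⟨d', h4'⟩⟩ h
  simp only [relabel, Prod.mk.injEq] at h
  obtain ⟨e1, e2, e3, e4⟩ := h
  subst e3; subst e4
  rw [abs_le] at h1 h1' h3 h3'
  by_cases hs : s = 0
  · simp only [hs, if_true] at h3 h3' e2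
    refine SpinIdx.ext' rfl ?_ ?_ rfl <;> simp only <;> omega
  · simp only [hs, if_false] at h3 h3' e2
    refine SpinIdx.ext' rfl ?_ ?_ rfl <;> simp only <;> omega

/-- The isometric inclusion of the spinors, with range `𝓗'`. -/
def incl : Spinor →L[ℂ] Ell2 BigIdx :=
  shiftOp (fun _ => 1) (fun k => some (relabel k)) ⟨1, by simp⟩
    (fun i i' k h h' => relabel_injective (Option.some.inj (h.trans h'.symm)))

/-- The compression `Q X Q` to `𝓗' = 𝓗`, where `Q = ι ι^*` is the orthogonal projector onto the
range of the inclusion `ι`; as an operator on `𝓗` it is `ι^* X ι`. -/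
def compress (X : Ell2 BigIdx →L[ℂ] Ell2 BigIdx) : BSpinor :=
  ContinuousLinearMap.adjoint incl ∘L X ∘L incl

/-- `ã_+ = P^↑ a_+ P^↑ + P^↓ a_+ P^↓`, and similarly below. -/
def aTildePlus (q : Par) : BSpinor := diagPart (aPlus q)
/-- `ã_-` -/
def aTildeMinus (q : Par) : BSpinor := diagPart (aMinus q)
/-- `b̃_+` -/
def bTildePlus (q : Par) : BSpinor := diagPart (bPlus q)
/-- `b̃_-` -/
def bTildeMinus (q : Par) : BSpinor := diagPart (bMinus q)
/-- `P^↓ a_+ P^↑ + P^↑ a_- P^↓` -/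
def aOff (q : Par) : BSpinor := offDiag (aPlus q) (aMinus q)
/-- `P^↓ b_+ P^↑ + P^↑ b_- P^↓` -/
def bOff (q : Par) : BSpinor := offDiag (bPlus q) (bMinus q)

section Values
variable (q : Par)

/-- `r_+(a) ⊗ r_-(a) ⊗ u` -/
def symAPlus : SymbolAlg q :=
  r q 1 (SUq2.a q) ⊗ₜ (r q (-1) (SUq2.a q) ⊗ₜ u)

/-- `-q r_+(b) ⊗ r_-(b^*) ⊗ u^*` -/
def symAMinus : SymbolAlg q :=
  -(((q : ℝ) : ℂ) • (r q 1 (SUq2.b q) ⊗ₜ (r q (-1) (star (SUq2.b q)) ⊗ₜ star u)))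

/-- `-r_+(a) ⊗ r_-(b) ⊗ u` -/
def symBPlus : SymbolAlg q :=
  -(r q 1 (SUq2.a q) ⊗ₜ (r q (-1) (SUq2.b q) ⊗ₜ u))

/-- `-r_+(b) ⊗ r_-(a^*) ⊗ u^*` -/
def symBMinus : SymbolAlg q :=
  -(r q 1 (SUq2.b q) ⊗ₜ (r q (-1) (star (SUq2.a q)) ⊗ₜ star u))

/-- `ρ` is a symbol map: it has the prescribed values on the generators of `𝓑`. -/
structure IsSymbolMap (ρ : algB q →⋆ₐ[ℂ] SymbolAlg q) : Prop where
  aPlus : ∃ h : aTildePlus q ∈ algB q, ρ ⟨aTildePlus q, h⟩ = symAPlus q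
  aMinus : ∃ h : aTildeMinus q ∈ algB q, ρ ⟨aTildeMinus q, h⟩ = symAMinus q
  bPlus : ∃ h : bTildePlus q ∈ algB q, ρ ⟨bTildePlus q, h⟩ = symBPlus q
  bMinus : ∃ h : bTildeMinus q ∈ algB q, ρ ⟨bTildeMinus q, h⟩ = symBMinus q
  aOff : ∃ h : aOff q ∈ algB q, ρ ⟨aOff q, h⟩ = 0
  bOff : ∃ h : bOff q ∈ algB q, ρ ⟨bOff q, h⟩ = 0

end Values

/-- The algebra `A(S_q^*)` of the cosphere bundle: the range of the symbol map. -/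
def cosphereBundle (q : Par) (ρ : algB q →⋆ₐ[ℂ] SymbolAlg q) : StarSubalgebra ℂ (SymbolAlg q) :=
  ρ.range

end QSU2
end

noncomputable section
open scoped TensorProduct ComplexConjugate InnerProductSpace

namespace QSU2

/-! ### Operators on `ℓ²` through their matrix coefficients -/

section Matrix
variable {ι κ : Type}

/-! Everything is measured against the degree 2j. Put t = √q and let Λ be the diagonal operator
t^(2j). An operator is exponentially small if it equals Λ S Λ with S bounded. Such operators are
smoothing: t^(2j) beats every power of |D|, and δ only multiplies the weights by |D|
(`ExpSmall.isSmoothing`). So it suffices to compute modulo exponentially small operators.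

Generators of 𝓑: on a sum of a raising part, a lowering part and a spin-flipping part, δ has the
eigenvalues 1, -1, 0. The spin flips commute with |D| because |D| is 2j + 3/2 on ↑ and 2j + 1/2 on
↓, and a flip ↑ → ↓ raises 2j by one. Hence T, δ(T), δ²(T) determine the three parts linearly.
Conversely the six parts are eigenvectors of a derivation that respects adjoints up to sign, so the
algebra that they generate is stable under δ (`algB_eq`).

Coefficients: since [N] = q^(-N) (1 - q^(2N)) / (q⁻¹ - q), the diagonal entries become, in the
coordinates x = j + μ and y = j + n ± 1/2, a power of q times √(1 - u) √(1 - v) / (1 - w). The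
factors that are absent from the prescribed tensors can be replaced by 1 at a cost of order q^(2j),
thanks to the power of q in front. The off-diagonal entries have a second q-integer in the
denominator and are themselves of order q^(2j).

Symbols: with ι the inclusion of the spinors, `HasSymbol` says that z ι - ι T and ι^* z - T ι^* are
exponentially small and that T and z can be moved past Λ. This relation is stable under all
operations of a *-algebra. It determines z: the matrix coefficients of z ⊗ 1₂ do not depend on 2j,
whereas those of an exponentially small operator tend to 0 as 2j grows, and the matrix coefficients
separate the elements of the tensor product (`HasSymbol.eq_zero`, `symbol_eq_zero`). Therefore the
*-algebra generated by the six pairs (generator, prescribed value) is the graph of a function on 𝓑.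
That function is ρ, the second projection of the graph is its range, and T - ι^* z ι = -ι^* (z ι - ι
T) is smoothing. -/

theorem hasSum_coeff (T : Ell2 ι →L[ℂ] Ell2 κ) (f : Ell2 ι) (k : κ) :
    HasSum (fun i => f i * T (basisVec i) k) (T f k) := by
  classical
  have hf := lp.hasSum_single (p := 2) (by norm_num) f
  have e : ∀ i, (lp.single 2 i (f i) : Ell2 ι) = f i • basisVec i := by
    intro i
    rw [basisVec, ← lp.single_smul]; simp
  have h := (hf.mapL T).mapL (innerSL ℂ (basisVec k : Ell2 κ))
  simpa only [e, map_smul, innerSL_apply_apply, ← apply_eq_inner, smul_eq_mul] using h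

theorem clm_ext_coeff {S T : Ell2 ι →L[ℂ] Ell2 κ}
    (h : ∀ i k, S (basisVec i) k = T (basisVec i) k) : S = T :=
  clm_ext fun i => by ext k; exact h i k

open Classical in
theorem basisVec_apply (i k : ι) : (basisVec i : Ell2 ι) k = if k = i then 1 else 0 := by
  split_ifs with h
  · rw [h, basisVec_self]
  · exact basisVec_ne h

theorem norm_basisVec (i : ι) : ‖(basisVec i : Ell2 ι)‖ = 1 := by
  classical
  rw [basisVec, lp.norm_single (by norm_num)]; simp

theorem norm_coeff_le (f : Ell2 ι) (i : ι) : ‖f i‖ ≤ ‖f‖ :=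
  lp.norm_apply_le_norm (by norm_num) f i

theorem adjoint_coeff (T : Ell2 ι →L[ℂ] Ell2 κ) (k : κ) (i : ι) :
    ContinuousLinearMap.adjoint T (basisVec k) i = conj (T (basisVec i) k) :=
  adjoint_basisVec_apply T k i

end Matrix

/-! ### Bounded diagonal operators -/

section Diag
variable {ι κ : Type}

/-- The bounded diagonal operator with entries `w i`. -/
def bddDiag (w : ι → ℂ) (hw : ∃ C, ∀ i, ‖w i‖ ≤ C) : Ell2 ι →L[ℂ] Ell2 ι :=
  shiftOp w some hw fun i i' k h h' => by simp at h h'; rw [h, h']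

theorem bddDiag_basisVec (w : ι → ℂ) (hw : ∃ C, ∀ i, ‖w i‖ ≤ C) (i : ι) :
    bddDiag w hw (basisVec i) = w i • basisVec i := shiftOp_basisVec _ _ _ _ _

theorem bddDiag_apply (w : ι → ℂ) (hw : ∃ C, ∀ i, ‖w i‖ ≤ C) (f : Ell2 ι) (i : ι) :
    bddDiag w hw f i = w i * f i := by
  have h := hasSum_coeff (bddDiag w hw) f i
  refine h.unique ?_
  convert hasSum_single (f := fun j => f j * bddDiag w hw (basisVec j) i) i ?_ using 1
  · simp [bddDiag_basisVec, basisVec_self, mul_comm]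
  · intro j hj
    simp [bddDiag_basisVec, basisVec_ne hj.symm]

theorem adjoint_bddDiag (w : ι → ℂ) (hw : ∃ C, ∀ i, ‖w i‖ ≤ C) (hr : ∀ i, conj (w i) = w i) :
    ContinuousLinearMap.adjoint (bddDiag w hw) = bddDiag w hw := by
  refine clm_ext_coeff fun i k => ?_
  rw [adjoint_coeff, bddDiag_basisVec, bddDiag_basisVec]
  by_cases h : i = k
  · subst h; simp [basisVec_self, hr]
  · simp [basisVec_ne h, basisVec_ne (Ne.symm h)]

theorem pow_par_bdd (t : Par) (J : ι → ℕ) : ∃ C, ∀ i, ‖(((t : ℝ) : ℂ)) ^ J i‖ ≤ C :=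
  ⟨1, fun i => by
    rw [norm_pow, Complex.norm_real, Real.norm_of_nonneg t.2.1.le]
    exact pow_le_one₀ t.2.1.le t.2.2.le⟩

/-- The operator `e_i ↦ t ^ J(i) e_i`. -/
def decay (t : Par) (J : ι → ℕ) : Ell2 ι →L[ℂ] Ell2 ι :=
  bddDiag (fun i => ((t : ℝ) : ℂ) ^ J i) (pow_par_bdd t J)

theorem decay_basisVec (t : Par) (J : ι → ℕ) (i : ι) :
    decay t J (basisVec i) = ((t : ℝ) : ℂ) ^ J i • basisVec i := bddDiag_basisVec _ _ _

theorem decay_apply (t : Par) (J : ι → ℕ) (f : Ell2 ι) (i : ι) :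
    decay t J f i = ((t : ℝ) : ℂ) ^ J i * f i := bddDiag_apply _ _ _ _

theorem adjoint_decay (t : Par) (J : ι → ℕ) :
    ContinuousLinearMap.adjoint (decay t J) = decay t J :=
  adjoint_bddDiag _ _ fun i => by rw [map_pow, Complex.conj_ofReal]

/-- Operators that can be moved past the decay operator in both directions. -/
def decayAlg (t : Par) (J : ι → ℕ) : StarSubalgebra ℂ (Ell2 ι →L[ℂ] Ell2 ι) where
  carrier := {T | (∃ S, decay t J * T = S * decay t J) ∧ ∃ S, T * decay t J = decay t J * S}
  mul_mem' := by
    rintro T T' ⟨⟨S₁, h₁⟩, S₂, h₂⟩ ⟨⟨S₁', h₁'⟩, S₂', h₂'⟩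
    refine ⟨⟨S₁ * S₁', ?_⟩, S₂ * S₂', ?_⟩
    · rw [← mul_assoc, h₁, mul_assoc, h₁', mul_assoc]
    · rw [mul_assoc, h₂', ← mul_assoc, h₂, mul_assoc]
  add_mem' := by
    rintro T T' ⟨⟨S₁, h₁⟩, S₂, h₂⟩ ⟨⟨S₁', h₁'⟩, S₂', h₂'⟩
    exact ⟨⟨S₁ + S₁', by rw [mul_add, h₁, h₁', add_mul]⟩,
      S₂ + S₂', by rw [add_mul, h₂, h₂', mul_add]⟩
  algebraMap_mem' c := ⟨⟨_, (Algebra.commutes c _).symm⟩, _, Algebra.commutes c _⟩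
  -- Λ is self-adjoint, so taking adjoints interchanges the two conditions. This is why both are
  -- imposed.
  star_mem' := by
    have e : star (decay t J) = decay t J := adjoint_decay t J
    rintro T ⟨⟨S₁, h₁⟩, S₂, h₂⟩
    refine ⟨⟨star S₂, ?_⟩, star S₁, ?_⟩
    · have := congrArg star h₂
      rwa [star_mul, star_mul, e] at this
    · have := congrArg star h₁
      rwa [star_mul, star_mul, e] at this

/-- `X` is exponentially small on both sides: `X = Λ S Λ` with a bounded operator `S`. -/
def ExpSmall (t : Par) (J : ι → ℕ) (J' : κ → ℕ) (X : Ell2 ι →L[ℂ] Ell2 κ) : Prop :=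
  ∃ S : Ell2 ι →L[ℂ] Ell2 κ, X = decay t J' ∘L S ∘L decay t J

namespace ExpSmall
variable {t : Par} {J : ι → ℕ} {J' : κ → ℕ} {X Y : Ell2 ι →L[ℂ] Ell2 κ}

theorem zero : ExpSmall t J J' (0 : Ell2 ι →L[ℂ] Ell2 κ) := ⟨0, by simp⟩

theorem add (hX : ExpSmall t J J' X) (hY : ExpSmall t J J' Y) : ExpSmall t J J' (X + Y) := by
  obtain ⟨S, rfl⟩ := hX
  obtain ⟨R, rfl⟩ := hY
  exact ⟨S + R, by simp⟩

theorem smul (c : ℂ) (hX : ExpSmall t J J' X) : ExpSmall t J J' (c • X) := by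
  obtain ⟨S, rfl⟩ := hX
  exact ⟨c • S, by simp⟩

theorem neg (hX : ExpSmall t J J' X) : ExpSmall t J J' (-X) := by
  obtain ⟨S, rfl⟩ := hX
  exact ⟨-S, by simp⟩

theorem adjoint (hX : ExpSmall t J J' X) :
    ExpSmall t J' J (ContinuousLinearMap.adjoint X) := by
  obtain ⟨S, rfl⟩ := hX
  refine ⟨ContinuousLinearMap.adjoint S, ?_⟩
  rw [ContinuousLinearMap.adjoint_comp, ContinuousLinearMap.adjoint_comp, adjoint_decay,
    adjoint_decay, ContinuousLinearMap.comp_assoc]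

/-- Multiplication from the left by an operator that intertwines decay operators. -/
theorem comp_left {μ : Type} {J'' : μ → ℕ} (hX : ExpSmall t J J' X)
    {T R : Ell2 κ →L[ℂ] Ell2 μ} (hT : T ∘L decay t J' = decay t J'' ∘L R) :
    ExpSmall t J J'' (T ∘L X) := by
  obtain ⟨S, rfl⟩ := hX
  refine ⟨R ∘L S, ?_⟩
  rw [← ContinuousLinearMap.comp_assoc, hT]
  simp only [ContinuousLinearMap.comp_assoc]

theorem comp_right {μ : Type} {J'' : μ → ℕ} (hX : ExpSmall t J J' X)
    {T R : Ell2 μ →L[ℂ] Ell2 ι} (hT : decay t J ∘L T = R ∘L decay t J'') :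
    ExpSmall t J'' J' (X ∘L T) := by
  obtain ⟨S, rfl⟩ := hX
  refine ⟨S ∘L R, ?_⟩
  simp only [ContinuousLinearMap.comp_assoc, hT]

theorem mul_left (hX : ExpSmall t J J' X) {T : Ell2 κ →L[ℂ] Ell2 κ} (hT : T ∈ decayAlg t J') :
    ExpSmall t J J' (T ∘L X) := by
  obtain ⟨-, R, hR⟩ := hT
  exact hX.comp_left hR

theorem mul_right (hX : ExpSmall t J J' X) {T : Ell2 ι →L[ℂ] Ell2 ι} (hT : T ∈ decayAlg t J) :
    ExpSmall t J J' (X ∘L T) := by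
  obtain ⟨⟨R, hR⟩, -⟩ := hT
  exact hX.comp_right hR

end ExpSmall

/-- A weighted partial shift that changes the degree by at most one and has coefficients of order
`t ^ (2 J)` is exponentially small. -/
theorem ExpSmall.of_shift {t : Par} {J : ι → ℕ} {J' : κ → ℕ} {X : Ell2 ι →L[ℂ] Ell2 κ}
    (w : ι → ℂ) (σ : ι → Option κ)
    (hX : ∀ i, X (basisVec i) = w i • (σ i).elim 0 basisVec)
    (hσ : ∀ i i' k, σ i = some k → σ i' = some k → i = i') (C : ℝ)
    (hw : ∀ i k, σ i = some k → J' k ≤ J i + 1 ∧ ‖w i‖ ≤ C * (t : ℝ) ^ (2 * J i)) :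
    ExpSmall t J J' X := by
  have h0 := t.2.1
  have h0' : ((t : ℝ) : ℂ) ≠ 0 := by exact_mod_cast h0.ne'
  -- S has to carry the coefficient w i / (t^(J' k) t^(J i)). As J' k ≤ J i + 1, the denominator is
  -- at least t^(2 J i + 1), which leaves the bound |C| t⁻¹.
  refine ⟨shiftOp (fun i => (σ i).elim 0 fun k =>
    w i * ((((t : ℝ) : ℂ) ^ J' k)⁻¹ * (((t : ℝ) : ℂ) ^ J i)⁻¹)) σ ⟨|C| * (t : ℝ)⁻¹, fun i => ?_⟩ hσ,
    clm_ext fun i => ?_⟩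
  · cases h : σ i with
    | none => simp only [Option.elim_none, norm_zero]; positivity
    | some k =>
      obtain ⟨h1, h2⟩ := hw i k h
      simp only [Option.elim_some, norm_mul, norm_inv, norm_pow, Complex.norm_real,
        Real.norm_of_nonneg h0.le]
      have h3 : (t : ℝ) ^ (J i + 1) ≤ (t : ℝ) ^ J' k :=
        pow_le_pow_of_le_one h0.le t.2.2.le h1
      have h4 : ((t : ℝ) ^ J' k)⁻¹ ≤ ((t : ℝ) ^ (J i + 1))⁻¹ := by gcongr
      calc ‖w i‖ * (((t : ℝ) ^ J' k)⁻¹ * ((t : ℝ) ^ J i)⁻¹)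
          ≤ (|C| * (t : ℝ) ^ (2 * J i)) * (((t : ℝ) ^ (J i + 1))⁻¹ * ((t : ℝ) ^ J i)⁻¹) := by
            have : ‖w i‖ ≤ |C| * (t : ℝ) ^ (2 * J i) := h2.trans (by gcongr; exact le_abs_self C)
            gcongr
        _ = |C| * (t : ℝ)⁻¹ := by field_simp; ring
  · rw [hX, ContinuousLinearMap.comp_apply, ContinuousLinearMap.comp_apply, decay_basisVec,
      map_smul, map_smul, shiftOp_basisVec, map_smul, smul_smul]
    cases h : σ i with
    | none => simp
    | some k =>
      simp only [Option.elim_some, decay_basisVec, smul_smul]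
      congr 1
      field_simp

/-- A bounded weighted partial shift that changes the degree by at most one can be moved past the
decay operator. -/
theorem mem_decayAlg_of_shift {t : Par} {J : ι → ℕ} {X : Ell2 ι →L[ℂ] Ell2 ι}
    (w : ι → ℂ) (σ : ι → Option ι)
    (hX : ∀ i, X (basisVec i) = w i • (σ i).elim 0 basisVec)
    (hw : ∃ C, ∀ i, ‖w i‖ ≤ C)
    (hσ : ∀ i i' k, σ i = some k → σ i' = some k → i = i')
    (hJ : ∀ i k, σ i = some k → J k ≤ J i + 1 ∧ J i ≤ J k + 1) :
    X ∈ decayAlg t J := by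
  have h0 := t.2.1
  have h0' : ((t : ℝ) : ℂ) ≠ 0 := by exact_mod_cast h0.ne'
  obtain ⟨C, hC⟩ := hw
  have key : ∀ m n : ℕ, n ≤ m + 1 → (t : ℝ) ^ m * ((t : ℝ) ^ n)⁻¹ ≤ (t : ℝ)⁻¹ := by
    intro m n hmn
    have h3 : (t : ℝ) ^ (m + 1) ≤ (t : ℝ) ^ n := pow_le_pow_of_le_one h0.le t.2.2.le hmn
    rw [mul_inv_le_iff₀ (by positivity), inv_mul_eq_div, le_div_iff₀ h0, ← pow_succ]
    exact h3
  -- Conjugation by Λ multiplies the coefficient of i → k by t^(J i - J k) or its inverse, hence by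
  -- at most t⁻¹ when the degree moves by at most one. The functions a, b allow both directions at
  -- once.
  have bd : ∀ (a b : ι → ι → ℕ), (∀ i k, σ i = some k → b i k ≤ a i k + 1) →
      ∃ C', ∀ i, ‖(σ i).elim 0 fun k =>
        w i * ((((t : ℝ) : ℂ) ^ a i k) * (((t : ℝ) : ℂ) ^ b i k)⁻¹)‖ ≤ C' := by
    refine fun a b hab => ⟨|C| * (t : ℝ)⁻¹, fun i => ?_⟩
    cases h : σ i with
    | none => simp only [Option.elim_none, norm_zero]; positivity
    | some k =>
      simp only [Option.elim_some, norm_mul, norm_inv, norm_pow, Complex.norm_real,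
        Real.norm_of_nonneg h0.le]
      have := key _ _ (hab i k h)
      have := (hC i).trans (le_abs_self C)
      gcongr
  refine ⟨⟨shiftOp _ σ (bd (fun _ k => J k) (fun i _ => J i) fun i k h => (hJ i k h).2) hσ,
    clm_ext fun i => ?_⟩,
    shiftOp _ σ (bd (fun i _ => J i) (fun _ k => J k) fun i k h => (hJ i k h).1) hσ,
    clm_ext fun i => ?_⟩ <;>
  · rw [mul_apply_eq_comp, mul_apply_eq_comp]
    simp only [hX, decay_basisVec, map_smul, shiftOp_basisVec]
    cases h : σ i with
    | none => simp
    | some k =>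
      simp only [Option.elim_some, decay_basisVec, smul_smul]
      congr 1
      field_simp

end Diag

/-! ### The derivation `δ` through matrix coefficients -/

theorem mem_diagOp_domain {d : SpinIdx → ℝ} {ξ η : Spinor} (h : ∀ k, (d k : ℂ) * ξ k = η k) :
    ξ ∈ (diagOp d).domain := by
  change Memℓp (fun k => (d k : ℂ) * ξ k) 2
  rw [funext h]
  exact η.2

theorem absDirac_apply (ξ : absDirac.domain) (k : SpinIdx) :
    absDirac ξ k = ((|diracEv k| : ℝ) : ℂ) * (ξ : Spinor) k := rfl

theorem absDiracPow_apply (z : ℝ) (ξ : (absDiracPow z).domain) (k : SpinIdx) :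
    absDiracPow z ξ k = ((|diracEv k| ^ z : ℝ) : ℂ) * (ξ : Spinor) k := rfl

/-- Boundedness of S does the analytic work: coordinatewise |D| T ξ equals S ξ + T |D| ξ, which is
square summable, so T ξ lies in the domain of |D|. Together with the converse `IsDelta.coeff`, this
reduces δ to an entrywise rule on matrices. -/
theorem IsDelta.of_coeff {T S : BSpinor}
    (h : ∀ l k, S (basisVec l) k
      = ((|diracEv k| : ℝ) - (|diracEv l| : ℝ) : ℂ) * T (basisVec l) k) :
    IsDelta T S := by
  intro ξ
  have key : ∀ k, ((|diracEv k| : ℝ) : ℂ) * T ξ k = (S ξ + T (absDirac ξ)) k := by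
    intro k
    have h1 := (hasSum_coeff T ξ k).mul_left ((|diracEv k| : ℝ) : ℂ)
    have h2 := (hasSum_coeff S ξ k).add (hasSum_coeff T (absDirac ξ) k)
    have e : (fun l => ((|diracEv k| : ℝ) : ℂ) * ((ξ : Spinor) l * T (basisVec l) k))
        = fun l => (ξ : Spinor) l * S (basisVec l) k + absDirac ξ l * T (basisVec l) k := by
      funext l
      rw [h l k, absDirac_apply]
      ring
    rw [e] at h1
    exact h1.unique h2
  refine ⟨mem_diagOp_domain key, ?_⟩
  ext k
  rw [lp.coeFn_sub, Pi.sub_apply, absDirac_apply]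
  refine (congrArg (· - _) (key k)).trans ?_
  simp

theorem basisVec_mem_domain (d : SpinIdx → ℝ) (l : SpinIdx) :
    basisVec l ∈ (diagOp d).domain := by
  refine mem_diagOp_domain (η := (d l : ℂ) • basisVec l) fun k => ?_
  by_cases h : k = l
  · subst h; simp [-Complex.coe_smul]
  · simp [-Complex.coe_smul, basisVec_ne h]

theorem IsDelta.coeff {T S : BSpinor} (h : IsDelta T S) (l k : SpinIdx) :
    S (basisVec l) k = ((|diracEv k| : ℝ) - (|diracEv l| : ℝ) : ℂ) * T (basisVec l) k := by
  obtain ⟨h1, h2⟩ := h ⟨basisVec l, basisVec_mem_domain _ l⟩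
  have e : absDirac ⟨basisVec l, basisVec_mem_domain _ l⟩
      = ((|diracEv l| : ℝ) : ℂ) • basisVec l := by
    ext k
    rw [absDirac_apply]
    by_cases h : k = l
    · subst h; simp [-Complex.coe_smul]
    · simp [-Complex.coe_smul, basisVec_ne h]
  rw [← h2, e, lp.coeFn_sub, Pi.sub_apply, absDirac_apply, map_smul]
  simp only [lp.coeFn_smul, Pi.smul_apply, smul_eq_mul]
  ring

theorem IsDelta.unique {T S S' : BSpinor} (h : IsDelta T S) (h' : IsDelta T S') : S = S' :=
  clm_ext_coeff fun l k => by rw [h.coeff, h'.coeff]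

theorem IsDelta.add {T T' S S' : BSpinor} (h : IsDelta T S) (h' : IsDelta T' S') :
    IsDelta (T + T') (S + S') := by
  refine .of_coeff fun l k => ?_
  simp only [add_apply, lp.coeFn_add, Pi.add_apply, h.coeff l k, h'.coeff l k]
  ring

theorem IsDelta.smul {T S : BSpinor} (c : ℂ) (h : IsDelta T S) : IsDelta (c • T) (c • S) := by
  refine .of_coeff fun l k => ?_
  simp only [smul_apply, lp.coeFn_smul, Pi.smul_apply, h.coeff l k, smul_eq_mul]
  ring

theorem IsDelta.star {T S : BSpinor} (h : IsDelta T S) : IsDelta (star T) (-star S) := by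
  refine .of_coeff fun l k => ?_
  rw [neg_apply, lp.coeFn_neg, Pi.neg_apply, ContinuousLinearMap.star_eq_adjoint,
    ContinuousLinearMap.star_eq_adjoint, adjoint_coeff, adjoint_coeff, h.coeff]
  simp only [map_mul, map_sub, Complex.conj_ofReal]
  ring

theorem IsDelta.mul {T T' S S' : BSpinor} (h : IsDelta T S) (h' : IsDelta T' S') :
    IsDelta (T * T') (S * T' + T * S') := by
  intro ξ
  obtain ⟨h1, e1⟩ := h' ξ
  obtain ⟨h2, e2⟩ := h ⟨T' ξ, h1⟩
  refine ⟨h2, ?_⟩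
  change absDirac ⟨T (T' ξ), h2⟩ - T (T' (absDirac ξ)) = S (T' ξ) + T (S' ξ)
  rw [← e1, map_sub]
  refine Eq.trans ?_ (congrArg (· + _) e2)
  change _ = absDirac ⟨T (T' ξ), h2⟩ - T (absDirac ⟨T' ξ, h1⟩) + _
  abel

theorem IsDelta.algebraMap (c : ℂ) : IsDelta (algebraMap ℂ BSpinor c) 0 := by
  refine .of_coeff fun l k => ?_
  rw [Algebra.algebraMap_eq_smul_one, smul_apply, one_apply_eq_self]
  by_cases h : k = l
  · subst h; simp [-Complex.coe_smul]
  · simp [-Complex.coe_smul, basisVec_ne h]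

theorem IsDelta.zero : IsDelta 0 0 := .of_coeff fun l k => by simp

/-- Reduces iterates of δ to a single application. It serves both for the smooth domain (`rapidOps`)
and for the algebra generated by the six parts. -/
theorem isDeltaPow_of_closed {P : BSpinor → Prop} (hP : ∀ T, P T → ∃ S, P S ∧ IsDelta T S)
    {T : BSpinor} (hT : P T) (n : ℕ) : ∃ S, P S ∧ IsDeltaPow n T S := by
  induction n with
  | zero => exact ⟨T, hT, rfl⟩
  | succ n ih =>
    obtain ⟨R, hR, h⟩ := ih
    obtain ⟨S, hS, h'⟩ := hP R hR
    exact ⟨S, hS, R, h, h'⟩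

theorem IsDeltaPow.unique {T S S' : BSpinor} {n : ℕ} (h : IsDeltaPow n T S)
    (h' : IsDeltaPow n T S') : S = S' := by
  induction n generalizing S S' with
  | zero => exact h.trans h'.symm
  | succ n ih =>
    obtain ⟨R, hR, hS⟩ := h
    obtain ⟨R', hR', hS'⟩ := h'
    obtain rfl := ih hR hR'
    exact hS.unique hS'

/-! ### Exponentially small operators are smoothing -/

/-- The degree `2j`. -/
def SpinIdx.deg (k : SpinIdx) : ℕ := k.J.toNat

theorem SpinIdx.deg_cast (k : SpinIdx) : (k.deg : ℤ) = k.J := Int.toNat_of_nonneg k.isLabel.1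

theorem SpinIdx.one_le_J {k : SpinIdx} (h : k.s ≠ 0) : 1 ≤ k.J := by
  have := k.isLabel.2.2.2.1
  rw [if_neg h] at this
  have := abs_nonneg k.N
  omega

theorem abs_diracEv_eq (k : SpinIdx) :
    |diracEv k| = k.J + (if k.s = 0 then 3 / 2 else 1 / 2 : ℝ) := by
  have h : (0 : ℝ) ≤ k.J := by exact_mod_cast k.isLabel.1
  unfold diracEv SpinIdx.j
  split_ifs
  · rw [abs_of_nonneg (by positivity)]; ring
  · rw [abs_of_nonpos (by linarith)]; ring

/-- For ↓ this uses j ≥ 1/2. The bound 1 makes powers of |D| monotone in the exponent, so that real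
powers are dominated by natural ones. -/
theorem one_le_abs_diracEv (k : SpinIdx) : 1 ≤ |diracEv k| := by
  have h : (0 : ℝ) ≤ k.J := by exact_mod_cast k.isLabel.1
  rw [abs_diracEv_eq]
  split_ifs with hs
  · linarith
  · have : (1 : ℝ) ≤ k.J := by exact_mod_cast SpinIdx.one_le_J hs
    linarith

theorem abs_diracEv_le (k : SpinIdx) : |diracEv k| ≤ k.deg + 2 := by
  have : (k.deg : ℝ) = k.J := by exact_mod_cast k.deg_cast
  rw [abs_diracEv_eq, this]
  split_ifs <;> linarith

/-- Weights that decay faster than every power of `|D|`. -/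
def RapidDecay (u : SpinIdx → ℂ) : Prop :=
  ∀ n : ℕ, ∃ C, ∀ k, ‖((|diracEv k| : ℝ) : ℂ) ^ n * u k‖ ≤ C

namespace RapidDecay
variable {u : SpinIdx → ℂ}

theorem bdd (hu : RapidDecay u) : ∃ C, ∀ k, ‖u k‖ ≤ C := by simpa using hu 0

theorem mul_abs (hu : RapidDecay u) : RapidDecay fun k => ((|diracEv k| : ℝ) : ℂ) * u k :=
  fun n => by
    obtain ⟨C, hC⟩ := hu (n + 1)
    exact ⟨C, fun k => by rw [← mul_assoc, ← pow_succ]; exact hC k⟩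

theorem of_le {v : SpinIdx → ℂ} (hu : RapidDecay u) (N : ℕ)
    (h : ∀ k, ‖v k‖ ≤ |diracEv k| ^ N * ‖u k‖) : RapidDecay v := fun n => by
  obtain ⟨C, hC⟩ := hu (n + N)
  refine ⟨C, fun k => le_trans ?_ (hC k)⟩
  rw [norm_mul, norm_mul, pow_add, norm_mul, mul_assoc]
  gcongr
  refine (h k).trans_eq ?_
  rw [norm_pow, Complex.norm_real, Real.norm_of_nonneg (abs_nonneg _)]

theorem rpow_mul (hu : RapidDecay u) (z : ℝ) :
    RapidDecay fun k => ((|diracEv k| ^ z : ℝ) : ℂ) * u k := by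
  obtain ⟨N, hN⟩ := exists_nat_ge z
  refine hu.of_le N fun k => ?_
  rw [norm_mul, Complex.norm_real, Real.norm_of_nonneg (by positivity), ← Real.rpow_natCast]
  gcongr
  exact one_le_abs_diracEv k

end RapidDecay

theorem rapidDecay_pow (t : Par) : RapidDecay fun k => ((t : ℝ) : ℂ) ^ k.deg := fun n => by
  have h0 := t.2.1
  have h := tendsto_pow_const_mul_const_pow_of_lt_one n h0.le t.2.2
  obtain ⟨C, hC⟩ := h.bddAbove_range
  -- Since |D| ≤ deg + 2, the boundedness of m^n t^m is applied at m = deg + 2, and t⁻² pays for the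
  -- shift.
  refine ⟨C * ((t : ℝ) ^ 2)⁻¹, fun k => ?_⟩
  rw [norm_mul, norm_pow, norm_pow, Complex.norm_real, Complex.norm_real,
    Real.norm_of_nonneg h0.le, Real.norm_of_nonneg (abs_nonneg _), ← div_eq_mul_inv,
    le_div_iff₀ (by positivity)]
  have h2 := hC (Set.mem_range_self (k.deg + 2))
  refine le_trans ?_ h2
  push_cast
  rw [pow_add, ← mul_assoc]
  have := abs_diracEv_le k
  gcongr

/-- Finite sums of `u(D) S v(D)` with rapidly decaying weights `u`, `v`. -/
def rapidOps : Submodule ℂ BSpinor :=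
  Submodule.span ℂ {T | ∃ (u v : SpinIdx → ℂ) (hu : RapidDecay u) (hv : RapidDecay v) (S : BSpinor),
    T = bddDiag u hu.bdd * (S * bddDiag v hv.bdd)}

theorem bddDiag_mul_coeff (u v : SpinIdx → ℂ) (hu : ∃ C, ∀ k, ‖u k‖ ≤ C)
    (hv : ∃ C, ∀ k, ‖v k‖ ≤ C) (S : BSpinor) (l k : SpinIdx) :
    (bddDiag u hu * (S * bddDiag v hv)) (basisVec l) k = u k * (v l * S (basisVec l) k) := by
  rw [mul_apply_eq_comp, bddDiag_apply, mul_apply_eq_comp, bddDiag_basisVec, map_smul]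
  simp

/-- The commutator of |D| with u S v is (|D| u) S v - u S (|D| v), and rapid decay survives a factor
|D|. The difference of two such terms is the reason for working with a span. -/
theorem exists_isDelta_of_mem_rapidOps (T : BSpinor) (hT : T ∈ rapidOps) :
    ∃ S, S ∈ rapidOps ∧ IsDelta T S := by
  induction hT using Submodule.span_induction with
  | mem T h =>
    obtain ⟨u, v, hu, hv, S, rfl⟩ := h
    refine ⟨bddDiag _ hu.mul_abs.bdd * (S * bddDiag v hv.bdd)
      - bddDiag u hu.bdd * (S * bddDiag _ hv.mul_abs.bdd), Submodule.sub_mem _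
        (Submodule.subset_span ⟨_, _, hu.mul_abs, hv, S, rfl⟩)
        (Submodule.subset_span ⟨_, _, hu, hv.mul_abs, S, rfl⟩), .of_coeff fun l k => ?_⟩
    rw [sub_apply, lp.coeFn_sub, Pi.sub_apply, bddDiag_mul_coeff, bddDiag_mul_coeff,
      bddDiag_mul_coeff]
    ring
  | zero => exact ⟨0, Submodule.zero_mem _, .zero⟩
  | add T T' _ _ h h' =>
    obtain ⟨S, hS, h⟩ := h
    obtain ⟨S', hS', h'⟩ := h'
    exact ⟨S + S', Submodule.add_mem _ hS hS', h.add h'⟩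
  | smul c T _ h =>
    obtain ⟨S, hS, h⟩ := h
    exact ⟨c • S, Submodule.smul_mem _ c hS, h.smul c⟩

theorem inSmoothDomain_of_mem_rapidOps {T : BSpinor} (hT : T ∈ rapidOps) : InSmoothDomain T :=
  fun n => by
    obtain ⟨S, -, h⟩ := isDeltaPow_of_closed exists_isDelta_of_mem_rapidOps hT n
    exact ⟨S, h⟩

theorem bddDiag_mem_domain (d : SpinIdx → ℝ) (u : SpinIdx → ℂ) (hu : ∃ C, ∀ k, ‖u k‖ ≤ C)
    (hdu : ∃ C, ∀ k, ‖(d k : ℂ) * u k‖ ≤ C) (ξ : Spinor) :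
    bddDiag u hu ξ ∈ (diagOp d).domain :=
  mem_diagOp_domain (η := bddDiag _ hdu ξ) fun k => by
    rw [bddDiag_apply, bddDiag_apply, mul_assoc]

theorem bddDiag_mem_Hinf {u : SpinIdx → ℂ} (hu : RapidDecay u) (ξ : Spinor) :
    bddDiag u hu.bdd ξ ∈ Hinf := by
  rw [Hinf, Submodule.mem_iInf]
  rintro ⟨s, hs⟩
  refine bddDiag_mem_domain _ _ _ ?_ ξ
  obtain ⟨N, hN⟩ := exists_nat_ge (s / 2)
  -- The comparison (1 + D²)^N ≤ (2 D²)^N costs the constant 2^N. It is put into the weight because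
  -- `RapidDecay.of_le` only admits powers of |D|.
  have hu' : RapidDecay fun k => (2 : ℂ) ^ N * u k := fun n => by
    obtain ⟨C, hC⟩ := hu n
    refine ⟨‖(2 : ℂ) ^ N‖ * C, fun k => ?_⟩
    rw [mul_left_comm, norm_mul]
    gcongr
    exact hC k
  refine (hu'.of_le (v := fun k => (((1 + diracEv k ^ 2) ^ (s / 2) : ℝ) : ℂ) * u k) (2 * N)
    fun k => ?_).bdd
  have h1 := one_le_abs_diracEv k
  have h2 : 1 ≤ diracEv k ^ 2 := by rw [← sq_abs]; nlinarith
  rw [norm_mul, norm_mul, Complex.norm_real, Real.norm_of_nonneg (by positivity), ← mul_assoc]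
  gcongr
  calc (1 + diracEv k ^ 2) ^ (s / 2) ≤ (1 + diracEv k ^ 2) ^ (N : ℝ) :=
        Real.rpow_le_rpow_of_exponent_le (by linarith) hN
    _ = (1 + diracEv k ^ 2) ^ N := Real.rpow_natCast _ _
    _ ≤ (2 * diracEv k ^ 2) ^ N := by gcongr; linarith
    _ = |diracEv k| ^ (2 * N) * ‖(2 : ℂ) ^ N‖ := by
      rw [mul_pow, pow_mul, sq_abs]; simp [mul_comm]

theorem ExpSmall.isSmoothing {t : Par} {R : BSpinor} (h : ExpSmall t SpinIdx.deg SpinIdx.deg R) :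
    IsSmoothing R := by
  obtain ⟨S, rfl⟩ := h
  have ht := rapidDecay_pow t
  have hR : ∀ ξ : Spinor, (decay t SpinIdx.deg ∘L S ∘L decay t SpinIdx.deg) ξ
      = bddDiag _ ht.bdd ((S * bddDiag _ ht.bdd) ξ) := fun _ => rfl
  refine ⟨((decay t SpinIdx.deg ∘L S ∘L decay t SpinIdx.deg : BSpinor).toLinearMap.comp
    Hinf.subtype).codRestrict Hinf fun ξ => bddDiag_mem_Hinf ht _, fun ξ => rfl, fun α _ => ?_⟩
  -- The factor |D|^(-α) is absorbed by the left Λ, whose weights still decay rapidly.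
  have ht' := ht.rpow_mul (-α)
  refine ⟨bddDiag _ ht'.bdd * (S * bddDiag _ ht.bdd),
    inSmoothDomain_of_mem_rapidOps (Submodule.subset_span ⟨_, _, ht', ht, S, rfl⟩), fun ξ =>
    ⟨bddDiag_mem_domain _ _ ht.bdd ht'.bdd _, ?_⟩⟩
  ext k
  rw [absDiracPow_apply, mul_apply_eq_comp, bddDiag_apply, mul_assoc]
  congr 1
  exact (congrArg (fun f : Spinor => f k) (hR ξ)).trans (bddDiag_apply _ _ _ _)

/-! ### Amplifications -/

section Amplify
variable {α β κ : Type} (e : κ ≃ α × β)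

theorem amplify_apply (S : Ell2 α →L[ℂ] Ell2 α) (f : Ell2 κ) (k : κ) :
    amplify e S f k = S (slice e (e k).2 f) (e k).1 := rfl

theorem slice_amplify (S : Ell2 α →L[ℂ] Ell2 α) (f : Ell2 κ) (b : β) :
    slice e b (amplify e S f) = S (slice e b f) := by
  ext a
  rw [slice_apply, amplify_apply, Equiv.apply_symm_apply]

open Classical in
theorem slice_basisVec (l : κ) (b : β) :
    slice e b (basisVec l) = if b = (e l).2 then basisVec (e l).1 else 0 := by
  ext a
  have h : e.symm (a, b) = l ↔ a = (e l).1 ∧ b = (e l).2 := by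
    rw [Equiv.symm_apply_eq, Prod.ext_iff]
  rw [slice_apply, basisVec_apply]
  split_ifs with h1 h2 h2
  · rw [(h.mp h1).1, basisVec_self]
  · exact absurd (h.mp h1).2 h2
  · rw [basisVec_ne fun h3 => h1 (h.mpr ⟨h3, h2⟩)]
  · rfl

open Classical in
theorem amplify_coeff (S : Ell2 α →L[ℂ] Ell2 α) (l k : κ) :
    amplify e S (basisVec l) k
      = if (e k).2 = (e l).2 then S (basisVec (e l).1) (e k).1 else 0 := by
  rw [amplify_apply, slice_basisVec]
  split_ifs <;> simp

theorem amplify_basisVec {S : Ell2 α →L[ℂ] Ell2 α} {l : κ} {c : ℂ} {a : α}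
    (h : S (basisVec (e l).1) = c • basisVec a) :
    amplify e S (basisVec l) = c • basisVec (e.symm (a, (e l).2)) := by
  classical
  ext k
  rw [amplify_coeff, h]
  simp only [lp.coeFn_smul, Pi.smul_apply, basisVec_apply, Equiv.eq_symm_apply, Prod.ext_iff]
  split_ifs with h1 h2 h3 h3 <;> simp_all

/-- `S ↦ S ⊗ 1` is a `*`-homomorphism. -/
def amplifyHom : (Ell2 α →L[ℂ] Ell2 α) →⋆ₐ[ℂ] (Ell2 κ →L[ℂ] Ell2 κ) where
  __ := AlgHom.ofLinearMap (amplify e)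
    (by ext f k; rw [amplify_apply, one_apply_eq_self, one_apply_eq_self, slice_apply]; simp)
    (fun S T => by
      ext f k
      rw [mul_apply_eq_comp, amplify_apply, amplify_apply, slice_amplify, mul_apply_eq_comp])
  map_star' S := by
    classical
    change amplify e (star S) = star (amplify e S)
    refine clm_ext_coeff fun l k => ?_
    rw [ContinuousLinearMap.star_eq_adjoint, ContinuousLinearMap.star_eq_adjoint, adjoint_coeff,
      amplify_coeff, amplify_coeff, adjoint_coeff]
    by_cases h : (e k).2 = (e l).2
    · rw [if_pos h, if_pos h.symm]
    · rw [if_neg h, if_neg (Ne.symm h), map_zero]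

open Classical in
/-- Matrix coefficients of a product of operators on different tensor factors. -/
theorem amplify_amplify_coeff {α' β' γ : Type} (e' : κ ≃ α' × β') (p : κ → γ)
    (h : ∀ k l, (e k).2 = (e l).2 ↔ (e' k).1 = (e' l).1 ∧ p k = p l)
    (h' : ∀ k l, (e' k).2 = (e' l).2 ↔ (e k).1 = (e l).1 ∧ p k = p l)
    (S : Ell2 α →L[ℂ] Ell2 α) (T : Ell2 α' →L[ℂ] Ell2 α') (l k : κ) :
    amplify e S (amplify e' T (basisVec l)) k
      = if p k = p l then S (basisVec (e l).1) (e k).1 * T (basisVec (e' l).1) (e' k).1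
        else 0 := by
  -- The operator T leaves the e-coordinate alone, so the slice through k of its value at e_l is a
  -- multiple of one basis vector. Here p collects the coordinates that belong to neither factor.
  have key : slice e (e k).2 (amplify e' T (basisVec l))
      = (if p k = p l then T (basisVec (e' l).1) (e' k).1 else 0) • basisVec (e l).1 := by
    ext a
    set k' := e.symm (a, (e k).2) with hk'
    have h1 : (e k').1 = a := by simp [hk']
    have h2 : (e k').2 = (e k).2 := by simp [hk']
    obtain ⟨h3, h4⟩ := (h k' k).mp h2
    rw [slice_apply, ← hk', amplify_coeff, h3]
    simp only [h' k' l, h1, h4, lp.coeFn_smul, Pi.smul_apply, basisVec_apply]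
    split_ifs <;> simp_all
  rw [amplify_apply, key, map_smul]
  split_ifs <;> simp [mul_comm]

/-- The coefficient formula `amplify_amplify_coeff` is symmetric in the two factors. -/
theorem amplify_commute {α' β' γ : Type} (e' : κ ≃ α' × β') (p : κ → γ)
    (h : ∀ k l, (e k).2 = (e l).2 ↔ (e' k).1 = (e' l).1 ∧ p k = p l)
    (h' : ∀ k l, (e' k).2 = (e' l).2 ↔ (e k).1 = (e l).1 ∧ p k = p l)
    (S : Ell2 α →L[ℂ] Ell2 α) (T : Ell2 α' →L[ℂ] Ell2 α') :
    Commute (amplify e S) (amplify e' T) := by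
  classical
  refine clm_ext_coeff fun l k => ?_
  rw [mul_apply_eq_comp, mul_apply_eq_comp, amplify_amplify_coeff e e' p h h',
    amplify_amplify_coeff e' e p h' h, mul_comm]

end Amplify

theorem leg₁_leg₂ (S T : Ell2 ℕ →L[ℂ] Ell2 ℕ) : Commute (amplify leg₁ S) (amplify leg₂ T) :=
  amplify_commute leg₁ leg₂ (fun k => k.2.2)
    (fun _ _ => by simp [leg₁, leg₂, Prod.ext_iff]) (fun _ _ => by simp [leg₁, leg₂, Prod.ext_iff])
    S T

theorem leg₁_leg₃ (S : Ell2 ℕ →L[ℂ] Ell2 ℕ) (T : Ell2 ℤ →L[ℂ] Ell2 ℤ) :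
    Commute (amplify leg₁ S) (amplify leg₃ T) :=
  amplify_commute leg₁ leg₃ (fun k => (k.2.1, k.2.2.2))
    (fun _ _ => by simp [leg₁, leg₃, Prod.ext_iff]; tauto)
    (fun _ _ => by simp [leg₁, leg₃, Prod.ext_iff]) S T

theorem leg₂_leg₃ (S : Ell2 ℕ →L[ℂ] Ell2 ℕ) (T : Ell2 ℤ →L[ℂ] Ell2 ℤ) :
    Commute (amplify leg₂ S) (amplify leg₃ T) :=
  amplify_commute leg₂ leg₃ (fun k => (k.1, k.2.2.2))
    (fun _ _ => by simp [leg₂, leg₃, Prod.ext_iff]; tauto)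
    (fun _ _ => by simp [leg₂, leg₃, Prod.ext_iff]; tauto) S T

/-! ### The action of the circle -/

theorem circleAct_C_mul_T (c : ℂ) (m : ℤ) :
    circleAct (LaurentPolynomial.C c * LaurentPolynomial.T m) = c • translate m := by
  rw [← LaurentPolynomial.single_eq_C_mul_T]
  change Finsupp.linearCombination ℂ translate (AddMonoidAlgebra.single m c).coeff = _
  rw [AddMonoidAlgebra.coeff_single, Finsupp.linearCombination_single]

theorem translate_basisVec (m k : ℤ) : translate m (basisVec k) = basisVec (k + m) := by
  rw [translate, shiftOp_basisVec]; simp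

theorem translate_mul (m n : ℤ) : translate m * translate n = translate (m + n) :=
  clm_ext fun k => by
    rw [mul_apply_eq_comp, translate_basisVec, translate_basisVec, translate_basisVec]
    congr 1; ring

theorem star_translate (m : ℤ) : star (translate m) = translate (-m) := by
  classical
  refine clm_ext_coeff fun i k => ?_
  rw [ContinuousLinearMap.star_eq_adjoint, adjoint_coeff, translate_basisVec, translate_basisVec,
    basisVec_apply, basisVec_apply]
  by_cases h : i = k + m
  · rw [if_pos h, if_pos (by omega), map_one]
  · rw [if_neg h, if_neg (by omega), map_zero]

theorem translate_zero : translate 0 = 1 :=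
  clm_ext fun k => by rw [translate_basisVec, add_zero, one_apply_eq_self]

/-- The action of `A(S¹)` as a `*`-homomorphism. -/
def circleHom : CircleAlg →⋆ₐ[ℂ] (Ell2 ℤ →L[ℂ] Ell2 ℤ) where
  __ := AlgHom.ofLinearMap circleAct
    (by
      have := circleAct_C_mul_T 1 0
      rwa [map_one, LaurentPolynomial.T_zero, mul_one, one_smul, translate_zero] at this)
    (fun f g => by
      induction f using LaurentPolynomial.induction_on' with
      | add f f' h h' => rw [add_mul, map_add, map_add, h, h', add_mul]
      | C_mul_T m c =>
        induction g using LaurentPolynomial.induction_on' with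
        | add g g' h h' => rw [mul_add, map_add, map_add, h, h', mul_add]
        | C_mul_T n c' =>
          rw [mul_mul_mul_comm, ← map_mul, ← LaurentPolynomial.T_add, circleAct_C_mul_T,
            circleAct_C_mul_T, circleAct_C_mul_T, smul_mul_smul_comm, translate_mul])
  map_star' f := by
    change circleAct (star f) = star (circleAct f)
    induction f using LaurentPolynomial.induction_on' with
    | add f f' h h' => rw [star_add, map_add, map_add, h, h', star_add]
    | C_mul_T m c =>
      have : star (LaurentPolynomial.C c * LaurentPolynomial.T m : CircleAlg)
          = LaurentPolynomial.C (conj c) * LaurentPolynomial.T (-m) := by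
        ext n
        rw [coeff_star, ← LaurentPolynomial.single_eq_C_mul_T,
          ← LaurentPolynomial.single_eq_C_mul_T]
        simp only [AddMonoidAlgebra.coeff_single, Finsupp.single_apply]
        by_cases h : m = -n
        · rw [if_pos h, if_pos (by omega)]
        · rw [if_neg h, if_neg (by omega), map_zero]
      rw [this, circleAct_C_mul_T, circleAct_C_mul_T, star_smul, star_translate]
      rfl

/-- The matrix is a Laurent (bi-infinite Toeplitz) matrix. Its translation invariance is what makes
the coefficients of a symbol independent of 2j. -/
theorem circleAct_coeff (f : CircleAlg) (m k : ℤ) :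
    circleAct f (basisVec m) k = f.coeff (k - m) := by
  classical
  induction f using LaurentPolynomial.induction_on' with
  | add f f' h h' =>
    rw [map_add, add_apply, lp.coeFn_add, Pi.add_apply, h, h']
    simp
  | C_mul_T n c =>
    rw [circleAct_C_mul_T, ← LaurentPolynomial.single_eq_C_mul_T, smul_apply, translate_basisVec,
      lp.coeFn_smul, Pi.smul_apply, basisVec_apply]
    simp only [AddMonoidAlgebra.coeff_single, Finsupp.single_apply]
    by_cases h : k = m + n
    · rw [if_pos h, if_pos (by omega)]; simp
    · rw [if_neg h, if_neg (by omega)]; simp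

/-! ### The action of the symbol algebra is a `*`-homomorphism -/

section Symbol
variable (q : Par)

theorem diskAct_star (ε : ℤˣ) (x : Disk q ε) : diskAct q ε (star x) = star (diskAct q ε x) := by
  obtain ⟨x, rfl⟩ := diskMk_surjective q ε x
  rw [star_diskMk]
  exact map_star (diskRep q ε) x

theorem diskAct_injective (ε : ℤˣ) : Function.Injective (diskAct q ε) := by
  rw [injective_iff_map_eq_zero]
  intro x h
  obtain ⟨x, rfl⟩ := diskMk_surjective q ε x
  exact (diskMk_eq_zero q ε).mpr h

/-- The action of the last two factors as an algebra homomorphism. -/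
def symbolTailHom : Disk q (-1) ⊗[ℂ] CircleAlg →ₐ[ℂ] (Ell2 BigIdx →L[ℂ] Ell2 BigIdx) :=
  Algebra.TensorProduct.algHomOfLinearMapTensorProduct
    (LinearMap.mul' ℂ _ ∘ₗ TensorProduct.map (amplify leg₂ ∘ₗ (diskAct q (-1)).toLinearMap)
      (amplify leg₃ ∘ₗ circleAct))
    (fun y y' f f' => by
      have h2 : amplify leg₂ (diskAct q (-1) (y * y'))
          = amplify leg₂ (diskAct q (-1) y) * amplify leg₂ (diskAct q (-1) y') := by
        rw [map_mul]; exact map_mul (amplifyHom leg₂) _ _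
      have h3 : amplify leg₃ (circleAct (f * f'))
          = amplify leg₃ (circleAct f) * amplify leg₃ (circleAct f') :=
        (congrArg _ (map_mul circleHom f f')).trans (map_mul (amplifyHom leg₃) _ _)
      change amplify leg₂ (diskAct q (-1) (y * y')) * amplify leg₃ (circleAct (f * f'))
        = amplify leg₂ (diskAct q (-1) y) * amplify leg₃ (circleAct f)
          * (amplify leg₂ (diskAct q (-1) y') * amplify leg₃ (circleAct f'))
      rw [h2, h3]
      exact (leg₂_leg₃ _ _).mul_mul_mul_comm _ _)
    (by
      change amplify leg₂ (diskAct q (-1) 1) * amplify leg₃ (circleAct 1) = 1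
      have h3 : amplify leg₃ (circleAct 1) = 1 :=
        (congrArg _ (map_one circleHom)).trans (map_one (amplifyHom leg₃))
      have h2 : amplify leg₂ (1 : Ell2 ℕ →L[ℂ] Ell2 ℕ) = 1 := map_one (amplifyHom leg₂)
      rw [map_one, h2, h3, one_mul])

theorem leg₁_symbolTailHom (S : Ell2 ℕ →L[ℂ] Ell2 ℕ) (z : Disk q (-1) ⊗[ℂ] CircleAlg) :
    Commute (amplify leg₁ S) (symbolTailHom q z) := by
  induction z using TensorProduct.induction_on with
  | zero => rw [map_zero]; exact Commute.zero_right _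
  | tmul y f => exact (leg₁_leg₂ _ _).mul_right (leg₁_leg₃ _ _)
  | add z z' h h' => rw [map_add]; exact h.add_right h'

/-- The action of the symbol algebra as an algebra homomorphism. -/
def symbolAlgHom : SymbolAlg q →ₐ[ℂ] (Ell2 BigIdx →L[ℂ] Ell2 BigIdx) :=
  Algebra.TensorProduct.algHomOfLinearMapTensorProduct (symbolAct q)
    (fun x x' z z' => by
      have h : amplify leg₁ (diskAct q 1 (x * x'))
          = amplify leg₁ (diskAct q 1 x) * amplify leg₁ (diskAct q 1 x') := by
        rw [map_mul]; exact map_mul (amplifyHom leg₁) _ _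
      change amplify leg₁ (diskAct q 1 (x * x')) * symbolTailHom q (z * z')
        = amplify leg₁ (diskAct q 1 x) * symbolTailHom q z
          * (amplify leg₁ (diskAct q 1 x') * symbolTailHom q z')
      rw [h, map_mul]
      exact (leg₁_symbolTailHom q _ _).mul_mul_mul_comm _ _)
    (by
      change amplify leg₁ (diskAct q 1 1) * symbolTailHom q 1 = 1
      have h2 : amplify leg₁ (1 : Ell2 ℕ →L[ℂ] Ell2 ℕ) = 1 := map_one (amplifyHom leg₁)
      rw [map_one (symbolTailHom q), map_one (diskAct q 1), h2, one_mul])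

theorem symbolAct_eq (z : SymbolAlg q) : symbolAct q z = symbolAlgHom q z := rfl

theorem symbolAct_star (z : SymbolAlg q) : symbolAct q (star z) = star (symbolAct q z) := by
  induction z using TensorProduct.induction_on with
  | zero => rw [star_zero, map_zero, star_zero]
  | add z z' h h' => rw [star_add, map_add, map_add, h, h', star_add]
  | tmul x z =>
    induction z using TensorProduct.induction_on with
    | zero => rw [TensorProduct.tmul_zero, star_zero, map_zero, star_zero]
    | add z z' h h' =>
      rw [TensorProduct.tmul_add, star_add, map_add, map_add, h, h', star_add]
    | tmul y f =>
      have h1 : amplify leg₁ (diskAct q 1 (star x)) = star (amplify leg₁ (diskAct q 1 x)) := by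
        rw [diskAct_star]; exact map_star (amplifyHom leg₁) _
      have h2 : amplify leg₂ (diskAct q (-1) (star y))
          = star (amplify leg₂ (diskAct q (-1) y)) := by
        rw [diskAct_star]; exact map_star (amplifyHom leg₂) _
      have h3 : amplify leg₃ (circleAct (star f)) = star (amplify leg₃ (circleAct f)) :=
        (congrArg _ (map_star circleHom f)).trans (map_star (amplifyHom leg₃) _)
      -- The adjoint reverses the three factors, and their order is restored because they commute.
      rw [TensorProduct.star_tmul, TensorProduct.star_tmul, symbolAct_tmul, symbolAct_tmul, h1, h2,
        h3, star_mul, star_mul, ← (leg₂_leg₃ _ _).star_star.eq]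
      exact ((leg₁_leg₂ _ _).star_star.mul_right (leg₁_leg₃ _ _).star_star).eq

/-- The action of the symbol algebra as a `*`-homomorphism. -/
def symbolHom : SymbolAlg q →⋆ₐ[ℂ] (Ell2 BigIdx →L[ℂ] Ell2 BigIdx) where
  __ := symbolAlgHom q
  map_star' z := by
    change symbolAlgHom q (star z) = star (symbolAlgHom q z)
    rw [← symbolAct_eq, ← symbolAct_eq, symbolAct_star]

theorem symbolHom_apply (z : SymbolAlg q) : symbolHom q z = symbolAct q z :=
  (symbolAct_eq q z).symm

theorem symbolHom_one : symbolHom q 1 = 1 := (symbolHom q).map_one'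

/-! ### Faithfulness -/

/-- Two separating families of functionals separate the tensor product. -/
theorem tensor_eq_zero {V W ι κ : Type} [AddCommGroup V] [Module ℂ V] [AddCommGroup W] [Module ℂ W]
    (f : ι → V →ₗ[ℂ] ℂ) (g : κ → W →ₗ[ℂ] ℂ) (hf : ∀ v, (∀ i, f i v = 0) → v = 0)
    (hg : ∀ w, (∀ k, g k w = 0) → w = 0) (z : V ⊗[ℂ] W)
    (hz : ∀ i k, LinearMap.mul' ℂ ℂ (TensorProduct.map (f i) (g k) z) = 0) : z = 0 := by
  classical
  -- Write z = ∑ v_j ⊗ b_j. Then f_i(v_j) is the j-th coordinate of the vector (f_i ⊗ id)(z) of W.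
  -- Every g_k kills that vector, so it is 0, and hence every v_j is 0.
  let b := Module.Basis.ofVectorSpace ℂ W
  let E := TensorProduct.equivFinsuppOfBasisRight (M := V) b
  refine E.map_eq_zero_iff.mp (Finsupp.ext fun j => hf _ fun i => ?_)
  have h1 : ∀ z : V ⊗[ℂ] W, f i (E z j)
      = b.repr (TensorProduct.lid ℂ W (TensorProduct.map (f i) LinearMap.id z)) j := by
    intro z
    induction z using TensorProduct.induction_on with
    | zero => simp
    | add z z' h h' => simp only [map_add, Finsupp.add_apply, h, h']
    | tmul v w =>
      simp [E, mul_comm]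
  have h2 : ∀ (k : κ) (z : V ⊗[ℂ] W),
      g k (TensorProduct.lid ℂ W (TensorProduct.map (f i) LinearMap.id z))
        = LinearMap.mul' ℂ ℂ (TensorProduct.map (f i) (g k) z) := by
    intro k z
    induction z using TensorProduct.induction_on with
    | zero => simp
    | add z z' h h' => simp only [map_add, h, h']
    | tmul v w => simp
  rw [h1, hg _ fun k => (h2 k z).trans (hz i k)]
  simp

/-- Evaluation of a coordinate of `ℓ²`. -/
def evalCoord {ι : Type} (i : ι) : Ell2 ι →ₗ[ℂ] ℂ where
  toFun f := f i
  map_add' _ _ := rfl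
  map_smul' _ _ := rfl

/-- The matrix coefficients of the quantum disk. -/
def diskCoeff (ε : ℤˣ) (p : ℕ × ℕ) : Disk q ε →ₗ[ℂ] ℂ :=
  evalCoord p.2 ∘ₗ LinearMap.applyₗ (basisVec p.1) ∘ₗ ContinuousLinearMap.coeLM ℂ ∘ₗ
    (diskAct q ε).toLinearMap

theorem diskCoeff_apply (ε : ℤˣ) (p : ℕ × ℕ) (x : Disk q ε) :
    diskCoeff q ε p x = diskAct q ε x (basisVec p.1) p.2 := rfl

theorem disk_eq_zero (ε : ℤˣ) (x : Disk q ε) (h : ∀ p, diskCoeff q ε p x = 0) : x = 0 := by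
  refine diskAct_injective q ε ?_
  rw [map_zero]
  exact clm_ext_coeff fun i k => h (i, k)

/-- The coefficient of `uᵍ`. -/
def circleCoeff (g : ℤ) : CircleAlg →ₗ[ℂ] ℂ :=
  Finsupp.lapply g ∘ₗ (AddMonoidAlgebra.coeffLinearEquiv ℂ).toLinearMap

theorem circleCoeff_apply (g : ℤ) (f : CircleAlg) : circleCoeff g f = f.coeff g := rfl

/-- Products of matrix coefficients of the three factors. -/
def symbolCoeff (p p' : ℕ × ℕ) (g : ℤ) : SymbolAlg q →ₗ[ℂ] ℂ :=
  LinearMap.mul' ℂ ℂ ∘ₗ TensorProduct.map (diskCoeff q 1 p)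
    (LinearMap.mul' ℂ ℂ ∘ₗ TensorProduct.map (diskCoeff q (-1) p') (circleCoeff g))

/-- Each disk algebra is a quotient by the kernel of its representation, hence separated by matrix
coefficients, and the circle is separated by Fourier coefficients. `tensor_eq_zero` is applied once
for each tensor sign. -/
theorem symbol_eq_zero (z : SymbolAlg q) (h : ∀ p p' g, symbolCoeff q p p' g z = 0) : z = 0 :=
  tensor_eq_zero (diskCoeff q 1)
    (fun i : (ℕ × ℕ) × ℤ =>
      LinearMap.mul' ℂ ℂ ∘ₗ TensorProduct.map (diskCoeff q (-1) i.1) (circleCoeff i.2))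
    (disk_eq_zero q 1)
    (fun w hw => tensor_eq_zero (diskCoeff q (-1)) circleCoeff (disk_eq_zero q (-1))
      (fun f hf => by ext g; exact hf g) w fun i k => hw (i, k)) z fun i k => h i k.1 k.2

/-- The right-hand side involves neither m nor s: a coefficient of z can be read off at arbitrarily
high degree. -/
theorem symbolAct_coeff (z : SymbolAlg q) (x x' y y' : ℕ) (m g : ℤ) (s : Fin 2) :
    symbolAct q z (basisVec (x, y, m, s)) (x', y', m + g, s)
      = symbolCoeff q (x, x') (y, y') g z := by
  classical
  induction z using TensorProduct.induction_on with
  | zero => simp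
  | add z z' h h' => rw [map_add, map_add, add_apply, lp.coeFn_add, Pi.add_apply, h, h']
  | tmul d z =>
    induction z using TensorProduct.induction_on with
    | zero => simp
    | add z z' h h' =>
      rw [TensorProduct.tmul_add, map_add, map_add, add_apply, lp.coeFn_add, Pi.add_apply, h, h']
    | tmul d' f =>
      have key : slice leg₁ (y', m + g, s) (amplify leg₂ (diskAct q (-1) d')
          (amplify leg₃ (circleAct f) (basisVec (x, y, m, s))))
          = (diskCoeff q (-1) (y, y') d' * f.coeff g) • basisVec x := by
        ext x''
        rw [slice_apply, amplify_amplify_coeff leg₂ leg₃ (fun k => (k.1, k.2.2.2))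
          (fun _ _ => by simp [leg₂, leg₃, Prod.ext_iff]; tauto)
          (fun _ _ => by simp [leg₂, leg₃, Prod.ext_iff]; tauto), circleAct_coeff]
        simp only [leg₁, leg₂, leg₃, Equiv.refl_symm, Equiv.refl_apply, Equiv.coe_fn_mk,
          Prod.mk.injEq, and_true, add_sub_cancel_left, lp.coeFn_smul, Pi.smul_apply,
          basisVec_apply, smul_eq_mul, diskCoeff_apply]
        split_ifs <;> simp
      rw [symbolAct_tmul, mul_apply_eq_comp, mul_apply_eq_comp, amplify_apply]
      change (diskAct q 1 d) (slice leg₁ (y', m + g, s) _) x' = _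
      rw [key, map_smul]
      simp only [symbolCoeff, LinearMap.comp_apply, TensorProduct.map_tmul, LinearMap.mul'_apply,
        circleCoeff_apply, diskCoeff_apply, lp.coeFn_smul, Pi.smul_apply, smul_eq_mul]
      ring

end Symbol

/-! ### The inclusion of the spinors -/

/-- The degree `|2j|` on the labels of the big space. -/
def bigDeg (i : BigIdx) : ℕ := i.2.2.1.natAbs

/-- The inclusion of the spinors, seen from the other side. -/
abbrev inclAdj : Ell2 BigIdx →L[ℂ] Spinor := ContinuousLinearMap.adjoint incl

theorem incl_basisVec (k : SpinIdx) : incl (basisVec k) = basisVec (relabel k) := by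
  rw [incl, shiftOp_basisVec]; simp

theorem bigDeg_relabel (k : SpinIdx) : bigDeg (relabel k) = k.deg := by
  have := k.isLabel.1
  simp only [bigDeg, relabel, SpinIdx.deg]
  omega

theorem inclAdj_relabel (k : SpinIdx) : inclAdj (basisVec (relabel k)) = basisVec k := by
  classical
  ext l
  rw [adjoint_coeff, incl_basisVec, basisVec_apply, basisVec_apply]
  by_cases h : l = k
  · subst h; simp
  · rw [if_neg h, if_neg fun h' => h (relabel_injective h'.symm), map_zero]

theorem inclAdj_of_notMem {i : BigIdx} (hi : i ∉ Set.range relabel) :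
    inclAdj (basisVec i) = 0 := by
  ext l
  rw [adjoint_coeff, incl_basisVec, basisVec_ne fun h => hi ⟨l, h.symm⟩, map_zero]
  rfl

theorem inclAdj_incl : inclAdj ∘L incl = ContinuousLinearMap.id ℂ Spinor :=
  clm_ext fun k => by
    rw [ContinuousLinearMap.comp_apply, incl_basisVec, inclAdj_relabel]; rfl

theorem incl_decay (t : Par) : incl ∘L decay t SpinIdx.deg = decay t bigDeg ∘L incl :=
  clm_ext fun k => by
    rw [ContinuousLinearMap.comp_apply, ContinuousLinearMap.comp_apply, decay_basisVec, map_smul,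
      incl_basisVec, decay_basisVec, bigDeg_relabel]

theorem inclAdj_decay (t : Par) : inclAdj ∘L decay t bigDeg = decay t SpinIdx.deg ∘L inclAdj := by
  have := congrArg ContinuousLinearMap.adjoint (incl_decay t)
  rw [ContinuousLinearMap.adjoint_comp, ContinuousLinearMap.adjoint_comp, adjoint_decay,
    adjoint_decay] at this
  exact this.symm

/-- The orthogonal projector onto the spinors inside the big space. -/
def inclProj : Ell2 BigIdx →L[ℂ] Ell2 BigIdx := incl ∘L inclAdj

theorem inclProj_relabel (k : SpinIdx) :
    inclProj (basisVec (relabel k)) = basisVec (relabel k) := by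
  rw [inclProj, ContinuousLinearMap.comp_apply, inclAdj_relabel, incl_basisVec]

theorem inclProj_of_notMem {i : BigIdx} (hi : i ∉ Set.range relabel) :
    inclProj (basisVec i) = 0 := by
  rw [inclProj, ContinuousLinearMap.comp_apply, inclAdj_of_notMem hi, map_zero]

theorem inclAdj_inclProj : inclAdj ∘L inclProj = inclAdj := by
  rw [inclProj, ← ContinuousLinearMap.comp_assoc, inclAdj_incl, ContinuousLinearMap.id_comp]

/-! ### Operators with a symbol -/

/-- The square root of the deformation parameter. -/
def sqrtPar (q : Par) : Par :=
  ⟨√q, Real.sqrt_pos.mpr q.2.1, (Real.sqrt_lt' one_pos).mpr (by simpa using q.2.2)⟩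

theorem sqrtPar_pow (q : Par) (n : ℕ) : (sqrtPar q : ℝ) ^ (2 * n) = (q : ℝ) ^ n := by
  rw [pow_mul, sqrtPar, Real.sq_sqrt q.2.1.le]

theorem eq_of_add_neg_one_smul {V : Type} [AddCommGroup V] [Module ℂ V] {v w : V}
    (h : v + (-1 : ℂ) • w = 0) : v = w := by
  rwa [neg_one_smul, add_neg_eq_zero] at h

/-- `z` is a symbol of `T`: up to exponentially small operators, `z ⊗ 1₂` preserves the spinors and
acts on them as `T`, and so do the adjoints. -/
structure HasSymbol (q : Par) (T : BSpinor) (z : SymbolAlg q) : Prop where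
  mem : T ∈ decayAlg (sqrtPar q) SpinIdx.deg
  mem_act : symbolHom q z ∈ decayAlg (sqrtPar q) bigDeg
  right : ExpSmall (sqrtPar q) SpinIdx.deg bigDeg (symbolHom q z ∘L incl - incl ∘L T)
  left : ExpSmall (sqrtPar q) bigDeg SpinIdx.deg (inclAdj ∘L symbolHom q z - T ∘L inclAdj)

namespace HasSymbol
variable {q : Par} {T T' : BSpinor} {z z' : SymbolAlg q}

theorem add (h : HasSymbol q T z) (h' : HasSymbol q T' z') : HasSymbol q (T + T') (z + z') where
  mem := add_mem h.mem h'.mem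
  mem_act := by rw [map_add]; exact add_mem h.mem_act h'.mem_act
  right := by
    convert h.right.add h'.right using 1
    rw [map_add, ContinuousLinearMap.add_comp, ContinuousLinearMap.comp_add]
    abel
  left := by
    convert h.left.add h'.left using 1
    rw [map_add, ContinuousLinearMap.add_comp, ContinuousLinearMap.comp_add]
    abel

theorem mul (h : HasSymbol q T z) (h' : HasSymbol q T' z') : HasSymbol q (T * T') (z * z') where
  mem := mul_mem h.mem h'.mem
  mem_act := by rw [map_mul]; exact mul_mem h.mem_act h'.mem_act
  right := by
    -- z z' ι - ι T T' = z (z' ι - ι T') + (z ι - ι T) T'. The outer factors z and T' must pass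
    -- through Λ, whence the two membership fields.
    convert (h'.right.mul_left h.mem_act).add (h.right.mul_right h'.mem) using 1
    rw [map_mul, ContinuousLinearMap.comp_sub, ContinuousLinearMap.sub_comp]
    simp only [ContinuousLinearMap.mul_def, ContinuousLinearMap.comp_assoc]
    abel
  left := by
    convert (h'.left.mul_left h.mem).add (h.left.mul_right h'.mem_act) using 1
    rw [map_mul, ContinuousLinearMap.comp_sub, ContinuousLinearMap.sub_comp]
    simp only [ContinuousLinearMap.mul_def, ContinuousLinearMap.comp_assoc]
    abel

/-- Adjoints exchange `right` and `left`. Neither implies the other in general, since z ⊗ 1₂ need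
not preserve the spinors or their complement. -/
theorem star (h : HasSymbol q T z) : HasSymbol q (star T) (star z) where
  mem := star_mem h.mem
  mem_act := by rw [map_star]; exact star_mem h.mem_act
  right := by
    convert h.left.adjoint using 1
    rw [map_sub, ContinuousLinearMap.adjoint_comp, ContinuousLinearMap.adjoint_comp, map_star,
      ContinuousLinearMap.adjoint_adjoint]
    rfl
  left := by
    convert h.right.adjoint using 1
    rw [map_sub, ContinuousLinearMap.adjoint_comp, ContinuousLinearMap.adjoint_comp, map_star]
    rfl

theorem scalar (c : ℂ) : HasSymbol q (c • 1) (c • 1) where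
  mem := SMulMemClass.smul_mem c (one_mem _)
  mem_act := by rw [map_smul, symbolHom_one]; exact SMulMemClass.smul_mem c (one_mem _)
  right := by
    convert ExpSmall.zero using 1
    rw [map_smul, symbolHom_one]
    ext ξ
    simp
  left := by
    convert ExpSmall.zero using 1
    rw [map_smul, symbolHom_one]
    ext ξ
    simp

theorem smul (c : ℂ) (h : HasSymbol q T z) : HasSymbol q (c • T) (c • z) where
  mem := SMulMemClass.smul_mem c h.mem
  mem_act := by rw [map_smul]; exact SMulMemClass.smul_mem c h.mem_act
  right := by
    convert h.right.smul c using 1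
    rw [map_smul, ContinuousLinearMap.smul_comp, ContinuousLinearMap.comp_smul, smul_sub]
  left := by
    convert h.left.smul c using 1
    rw [map_smul, ContinuousLinearMap.smul_comp, ContinuousLinearMap.comp_smul, smul_sub]

/-- From ι^* ι = 1 follows T - ι^* z ι = -ι^* (z ι - ι T), and ι^* intertwines the two decay
operators. -/
theorem isSmoothing (h : HasSymbol q T z) : IsSmoothing (T - compress (symbolAct q z)) := by
  have h1 := (h.right.comp_left (inclAdj_decay _)).neg
  refine ExpSmall.isSmoothing (t := sqrtPar q) ?_
  convert h1 using 1
  rw [ContinuousLinearMap.comp_sub, neg_sub, ← ContinuousLinearMap.comp_assoc, inclAdj_incl,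
    ContinuousLinearMap.id_comp]
  rfl

/-- With T = 0 the operator z ι itself is exponentially small, so a fixed matrix coefficient of z is
bounded by a constant times t^(2j) for arbitrarily large j. -/
theorem eq_zero (h : HasSymbol q 0 z) : z = 0 := by
  refine symbol_eq_zero q z fun ⟨x, x'⟩ ⟨y, y'⟩ g => ?_
  obtain ⟨S, hS⟩ := h.right
  rw [ContinuousLinearMap.comp_zero, sub_zero] at hS
  have t0 := (sqrtPar q).2.1
  have t1 := (sqrtPar q).2.2
  have key : ∀ N : ℕ, ‖symbolCoeff q (x, x') (y, y') g z‖
      ≤ ‖S‖ * (sqrtPar q : ℝ) ^ (x + y + N) := by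
    intro N
    -- For 2j = x + y + N the constraints x ≤ 2j and y ≤ 2j + 1 hold for every N, so (x, y, 2j, ↑)
    -- always labels a spinor.
    let k : SpinIdx := ⟨(x + y + N : ℕ), 2 * x - (x + y + N : ℕ), 2 * y - (x + y + N : ℕ) - 1, 0, by
      refine ⟨by positivity, by rw [abs_le]; omega, ⟨(x + y + N : ℕ) - x, by ring⟩,
        by rw [if_pos rfl, abs_le]; omega, ⟨(x + y + N : ℕ) - y + 1, by ring⟩⟩⟩
    have hk : relabel k = (x, y, ((x + y + N : ℕ) : ℤ), 0) := by
      simp only [relabel, k, if_true, Prod.mk.injEq, and_true]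
      omega
    have e := congrArg (fun X : Spinor →L[ℂ] Ell2 BigIdx =>
      X (basisVec k) (x', y', ((x + y + N : ℕ) : ℤ) + g, 0)) hS
    simp only [ContinuousLinearMap.comp_apply, incl_basisVec, hk, decay_basisVec, map_smul,
      lp.coeFn_smul, Pi.smul_apply, decay_apply, smul_eq_mul, symbolHom_apply] at e
    rw [symbolAct_coeff] at e
    rw [e, norm_mul, norm_mul, norm_pow, norm_pow, Complex.norm_real, Real.norm_of_nonneg t0.le]
    have hd : k.deg = x + y + N := by simp [SpinIdx.deg, k]; omega
    rw [hd, mul_comm]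
    have h1 : ‖S (basisVec k) (x', y', ((x + y + N : ℕ) : ℤ) + g, 0)‖ ≤ ‖S‖ := by
      refine (norm_coeff_le _ _).trans ((S.le_opNorm _).trans_eq ?_)
      rw [norm_basisVec, mul_one]
    have h2 : (sqrtPar q : ℝ) ^ bigDeg (x', y', ((x + y + N : ℕ) : ℤ) + g, 0) ≤ 1 :=
      pow_le_one₀ t0.le t1.le
    have h3 := mul_le_mul h2 h1 (norm_nonneg _) zero_le_one
    rw [one_mul] at h3
    gcongr
  have hl : Filter.Tendsto (fun N : ℕ => ‖S‖ * (sqrtPar q : ℝ) ^ (x + y + N)) Filter.atTop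
      (nhds 0) := by
    have := (tendsto_pow_atTop_nhds_zero_of_lt_one t0.le t1).const_mul
      (‖S‖ * (sqrtPar q : ℝ) ^ (x + y))
    simpa only [pow_add, mul_assoc, mul_zero] using this
  exact norm_le_zero_iff.mp (ge_of_tendsto' hl key)

/-- An operator has at most one symbol. -/
theorem unique (h : HasSymbol q T z) (h' : HasSymbol q T z') : z = z' := by
  have h1 := h.add (h'.smul (-1))
  have e : T + (-1 : ℂ) • T = 0 := by rw [neg_one_smul, add_neg_cancel]
  rw [e] at h1
  exact eq_of_add_neg_one_smul h1.eq_zero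

/-- Comparison of two weighted shifts. -/
theorem of_shift (hT : T ∈ decayAlg (sqrtPar q) SpinIdx.deg) (w : BigIdx → ℂ)
    (σ : BigIdx → Option BigIdx) (c : SpinIdx → ℂ)
    (hZ : ∀ i, symbolAct q z (basisVec i) = w i • (σ i).elim 0 basisVec)
    (hTc : ∀ k, incl (T (basisVec k)) = c k • (σ (relabel k)).elim 0 basisVec)
    (hσ : ∀ i i' k, σ i = some k → σ i' = some k → i = i')
    (hσ' : ∀ i k, σ i = some k → bigDeg k ≤ bigDeg i + 1 ∧ bigDeg i ≤ bigDeg k + 1)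
    (hw : ∃ C, ∀ i, ‖w i‖ ≤ C) (C : ℝ) (hC : 0 ≤ C)
    (hin : ∀ k, ‖w (relabel k) - c k‖ ≤ C * (q : ℝ) ^ k.deg)
    (hout : ∀ i ∉ Set.range relabel, ∀ k, σ i = some (relabel k) →
      ‖w i‖ ≤ C * (q : ℝ) ^ bigDeg i) : HasSymbol q T z := by
  classical
  have hright : ExpSmall (sqrtPar q) SpinIdx.deg bigDeg (symbolHom q z ∘L incl - incl ∘L T) := by
    refine .of_shift (fun k => w (relabel k) - c k) (fun k => σ (relabel k)) (fun k => ?_)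
      (fun i i' k h h' => relabel_injective (hσ _ _ _ h h')) C fun k i h => ⟨?_, ?_⟩
    · rw [sub_apply, ContinuousLinearMap.comp_apply, ContinuousLinearMap.comp_apply, hTc,
        incl_basisVec, symbolHom_apply, hZ, sub_smul]
    · rw [← bigDeg_relabel]; exact (hσ' _ _ h).1
    · rw [sqrtPar_pow]; exact hin k
  -- The estimate on spinors says nothing about `left` off the spinors. What is missing is the part
  -- of z that enters the spinors from their complement, and `hout` bounds exactly those weights.
  have hX : ExpSmall (sqrtPar q) bigDeg bigDeg
      (inclProj ∘L symbolHom q z ∘L (1 - inclProj)) := by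
    refine .of_shift (fun i => if i ∉ Set.range relabel ∧ ∃ k, σ i = some (relabel k) then w i
      else 0) σ (fun i => ?_) hσ C fun i i' h => ⟨(hσ' _ _ h).1, ?_⟩
    · rw [ContinuousLinearMap.comp_apply, ContinuousLinearMap.comp_apply, sub_apply,
        one_apply_eq_self]
      by_cases hi : i ∈ Set.range relabel
      · rw [if_neg fun h => h.1 hi]
        obtain ⟨k, rfl⟩ := hi
        rw [inclProj_relabel]; simp
      · rw [inclProj_of_notMem hi, sub_zero, symbolHom_apply, hZ, map_smul]
        cases h : σ i with
        | none => simp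
        | some i' =>
          by_cases hi' : i' ∈ Set.range relabel
          · obtain ⟨k, rfl⟩ := hi'
            rw [if_pos ⟨hi, k, rfl⟩, Option.elim_some, inclProj_relabel]
          · rw [if_neg, Option.elim_some, inclProj_of_notMem hi', smul_zero, zero_smul]
            rintro ⟨-, k, hk⟩
            exact hi' ⟨k, (Option.some.inj hk).symm⟩
    · rw [sqrtPar_pow]
      have h0 := q.2.1
      split_ifs with hc
      · obtain ⟨h1, k, h2⟩ := hc
        exact hout i h1 k h2
      · rw [norm_zero]; positivity
  refine ⟨hT, mem_decayAlg_of_shift w σ hZ hw hσ hσ', hright, ?_⟩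
  -- With P = ι ι^*, one has ι^* z - T ι^* = ι^* (z ι - ι T) ι^* + ι^* (P z (1 - P)).
  have h1 := (hright.comp_left (inclAdj_decay _)).comp_right (inclAdj_decay _).symm
  convert h1.add (hX.comp_left (inclAdj_decay _)) using 1
  have e := inclAdj_incl
  rw [← ContinuousLinearMap.comp_assoc inclAdj, inclAdj_inclProj, ContinuousLinearMap.comp_sub,
    ← ContinuousLinearMap.comp_assoc inclAdj incl, e, ContinuousLinearMap.id_comp, inclProj]
  simp only [ContinuousLinearMap.comp_sub, ContinuousLinearMap.sub_comp,
    ContinuousLinearMap.comp_assoc]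
  change _ = _ + (inclAdj ∘L symbolHom q z - _)
  abel

theorem of_expSmall (hT : T ∈ decayAlg (sqrtPar q) SpinIdx.deg)
    (h : ExpSmall (sqrtPar q) SpinIdx.deg SpinIdx.deg T) : HasSymbol q T 0 where
  mem := hT
  mem_act := by rw [map_zero]; exact zero_mem _
  right := by
    rw [map_zero, ContinuousLinearMap.zero_comp, zero_sub]
    exact (h.comp_left (incl_decay _)).neg
  left := by
    rw [map_zero, ContinuousLinearMap.comp_zero, zero_sub]
    exact (h.comp_right (inclAdj_decay _).symm).neg

end HasSymbol

/-! ### Labels in the coordinates `x`, `y`, `2j` -/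

/-- The sign `1` for `↑` and `-1` for `↓`. -/
def spinSign (s : Fin 2) : ℤ := if s = 0 then 1 else -1

theorem spinSign_cases (s : Fin 2) : s = 0 ∧ spinSign s = 1 ∨ s = 1 ∧ spinSign s = -1 := by
  fin_cases s <;> simp [spinSign]

/-- In the coordinates x, y, 2j the parity conditions are automatic, and the lower bounds on μ and n
become x ≥ 0 and y ≥ 0. Only upper bounds and 2j ≥ 0 remain. -/
theorem isSpinLabel_iff (x y : ℕ) (J : ℤ) (s : Fin 2) :
    IsSpinLabel J (2 * x - J) (2 * y - J - spinSign s) s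
      ↔ 0 ≤ J ∧ (x : ℤ) ≤ J ∧ (y : ℤ) ≤ J + spinSign s := by
  have h1 : Even (J - (2 * x - J)) := ⟨J - x, by ring⟩
  have h2 : Even (J + 1 - (2 * y - J - spinSign s)) := by
    rcases spinSign_cases s with ⟨-, h⟩ | ⟨-, h⟩ <;> rw [h]
    · exact ⟨J - y + 1, by ring⟩
    · exact ⟨J - y, by ring⟩
  have h3 : (if s = 0 then J + 1 else J - 1) = J + spinSign s := by
    rcases spinSign_cases s with ⟨h, h'⟩ | ⟨h, h'⟩ <;> rw [h', h] <;> rfl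
  rw [IsSpinLabel, h3, abs_le, abs_le]
  simp only [h1, h2, true_and, and_true]
  omega

theorem relabel_mk (x y : ℕ) (J : ℤ) (s : Fin 2)
    (h : IsSpinLabel J (2 * x - J) (2 * y - J - spinSign s) s) :
    relabel ⟨J, 2 * x - J, 2 * y - J - spinSign s, s, h⟩ = (x, y, J, s) := by
  simp only [relabel, Prod.mk.injEq, and_true]
  change _ ∧ ((J + (2 * y - J - spinSign s) + spinSign s) / 2).toNat = y
  omega

theorem incl_ket (x y : ℕ) (J : ℤ) (s : Fin 2) :
    incl (ket J (2 * x - J) (2 * y - J - spinSign s) s)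
      = if 0 ≤ J ∧ (x : ℤ) ≤ J ∧ (y : ℤ) ≤ J + spinSign s then basisVec (x, y, J, s) else 0 := by
  have h := isSpinLabel_iff x y J s
  rw [ket, mkIdx]
  split_ifs with h1 h2 h2
  · rw [Option.elim_some, incl_basisVec, relabel_mk]
  · exact absurd (h.mp h1) h2
  · exact absurd (h.mpr h2) h1
  · simp

theorem mem_range_relabel {x y : ℕ} {J : ℤ} {s : Fin 2}
    (h : 0 ≤ J ∧ (x : ℤ) ≤ J ∧ (y : ℤ) ≤ J + spinSign s) :
    (x, y, J, s) ∈ Set.range relabel :=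
  ⟨_, relabel_mk x y J s ((isSpinLabel_iff x y J s).mpr h)⟩

/-- The number `x = j + μ`. -/
def SpinIdx.x (k : SpinIdx) : ℕ := (relabel k).1

/-- The number `y = j + n ± 1/2`. -/
def SpinIdx.y (k : SpinIdx) : ℕ := (relabel k).2.1

theorem relabel_eq (k : SpinIdx) : relabel k = (k.x, k.y, k.J, k.s) := rfl

namespace SpinIdx
variable (k : SpinIdx)

theorem coords : k.M = 2 * k.x - k.J ∧ k.N = 2 * k.y - k.J - spinSign k.s ∧
    0 ≤ k.J ∧ (k.x : ℤ) ≤ k.J ∧ (k.y : ℤ) ≤ k.J + spinSign k.s := by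
  obtain ⟨J, M, N, s, h0, h1, ⟨c, h2⟩, h3, ⟨d, h4⟩⟩ := k
  rw [abs_le] at h1 h3
  simp only [SpinIdx.x, SpinIdx.y, relabel]
  rcases spinSign_cases s with ⟨rfl, h⟩ | ⟨rfl, h⟩
  · simp only [h, if_true] at h3 ⊢
    omega
  · simp only [h, one_ne_zero, if_false] at h3 ⊢
    omega

theorem j_eq : k.j = k.deg / 2 := by
  have : (k.deg : ℝ) = k.J := by exact_mod_cast k.deg_cast
  rw [j, this]

theorem μ_eq : k.μ = k.x - k.deg / 2 := by
  have h : (k.deg : ℝ) = k.J := by exact_mod_cast k.deg_cast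
  have : (k.M : ℝ) = 2 * k.x - k.J := by exact_mod_cast k.coords.1
  rw [μ, this, h]; ring

theorem n_eq : k.n = k.y - (k.deg + spinSign k.s) / 2 := by
  have h : (k.deg : ℝ) = k.J := by exact_mod_cast k.deg_cast
  have : (k.N : ℝ) = 2 * k.y - k.J - spinSign k.s := by exact_mod_cast k.coords.2.1
  rw [n, this, h]; ring

theorem x_le : (k.x : ℝ) ≤ k.deg := by
  have := k.coords.2.2.2.1
  rw [← k.deg_cast] at this
  exact_mod_cast this

theorem y_le : (k.y : ℝ) ≤ k.deg + spinSign k.s := by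
  have := k.coords.2.2.2.2
  rw [← k.deg_cast] at this
  exact_mod_cast this

end SpinIdx

/-! ### The action on basis vectors -/

theorem spinProj_basisVec (s : Fin 2) (k : SpinIdx) :
    spinProj s (basisVec k) = if k.s = s then basisVec k else 0 := by
  rw [spinProj, shiftOp_basisVec]
  split_ifs <;> simp

theorem spinProj_ket (s s' : Fin 2) (J M N : ℤ) :
    spinProj s (ket J M N s') = if s' = s then ket J M N s' else 0 := by
  unfold ket
  cases h : mkIdx J M N s' with
  | none => simp
  | some k => rw [Option.elim_some, spinProj_basisVec, (mkIdx_some h).2.2.2]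

section Action
variable {m m' : ℝ → ℝ → ℝ → Matrix (Fin 2) (Fin 2) ℝ} {dJ dM dN dJ' dM' dN' : ℤ}
  (hm : MatBounded m) (hm' : MatBounded m')

theorem diagPart_spinOp_basisVec (k : SpinIdx) :
    diagPart (spinOp m dJ dM dN hm) (basisVec k)
      = ((m k.j k.μ k.n k.s k.s : ℝ) : ℂ) • ket (k.J + dJ) (k.M + dM) (k.N + dN) k.s := by
  have hs : k.s = 0 ∨ k.s = 1 := by omega
  simp only [diagPart, add_apply, mul_apply_eq_comp, spinProj_basisVec]
  rcases hs with h | h <;>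
  simp [-Complex.coe_smul, h, spinOp_basisVec, spinProj_ket]

theorem offDiag_spinOp_basisVec (k : SpinIdx) :
    offDiag (spinOp m dJ dM dN hm) (spinOp m' dJ' dM' dN' hm') (basisVec k)
      = if k.s = 0 then
        ((m k.j k.μ k.n 1 0 : ℝ) : ℂ) • ket (k.J + dJ) (k.M + dM) (k.N + dN) 1
        else ((m' k.j k.μ k.n 0 1 : ℝ) : ℂ) • ket (k.J + dJ') (k.M + dM') (k.N + dN') 0 := by
  have hs : k.s = 0 ∨ k.s = 1 := by omega
  simp only [offDiag, add_apply, mul_apply_eq_comp, spinProj_basisVec]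
  rcases hs with h | h <;>
  simp [-Complex.coe_smul, h, spinOp_basisVec, spinProj_ket]

theorem spinProj_mem_decayAlg (t : Par) (s : Fin 2) : spinProj s ∈ decayAlg t SpinIdx.deg :=
  mem_decayAlg_of_shift (fun k => if k.s = s then 1 else 0) some
    (fun k => by rw [spinProj_basisVec]; split_ifs <;> simp)
    ⟨1, fun k => by split_ifs <;> simp⟩ (fun i i' k h h' => by simp at h h'; rw [h, h'])
    fun i k h => by simp at h; subst h; omega

theorem spinOp_mem_decayAlg (t : Par) (hJ : |dJ| ≤ 1) :
    spinOp m dJ dM dN hm ∈ decayAlg t SpinIdx.deg := by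
  rw [abs_le] at hJ
  refine sum_mem fun s _ => sum_mem fun s' _ => ?_
  obtain ⟨C, hC0, hC⟩ := hm.idx
  refine mem_decayAlg_of_shift _ _ (fun k => shiftOp_basisVec _ _ _ _ k) ⟨C, fun k => ?_⟩ ?_ ?_
  · by_cases h : k.s = s
    · subst h; simpa using hC k s'
    · simpa [h] using hC0
  · intro i i' k h h'
    split_ifs at h h' with hi hi'
    have e := mkIdx_some h
    have e' := mkIdx_some h'
    exact SpinIdx.ext' (by omega) (by omega) (by omega) (hi.trans hi'.symm)
  · intro i k h
    split_ifs at h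
    have e := mkIdx_some h
    simp only [SpinIdx.deg]
    omega

theorem diagPart_mem_decayAlg {t : Par} {T : BSpinor} (hT : T ∈ decayAlg t SpinIdx.deg) :
    diagPart T ∈ decayAlg t SpinIdx.deg :=
  add_mem (mul_mem (mul_mem (spinProj_mem_decayAlg t 0) hT) (spinProj_mem_decayAlg t 0))
    (mul_mem (mul_mem (spinProj_mem_decayAlg t 1) hT) (spinProj_mem_decayAlg t 1))

theorem offDiag_mem_decayAlg {t : Par} {T T' : BSpinor} (hT : T ∈ decayAlg t SpinIdx.deg)
    (hT' : T' ∈ decayAlg t SpinIdx.deg) : offDiag T T' ∈ decayAlg t SpinIdx.deg :=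
  add_mem (mul_mem (mul_mem (spinProj_mem_decayAlg t 1) hT) (spinProj_mem_decayAlg t 0))
    (mul_mem (mul_mem (spinProj_mem_decayAlg t 0) hT') (spinProj_mem_decayAlg t 1))

end Action

/-! ### Off-diagonal operators are exponentially small -/

/-- Both flips move the degree by one, and q^(2j) = t^(2 deg) is the rate that `ExpSmall.of_shift`
asks for. -/
theorem hasSymbol_offDiag (q : Par) {m m' : ℝ → ℝ → ℝ → Matrix (Fin 2) (Fin 2) ℝ} {dN : ℤ}
    (hm : MatBounded m) (hm' : MatBounded m') (C : ℝ)
    (h : ∀ j μ n : ℝ, 0 ≤ j → |μ| ≤ j → |n| ≤ j + 1 / 2 →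
      |m j μ n 1 0| ≤ C * (q : ℝ) ^ (2 * j))
    (h' : ∀ j μ n : ℝ, 1 / 2 ≤ j → |μ| ≤ j → |n| ≤ j - 1 / 2 →
      |m' j μ n 0 1| ≤ C * (q : ℝ) ^ (2 * j)) :
    HasSymbol q (offDiag (spinOp m 1 1 dN hm) (spinOp m' (-1) 1 dN hm')) 0 := by
  refine .of_expSmall (offDiag_mem_decayAlg (spinOp_mem_decayAlg hm _ (by norm_num))
    (spinOp_mem_decayAlg hm' _ (by norm_num))) ?_
  refine .of_shift (fun k => if k.s = 0 then ((m k.j k.μ k.n 1 0 : ℝ) : ℂ)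
    else ((m' k.j k.μ k.n 0 1 : ℝ) : ℂ)) (fun k => if k.s = 0 then
      mkIdx (k.J + 1) (k.M + 1) (k.N + dN) 1 else mkIdx (k.J + -1) (k.M + 1) (k.N + dN) 0)
    (fun k => ?_) ?_ C ?_
  · rw [offDiag_spinOp_basisVec]
    split_ifs <;> rfl
  · intro i i' k hi hi'
    -- The two branches end in different spins, so they cannot collide.
    split_ifs at hi hi' with h1 h2 h2 <;> have e := mkIdx_some hi <;> have e' := mkIdx_some hi'
    · exact SpinIdx.ext' (by omega) (by omega) (by omega) (h1.trans h2.symm)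
    · exact absurd (e.2.2.2.symm.trans e'.2.2.2) (by decide)
    · exact absurd (e.2.2.2.symm.trans e'.2.2.2) (by decide)
    · exact SpinIdx.ext' (by omega) (by omega) (by omega) (by omega)
  · intro i k hi
    constructor
    · split_ifs at hi <;> have e := mkIdx_some hi <;> simp only [SpinIdx.deg] <;> omega
    · have hq : (q : ℝ) ^ i.deg = (q : ℝ) ^ (2 * i.j) := by
        rw [i.j_eq, mul_div_cancel₀ _ two_ne_zero, Real.rpow_natCast]
      rw [sqrtPar_pow, hq]
      have x0 : (0 : ℝ) ≤ i.x := by positivity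
      have y0 : (0 : ℝ) ≤ i.y := by positivity
      have x1 := i.x_le
      have y1 := i.y_le
      have hμ : |i.μ| ≤ i.j := by rw [i.j_eq, i.μ_eq, abs_le]; constructor <;> linarith
      rcases spinSign_cases i.s with ⟨hs, hs'⟩ | ⟨hs, hs'⟩
      · rw [if_pos hs, Complex.norm_real]
        rw [hs'] at y1
        push_cast at y1
        refine h _ _ _ (by rw [i.j_eq]; positivity) hμ ?_
        rw [i.j_eq, i.n_eq, abs_le, hs']; push_cast; constructor <;> linarith
      · rw [if_neg (by rw [hs]; decide), Complex.norm_real]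
        rw [hs'] at y1
        push_cast at y1
        refine h' _ _ _ (by rw [i.j_eq]; linarith) hμ ?_
        rw [i.j_eq, i.n_eq, abs_le, hs']; push_cast; constructor <;> linarith

/-- In contrast to `coeff_bound₂`, both q-integers are used: their inverses contribute q^(C - 1) and
q^(D - 1). The two lost units turn the exponent J + 1 into J - 1, hence the factor q⁻¹ in the
constant. The margin J + 1 is attained by the entries of b_±. -/
theorem offDiag_coeff_le {q : ℝ} (h0 : 0 < q) (h1 : q < 1) (α A β B C D J : ℝ) (hC : 1 ≤ C) (hD : 1 ≤ D)
    (hE : J + 1 ≤ α - A / 2 + β - B / 2 + C + D) :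
    |q ^ α * √(qInt q A) * (q ^ β * (√(qInt q B) / (qInt q C * qInt q D)))|
      ≤ (q⁻¹ - q)⁻¹ * q⁻¹ * q ^ J := by
  have hc := inv_sub_pos h0 h1
  obtain ⟨i0, i1⟩ := qInt_inv_le h0 h1 hC
  obtain ⟨k0, k1⟩ := qInt_inv_le h0 h1 hD
  rw [div_eq_mul_inv, mul_inv, abs_of_nonneg (by positivity)]
  calc q ^ α * √(qInt q A) * (q ^ β * (√(qInt q B) * ((qInt q C)⁻¹ * (qInt q D)⁻¹)))
      ≤ q ^ α * (√((q⁻¹ - q)⁻¹) * q ^ (-A / 2)) *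
        (q ^ β * ((√((q⁻¹ - q)⁻¹) * q ^ (-B / 2)) * (q ^ (C - 1) * q ^ (D - 1)))) := by
        have := sqrt_qInt_le h0 h1 A
        have := sqrt_qInt_le h0 h1 B
        gcongr
    _ = (√((q⁻¹ - q)⁻¹) * √((q⁻¹ - q)⁻¹)) *
        (q ^ α * q ^ (-A / 2) * q ^ β * q ^ (-B / 2) * q ^ (C - 1) * q ^ (D - 1)) := by ring
    _ = (q⁻¹ - q)⁻¹ * q ^ (α + -A / 2 + β + -B / 2 + (C - 1) + (D - 1)) := by
        rw [Real.mul_self_sqrt (by positivity), Real.rpow_add h0, Real.rpow_add h0,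
          Real.rpow_add h0, Real.rpow_add h0, Real.rpow_add h0]
    _ ≤ (q⁻¹ - q)⁻¹ * q ^ (-1 + J) := by
        refine mul_le_mul_of_nonneg_left ?_ (by positivity)
        exact Real.rpow_le_rpow_of_exponent_ge h0 h1.le (by linarith)
    _ = (q⁻¹ - q)⁻¹ * q⁻¹ * q ^ J := by
        rw [Real.rpow_add h0, Real.rpow_neg_one, mul_assoc]

theorem hasSymbol_aOff (q : Par) : HasSymbol q (aOff q) 0 := by
  refine hasSymbol_offDiag q _ _ (((q : ℝ)⁻¹ - q)⁻¹ * (q : ℝ)⁻¹) (fun j μ n hj hμ hn => ?_)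
    (fun j μ n hj hμ hn => ?_) <;>
  · rw [abs_le] at hμ hn
    simp only [aPlusMat, aMinusMat, Matrix.smul_apply, Matrix.of_apply, Matrix.cons_val',
      Matrix.cons_val_zero, Matrix.cons_val_one, Matrix.cons_val_fin_one, smul_eq_mul,
      mul_neg, abs_neg]
    exact offDiag_coeff_le q.2.1 q.2.2 _ _ _ _ _ _ _ (by linarith) (by linarith) (by linarith)

theorem hasSymbol_bOff (q : Par) : HasSymbol q (bOff q) 0 := by
  refine hasSymbol_offDiag q _ _ (((q : ℝ)⁻¹ - q)⁻¹ * (q : ℝ)⁻¹) (fun j μ n hj hμ hn => ?_)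
    (fun j μ n hj hμ hn => ?_) <;>
  · rw [abs_le] at hμ hn
    simp only [bPlusMat, bMinusMat, Matrix.smul_apply, Matrix.of_apply, Matrix.cons_val',
      Matrix.cons_val_zero, Matrix.cons_val_one, Matrix.cons_val_fin_one, smul_eq_mul,
      mul_neg, abs_neg]
    exact offDiag_coeff_le q.2.1 q.2.2 _ _ _ _ _ _ _ (by linarith) (by linarith) (by linarith)

/-! ### The diagonal coefficients -/

/-- No sign condition on A is needed: for A < 0 both sides contain the root of a negative number,
which is 0. -/
theorem sqrt_qInt_eq {q : ℝ} (h0 : 0 < q) (h1 : q < 1) (A : ℝ) :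
    √(qInt q A) = √((q⁻¹ - q)⁻¹) * q ^ (-A / 2) * √(1 - q ^ (2 * A)) := by
  have hc := inv_sub_pos h0 h1
  have e : qInt q A = (q⁻¹ - q)⁻¹ * (q ^ (-A) * (1 - q ^ (2 * A))) := by
    have : q ^ (-A) * q ^ (2 * A) = q ^ A := by rw [← Real.rpow_add h0]; congr 1; ring
    rw [qInt, div_eq_inv_mul, mul_sub (q ^ (-A)), this, mul_one]
  have e2 : √(q ^ (-A)) = q ^ (-A / 2) := by
    rw [Real.sqrt_eq_rpow, ← Real.rpow_mul h0.le]; congr 1; ring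
  rw [e, Real.sqrt_mul (by positivity), Real.sqrt_mul (by positivity), e2, mul_assoc]

theorem inv_qInt_eq {q : ℝ} (h0 : 0 < q) (C : ℝ) :
    (qInt q C)⁻¹ = (q⁻¹ - q) * q ^ C * (1 - q ^ (2 * C))⁻¹ := by
  have e : qInt q C = (q⁻¹ - q)⁻¹ * (q ^ (-C) * (1 - q ^ (2 * C))) := by
    have : q ^ (-C) * q ^ (2 * C) = q ^ C := by rw [← Real.rpow_add h0]; congr 1; ring
    rw [qInt, div_eq_inv_mul, mul_sub (q ^ (-C)), this, mul_one]
  rw [e, mul_inv, mul_inv, inv_inv, Real.rpow_neg h0.le, inv_inv, mul_assoc]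

/-- The two square roots supply (q⁻¹ - q)⁻¹ and the denominator supplies q⁻¹ - q, which cancel. The
powers of q add up to E. -/
theorem diag_coeff_eq {q : ℝ} (h0 : 0 < q) (h1 : q < 1) {α A β B C E : ℝ}
    (hE : α - A / 2 + β - B / 2 + C = E) :
    q ^ α * √(qInt q A) * (q ^ β * (√(qInt q B) / qInt q C))
      = q ^ E * (√(1 - q ^ (2 * A)) * √(1 - q ^ (2 * B)) * (1 - q ^ (2 * C))⁻¹) := by
  have hc := inv_sub_pos h0 h1
  have e : q ^ E = q ^ α * q ^ (-A / 2) * q ^ β * q ^ (-B / 2) * q ^ C := by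
    rw [← Real.rpow_add h0, ← Real.rpow_add h0, ← Real.rpow_add h0, ← Real.rpow_add h0]
    congr 1; linarith
  have e1 : √((q⁻¹ - q)⁻¹) * √((q⁻¹ - q)⁻¹) * (q⁻¹ - q) = 1 := by
    rw [Real.mul_self_sqrt (by positivity), inv_mul_cancel₀ hc.ne']
  rw [div_eq_mul_inv, sqrt_qInt_eq h0 h1, sqrt_qInt_eq h0 h1, inv_qInt_eq h0, e]
  linear_combination (q ^ α * q ^ (-A / 2) * q ^ β * q ^ (-B / 2) * q ^ C *
    (√(1 - q ^ (2 * A)) * √(1 - q ^ (2 * B)) * (1 - q ^ (2 * C))⁻¹)) * e1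

theorem diag_coeff_eq' {q : ℝ} (h0 : 0 < q) (h1 : q < 1) {α A B C E : ℝ}
    (hE : α - A / 2 - B / 2 + C = E) :
    q ^ α * √(qInt q A) * (√(qInt q B) / qInt q C)
      = q ^ E * (√(1 - q ^ (2 * A)) * √(1 - q ^ (2 * B)) * (1 - q ^ (2 * C))⁻¹) := by
  have := diag_coeff_eq h0 h1 (β := 0) (α := α) (A := A) (B := B) (C := C) (E := E) (by linarith)
  rwa [Real.rpow_zero, one_mul] at this

section Entries
variable (q : Par) (k : SpinIdx)

/-- In the coordinates x, y all powers of q cancel (E = 0). The argument c of the q-integer in the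
denominator differs between the spins, but later only c ≥ 1 and c ≥ 2j matter, so ↑ and ↓ are
treated together from here on. The same holds for the other three matrices. -/
theorem aPlusMat_diag : ∃ c : ℝ, 1 ≤ c ∧ k.deg ≤ c ∧ aPlusMat q k.j k.μ k.n k.s k.s
    = √(1 - (q : ℝ) ^ (2 * (k.x + 1 : ℝ))) * √(1 - (q : ℝ) ^ (2 * (k.y + 1 : ℝ)))
      * (1 - (q : ℝ) ^ (2 * c))⁻¹ := by
  have hd : (0 : ℝ) ≤ k.deg := by positivity
  have hq : (q : ℝ) ^ (0 : ℝ) = 1 := Real.rpow_zero _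
  rw [k.j_eq, k.μ_eq, k.n_eq]
  rcases spinSign_cases k.s with ⟨hs, hs'⟩ | ⟨hs, hs'⟩ <;> rw [hs', hs]
  · refine ⟨k.deg + 2, by linarith, by linarith, ?_⟩
    simp only [aPlusMat, Matrix.smul_apply, Matrix.of_apply, Matrix.cons_val',
      Matrix.cons_val_zero, Matrix.cons_val_fin_one, smul_eq_mul]
    rw [diag_coeff_eq q.2.1 q.2.2 (E := 0) (by push_cast; ring), hq, one_mul]
    push_cast
    ring_nf
  · refine ⟨k.deg + 1, by linarith, by linarith, ?_⟩
    simp only [aPlusMat, Matrix.smul_apply, Matrix.of_apply, Matrix.cons_val',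
      Matrix.cons_val_one, Matrix.cons_val_fin_one, smul_eq_mul]
    rw [diag_coeff_eq q.2.1 q.2.2 (E := 0) (by push_cast; ring), hq, one_mul]
    push_cast
    ring_nf

theorem one_le_deg (hs : k.s = 1) : (1 : ℝ) ≤ k.deg := by
  have := SpinIdx.one_le_J (k := k) (by rw [hs]; decide)
  rw [← k.deg_cast] at this
  exact_mod_cast this

theorem aMinusMat_diag : ∃ c : ℝ, 1 ≤ c ∧ k.deg ≤ c ∧ aMinusMat q k.j k.μ k.n k.s k.s
    = (q : ℝ) ^ (k.x + k.y + 1 : ℝ) * (√(1 - (q : ℝ) ^ (2 * (k.deg - k.x : ℝ)))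
      * √(1 - (q : ℝ) ^ (2 * (k.deg - k.y + spinSign k.s : ℝ))) * (1 - (q : ℝ) ^ (2 * c))⁻¹) := by
  have hd : (0 : ℝ) ≤ k.deg := by positivity
  rw [k.j_eq, k.μ_eq, k.n_eq]
  rcases spinSign_cases k.s with ⟨hs, hs'⟩ | ⟨hs, hs'⟩ <;> rw [hs', hs]
  · refine ⟨k.deg + 1, by linarith, by linarith, ?_⟩
    simp only [aMinusMat, Matrix.smul_apply, Matrix.of_apply, Matrix.cons_val',
      Matrix.cons_val_zero, Matrix.cons_val_fin_one, smul_eq_mul]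
    rw [diag_coeff_eq q.2.1 q.2.2 (E := k.x + k.y + 1) (by push_cast; ring)]
    push_cast
    ring_nf
  -- The denominator is [2j] here, and 2j ≥ 1 because the spin is ↓.
  · refine ⟨k.deg, one_le_deg k hs, le_rfl, ?_⟩
    simp only [aMinusMat, Matrix.smul_apply, Matrix.of_apply, Matrix.cons_val',
      Matrix.cons_val_one, Matrix.cons_val_fin_one, smul_eq_mul]
    rw [diag_coeff_eq q.2.1 q.2.2 (E := k.x + k.y + 1) (by push_cast; ring)]
    push_cast
    ring_nf

theorem bPlusMat_diag : ∃ c : ℝ, 1 ≤ c ∧ k.deg ≤ c ∧ bPlusMat q k.j k.μ k.n k.s k.s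
    = (q : ℝ) ^ (k.y : ℝ) * (√(1 - (q : ℝ) ^ (2 * (k.x + 1 : ℝ)))
      * √(1 - (q : ℝ) ^ (2 * (k.deg - k.y + 1 + spinSign k.s : ℝ)))
      * (1 - (q : ℝ) ^ (2 * c))⁻¹) := by
  have hd : (0 : ℝ) ≤ k.deg := by positivity
  rw [k.j_eq, k.μ_eq, k.n_eq]
  rcases spinSign_cases k.s with ⟨hs, hs'⟩ | ⟨hs, hs'⟩ <;> rw [hs', hs]
  · refine ⟨k.deg + 2, by linarith, by linarith, ?_⟩
    simp only [bPlusMat, Matrix.smul_apply, Matrix.of_apply, Matrix.cons_val',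
      Matrix.cons_val_zero, Matrix.cons_val_fin_one, smul_eq_mul]
    rw [diag_coeff_eq' q.2.1 q.2.2 (E := k.y) (by push_cast; ring)]
    push_cast
    ring_nf
  · refine ⟨k.deg + 1, by linarith, by linarith, ?_⟩
    simp only [bPlusMat, Matrix.smul_apply, Matrix.of_apply, Matrix.cons_val',
      Matrix.cons_val_one, Matrix.cons_val_fin_one, smul_eq_mul]
    rw [diag_coeff_eq q.2.1 q.2.2 (E := k.y) (by push_cast; ring)]
    push_cast
    ring_nf

theorem bMinusMat_diag : ∃ c : ℝ, 1 ≤ c ∧ k.deg ≤ c ∧ bMinusMat q k.j k.μ k.n k.s k.s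
    = -((q : ℝ) ^ (k.x : ℝ) * (√(1 - (q : ℝ) ^ (2 * (k.deg - k.x : ℝ)))
      * √(1 - (q : ℝ) ^ (2 * (k.y : ℝ))) * (1 - (q : ℝ) ^ (2 * c))⁻¹)) := by
  have hd : (0 : ℝ) ≤ k.deg := by positivity
  rw [k.j_eq, k.μ_eq, k.n_eq]
  rcases spinSign_cases k.s with ⟨hs, hs'⟩ | ⟨hs, hs'⟩ <;> rw [hs', hs]
  · refine ⟨k.deg + 1, by linarith, by linarith, ?_⟩
    simp only [bMinusMat, Matrix.smul_apply, Matrix.of_apply, Matrix.cons_val',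
      Matrix.cons_val_zero, Matrix.cons_val_fin_one, smul_eq_mul, mul_neg]
    rw [diag_coeff_eq q.2.1 q.2.2 (E := k.x) (by push_cast; ring)]
    push_cast
    ring_nf
  · refine ⟨k.deg, one_le_deg k hs, le_rfl, ?_⟩
    simp only [bMinusMat, Matrix.smul_apply, Matrix.of_apply, Matrix.cons_val',
      Matrix.cons_val_one, Matrix.cons_val_fin_one, smul_eq_mul, mul_neg]
    rw [diag_coeff_eq' q.2.1 q.2.2 (E := k.x) (by push_cast; ring)]
    push_cast
    ring_nf

end Entries

theorem one_sub_le_sqrt {u : ℝ} (h0 : 0 ≤ u) (h1 : u ≤ 1) : 1 - u ≤ √(1 - u) := by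
  refine Real.le_sqrt_of_sq_le ?_
  nlinarith

/-- Replacing the factors `√(1 - u)`, `√(1 - v)`, `(1 - w)⁻¹` by `1`. -/
theorem abs_coeff_sub_le {q P S u v w X : ℝ} (h1 : q < 1) (hP0 : 0 ≤ P) (hP1 : P ≤ 1)
    (hS0 : 0 ≤ S) (hS1 : S ≤ 1) (hu0 : 0 ≤ u) (hu1 : u ≤ 1) (hv0 : 0 ≤ v) (hv1 : v ≤ 1)
    (hw0 : 0 ≤ w) (hw1 : w ≤ q) (hu : P * u ≤ X) (hv : P * v ≤ X) (hw : w ≤ X) :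
    |P * S - P * S * (√(1 - u) * √(1 - v) * (1 - w)⁻¹)| ≤ 3 * (1 - q)⁻¹ * X := by
  have hq : 0 < 1 - q := by linarith
  have hw' : 0 < 1 - w := by linarith
  have hsu := one_sub_le_sqrt hu0 hu1
  have hsv := one_sub_le_sqrt hv0 hv1
  have hsu1 : √(1 - u) ≤ 1 := Real.sqrt_le_one.mpr (by linarith)
  have hsv1 : √(1 - v) ≤ 1 := Real.sqrt_le_one.mpr (by linarith)
  have hsu0 := Real.sqrt_nonneg (1 - u)
  have hsv0 := Real.sqrt_nonneg (1 - v)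
  set R := √(1 - u) * √(1 - v) with hR
  have hR1 : R ≤ 1 := mul_le_one₀ hsu1 hsv0 hsv1
  have hR2 : 1 - u - v ≤ R := by
    have : (1 - u) * (1 - v) ≤ R := mul_le_mul hsu hsv (by linarith) hsu0
    nlinarith
  -- The error is P S (1 - w - R) / (1 - w). By 1 - u - v ≤ R ≤ 1 the numerator is at most u + v + w
  -- in absolute value, and w ≤ q keeps the denominator above 1 - q.
  have e : P * S - P * S * (R * (1 - w)⁻¹) = P * S * ((1 - w - R) * (1 - w)⁻¹) := by
    field_simp
  have hi : (1 - w)⁻¹ ≤ (1 - q)⁻¹ := inv_anti₀ hq (by linarith)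
  have habs : |1 - w - R| ≤ u + v + w := by rw [abs_le]; constructor <;> linarith
  rw [e, abs_mul, abs_mul (1 - w - R), abs_of_nonneg (mul_nonneg hP0 hS0), abs_of_pos (inv_pos.mpr hw')]
  have hi0 : 0 ≤ (1 - w)⁻¹ := by positivity
  have hX : P * (u + v + w) ≤ 3 * X := by nlinarith
  calc P * S * (|1 - w - R| * (1 - w)⁻¹) ≤ P * 1 * ((u + v + w) * (1 - q)⁻¹) := by gcongr
    _ = P * (u + v + w) * (1 - q)⁻¹ := by ring
    _ ≤ 3 * X * (1 - q)⁻¹ := by gcongr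
    _ = 3 * (1 - q)⁻¹ * X := by ring

/-! ### The values of the symbol map act as weighted shifts -/

section Act
variable (q : Par) (x y : ℕ) (J : ℤ) (s : Fin 2)

theorem circleAct_u (J : ℤ) : circleAct u (basisVec J) = (1 : ℂ) • basisVec (J + 1) := by
  have := circleAct_C_mul_T 1 1
  rw [map_one, one_mul, one_smul] at this
  rw [u, this, translate_basisVec, one_smul]

theorem circleAct_star_u (J : ℤ) :
    circleAct (star u) (basisVec J) = (1 : ℂ) • basisVec (J - 1) := by
  have := circleAct_C_mul_T 1 (-1)
  rw [map_one, one_mul, one_smul] at this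
  rw [star_u, this, translate_basisVec, one_smul, sub_eq_add_neg]

theorem diskAct_a (ε : ℤˣ) : diskAct q ε (r q ε (SUq2.a q)) = diskA q := by
  rw [diskAct_r, diskRep, SUq2.starLift_a]

theorem diskAct_b (ε : ℤˣ) : diskAct q ε (r q ε (SUq2.b q)) = diskB q ε := by
  rw [diskAct_r, diskRep, SUq2.starLift_b]

theorem diskAct_star_a (ε : ℤˣ) : diskAct q ε (r q ε (star (SUq2.a q))) = star (diskA q) := by
  rw [map_star, diskAct_star, diskAct_a]

theorem diskAct_star_b (ε : ℤˣ) : diskAct q ε (r q ε (star (SUq2.b q))) = diskB q ε := by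
  rw [map_star, diskAct_star, diskAct_b, star_diskB]

theorem symbolAct_tmul_basisVec {d : Disk q 1} {d' : Disk q (-1)} {f : CircleAlg}
    {α β : ℂ} {x y x' y' : ℕ} {J J' : ℤ} {s : Fin 2}
    (h1 : diskAct q 1 d (basisVec x) = α • basisVec x')
    (h2 : diskAct q (-1) d' (basisVec y) = β • basisVec y')
    (h3 : circleAct f (basisVec J) = (1 : ℂ) • basisVec J') :
    symbolAct q (d ⊗ₜ (d' ⊗ₜ f)) (basisVec (x, y, J, s))
      = (α * β) • basisVec (x', y', J', s) := by
  rw [symbolAct_tmul, mul_apply_eq_comp, mul_apply_eq_comp,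
    amplify_basisVec leg₃ (l := (x, y, J, s)) h3, map_smul,
    amplify_basisVec leg₂ (l := leg₃.symm (J', (leg₃ (x, y, J, s)).2)) h2, map_smul, map_smul,
    amplify_basisVec leg₁
      (l := leg₂.symm (y', (leg₂ (leg₃.symm (J', (leg₃ (x, y, J, s)).2))).2)) h1, one_smul,
    smul_smul, mul_comm]
  rfl

theorem symAPlus_act : symbolAct q (symAPlus q) (basisVec (x, y, J, s))
    = ((√(1 - (q : ℝ) ^ (2 * x + 2)) * √(1 - (q : ℝ) ^ (2 * y + 2)) : ℝ) : ℂ)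
      • basisVec (x + 1, y + 1, J + 1, s) := by
  rw [Complex.ofReal_mul]
  exact symbolAct_tmul_basisVec q (by rw [diskAct_a, diskA_basis])
    (by rw [diskAct_a, diskA_basis]) (circleAct_u J)

/-- The eigenvalue of π_-(b^*) = π_-(b) is -q^y, which cancels the sign in front. The same happens
for `symBPlus`. In `symBMinus` the factor b sits in the first leg, with positive eigenvalues, and
the sign remains. -/
theorem symAMinus_act : symbolAct q (symAMinus q) (basisVec (x, y, J, s))
    = (((q : ℝ) ^ (x + y + 1) : ℝ) : ℂ) • basisVec (x, y, J - 1, s) := by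
  rw [symAMinus, map_neg, map_smul, neg_apply, smul_apply,
    symbolAct_tmul_basisVec q (by rw [diskAct_b, diskB_basis]) (by rw [diskAct_star_b, diskB_basis])
      (circleAct_star_u J), smul_smul, ← neg_smul]
  congr 1
  push_cast
  ring

theorem symBPlus_act : symbolAct q (symBPlus q) (basisVec (x, y, J, s))
    = (((q : ℝ) ^ y * √(1 - (q : ℝ) ^ (2 * x + 2)) : ℝ) : ℂ) • basisVec (x + 1, y, J + 1, s) := by
  rw [symBPlus, map_neg, neg_apply,
    symbolAct_tmul_basisVec q (by rw [diskAct_a, diskA_basis]) (by rw [diskAct_b, diskB_basis])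
      (circleAct_u J), ← neg_smul]
  congr 1
  push_cast
  ring

theorem symBMinus_act_zero : symbolAct q (symBMinus q) (basisVec (x, 0, J, s)) = 0 := by
  rw [symBMinus, map_neg, neg_apply,
    symbolAct_tmul_basisVec q (y' := 0) (β := 0) (by rw [diskAct_b, diskB_basis])
      (by rw [diskAct_star_a, star_diskA_basis_zero, zero_smul]) (circleAct_star_u J),
    mul_zero, zero_smul, neg_zero]

theorem symBMinus_act_succ : symbolAct q (symBMinus q) (basisVec (x, y + 1, J, s))
    = ((-((q : ℝ) ^ x * √(1 - (q : ℝ) ^ (2 * y + 2))) : ℝ) : ℂ) • basisVec (x, y, J - 1, s) := by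
  rw [symBMinus, map_neg, neg_apply,
    symbolAct_tmul_basisVec q (by rw [diskAct_b, diskB_basis])
      (by rw [diskAct_star_a, star_diskA_basis_succ]) (circleAct_star_u J), ← neg_smul]
  congr 1
  push_cast
  ring

end Act

/-! ### The symbols of the diagonal generators -/

theorem incl_ket_of_eq {J M N : ℤ} {s : Fin 2} (x y : ℕ) (hM : M = 2 * x - J)
    (hN : N = 2 * y - J - spinSign s) : incl (ket J M N s)
      = if 0 ≤ J ∧ (x : ℤ) ≤ J ∧ (y : ℤ) ≤ J + spinSign s then basisVec (x, y, J, s) else 0 := by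
  rw [hM, hN, incl_ket]

theorem pow_add_two_eq (q : Par) (x : ℕ) :
    (q : ℝ) ^ (2 * x + 2) = (q : ℝ) ^ (2 * (x + 1 : ℝ)) := by
  rw [← Real.rpow_natCast]; push_cast; ring_nf

theorem rpow_par_anti (q : Par) {a b : ℝ} (h : a ≤ b) : (q : ℝ) ^ b ≤ (q : ℝ) ^ a :=
  Real.rpow_le_rpow_of_exponent_ge q.2.1 q.2.2.le h

theorem rpow_par_le_one (q : Par) {a : ℝ} (h : 0 ≤ a) : (q : ℝ) ^ a ≤ 1 :=
  Real.rpow_le_one q.2.1.le q.2.2.le h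

theorem rpow_par_nonneg (q : Par) (a : ℝ) : 0 ≤ (q : ℝ) ^ a := Real.rpow_nonneg q.2.1.le a

theorem sqrt_one_sub_rpow_le (q : Par) (a : ℝ) : √(1 - (q : ℝ) ^ a) ≤ 1 :=
  Real.sqrt_le_one.mpr (by linarith [rpow_par_nonneg q a])

theorem sqrt_one_sub_pow_le (q : Par) (a : ℕ) : √(1 - (q : ℝ) ^ a) ≤ 1 :=
  Real.sqrt_le_one.mpr (by linarith [pow_nonneg q.2.1.le a])

theorem rpow_two_mul_le (q : Par) {c : ℝ} (h : 1 ≤ c) : (q : ℝ) ^ (2 * c) ≤ q := by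
  have := rpow_par_anti q (show (1 : ℝ) ≤ 2 * c by linarith)
  rwa [Real.rpow_one] at this

theorem bigDeg_shift_le {i k : BigIdx} (h : |k.2.2.1 - i.2.2.1| ≤ 1) :
    bigDeg k ≤ bigDeg i + 1 ∧ bigDeg i ≤ bigDeg k + 1 := by
  rw [abs_le] at h
  simp only [bigDeg]
  omega

section Generators
variable (q : Par)

/-- The constant in the comparison of the coefficients with their limits. -/
def symbolConst : ℝ := 3 * (1 - (q : ℝ))⁻¹

theorem one_le_symbolConst : 1 ≤ symbolConst q := by
  have h0 := q.2.1
  have h1 : 0 < 1 - (q : ℝ) := sub_pos.mpr q.2.2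
  rw [symbolConst, ← div_eq_mul_inv, le_div_iff₀ h1]
  linarith

theorem hasSymbol_aTildePlus : HasSymbol q (aTildePlus q) (symAPlus q) := by
  refine .of_shift (diagPart_mem_decayAlg (spinOp_mem_decayAlg _ _ (by norm_num)))
    (fun i => ((√(1 - (q : ℝ) ^ (2 * i.1 + 2)) * √(1 - (q : ℝ) ^ (2 * i.2.1 + 2)) : ℝ) : ℂ))
    (fun i => some (i.1 + 1, i.2.1 + 1, i.2.2.1 + 1, i.2.2.2))
    (fun k => ((aPlusMat q k.j k.μ k.n k.s k.s : ℝ) : ℂ))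
    (fun i => symAPlus_act q _ _ _ _) (fun k => ?_) ?_ ?_ ⟨1, fun i => ?_⟩ (symbolConst q)
    (zero_le_one.trans (one_le_symbolConst q)) (fun k => ?_) ?_
  · obtain ⟨hM, hN, h0, hx, hy⟩ := k.coords
    rw [aTildePlus, aPlus, diagPart_spinOp_basisVec, map_smul,
      incl_ket_of_eq (k.x + 1) (k.y + 1) (by push_cast; omega) (by push_cast; omega),
      if_pos (by push_cast; omega)]
    rfl
  · intro i i' k h h'
    obtain ⟨x, y, J, s⟩ := i
    obtain ⟨x', y', J', s'⟩ := i'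
    have := (Option.some.inj h).trans (Option.some.inj h').symm
    simpa using this
  · intro i k h
    obtain rfl := Option.some.inj h
    exact bigDeg_shift_le (by simp)
  · rw [Complex.norm_real, Real.norm_of_nonneg (by positivity)]
    exact mul_le_one₀ (sqrt_one_sub_pow_le _ _) (Real.sqrt_nonneg _) (sqrt_one_sub_pow_le _ _)
  · obtain ⟨c, hc, hd, e⟩ := aPlusMat_diag q k
    rw [e, relabel_eq, pow_add_two_eq, pow_add_two_eq, ← Complex.ofReal_sub, Complex.norm_real,
      Real.norm_eq_abs]
    -- Both square roots already occur in the symbol, so they form S and u = v = 0. Only 1 / (1 -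
    -- q^(2c)) has to be replaced by 1.
    have := abs_coeff_sub_le (q := (q : ℝ)) (P := 1)
      (S := √(1 - (q : ℝ) ^ (2 * (k.x + 1 : ℝ))) * √(1 - (q : ℝ) ^ (2 * (k.y + 1 : ℝ))))
      (u := 0) (v := 0) (w := (q : ℝ) ^ (2 * c)) (X := (q : ℝ) ^ k.deg) q.2.2 zero_le_one le_rfl
      (by positivity)
      (mul_le_one₀ (sqrt_one_sub_rpow_le _ _) (Real.sqrt_nonneg _) (sqrt_one_sub_rpow_le _ _))
      le_rfl zero_le_one le_rfl zero_le_one (rpow_par_nonneg _ _) (rpow_two_mul_le q hc)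
      (by have := pow_nonneg q.2.1.le k.deg; simpa using this)
      (by have := pow_nonneg q.2.1.le k.deg; simpa using this)
      (by rw [← Real.rpow_natCast]; exact rpow_par_anti q (by linarith))
    simpa only [symbolConst, sub_zero, Real.sqrt_one, one_mul] using this
  -- Nothing enters from outside: if the shifted label is that of a spinor, so is the original one.
  · rintro ⟨x, y, J, s⟩ hi k hk
    rw [relabel_eq, Option.some_inj] at hk
    simp only [Prod.mk.injEq] at hk
    obtain ⟨hx, hy, hJ, rfl⟩ := hk
    have := k.coords
    exact absurd (mem_range_relabel (by omega)) hi

theorem hasSymbol_aTildeMinus : HasSymbol q (aTildeMinus q) (symAMinus q) := by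
  refine .of_shift (diagPart_mem_decayAlg (spinOp_mem_decayAlg _ _ (by norm_num)))
    (fun i => (((q : ℝ) ^ (i.1 + i.2.1 + 1) : ℝ) : ℂ))
    (fun i => some (i.1, i.2.1, i.2.2.1 - 1, i.2.2.2))
    (fun k => ((aMinusMat q k.j k.μ k.n k.s k.s : ℝ) : ℂ))
    (fun i => symAMinus_act q _ _ _ _) (fun k => ?_) ?_ ?_ ⟨1, fun i => ?_⟩ (symbolConst q)
    (zero_le_one.trans (one_le_symbolConst q)) (fun k => ?_) ?_
  · obtain ⟨hM, hN, h0, hx, hy⟩ := k.coords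
    rw [aTildeMinus, aMinus, diagPart_spinOp_basisVec, map_smul,
      incl_ket_of_eq k.x k.y (by omega) (by omega)]
    split_ifs with h
    · rfl
    -- A missing target label means x = 2j or y = 2j ± 1 (sign + for ↑), and then a factor √(1 -
    -- q^0) = 0 makes the coefficient vanish.
    · obtain ⟨c, -, -, e⟩ := aMinusMat_diag q k
      have hz : (k.deg : ℝ) - k.x = 0 ∨ (k.deg : ℝ) - k.y + spinSign k.s = 0 := by
        have hJ := k.deg_cast
        have : (k.deg : ℤ) - k.x = 0 ∨ (k.deg : ℤ) - k.y + spinSign k.s = 0 := by omega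
        exact_mod_cast this
      rw [e]
      rcases hz with hz | hz <;> simp [hz]
  · intro i i' k h h'
    obtain ⟨x, y, J, s⟩ := i
    obtain ⟨x', y', J', s'⟩ := i'
    have := (Option.some.inj h).trans (Option.some.inj h').symm
    simpa using this
  · intro i k h
    obtain rfl := Option.some.inj h
    exact bigDeg_shift_le (by simp)
  · rw [Complex.norm_real, Real.norm_of_nonneg (pow_nonneg q.2.1.le _)]
    exact pow_le_one₀ q.2.1.le q.2.2.le
  · obtain ⟨c, hc, hd, e⟩ := aMinusMat_diag q k
    have x0 : (0 : ℝ) ≤ k.x := by positivity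
    have y0 : (0 : ℝ) ≤ k.y := by positivity
    have x1 := k.x_le
    have y1 := k.y_le
    have s1 : (spinSign k.s : ℝ) ≤ 1 ∧ (-1 : ℝ) ≤ spinSign k.s := by
      rcases spinSign_cases k.s with ⟨-, h⟩ | ⟨-, h⟩ <;> rw [h] <;> norm_num
    have hX : (q : ℝ) ^ k.deg = (q : ℝ) ^ (k.deg : ℝ) := (Real.rpow_natCast _ _).symm
    have hP : (q : ℝ) ^ (k.x + k.y + 1) = (q : ℝ) ^ (k.x + k.y + 1 : ℝ) := by
      rw [← Real.rpow_natCast]; push_cast; rfl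
    rw [e, relabel_eq, hP, ← Complex.ofReal_sub, Complex.norm_real, Real.norm_eq_abs, hX]
    -- The power q^(x + y + 1) compensates for u and v being large near the boundary: x + 2 (2j - x)
    -- ≥ 2j because x ≤ 2j, and similarly for y. For ↓ with x = 0 and y = 2j - 1 the summand 1 in
    -- the exponent is used up entirely.
    have := abs_coeff_sub_le (q := (q : ℝ)) (P := (q : ℝ) ^ (k.x + k.y + 1 : ℝ)) (S := 1)
      (u := (q : ℝ) ^ (2 * (k.deg - k.x : ℝ)))
      (v := (q : ℝ) ^ (2 * (k.deg - k.y + spinSign k.s : ℝ))) (w := (q : ℝ) ^ (2 * c))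
      (X := (q : ℝ) ^ (k.deg : ℝ)) q.2.2 (rpow_par_nonneg _ _) (rpow_par_le_one q (by linarith))
      zero_le_one le_rfl (rpow_par_nonneg _ _) (rpow_par_le_one q (by linarith))
      (rpow_par_nonneg _ _) (rpow_par_le_one q (by linarith)) (rpow_par_nonneg _ _)
      (rpow_two_mul_le q hc)
      (by rw [← Real.rpow_add q.2.1]; exact rpow_par_anti q (by linarith))
      (by rw [← Real.rpow_add q.2.1]; exact rpow_par_anti q (by linarith))
      (rpow_par_anti q (by linarith))
    simpa only [symbolConst, mul_one] using this
  · rintro ⟨x, y, J, s⟩ hi k hk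
    rw [relabel_eq, Option.some_inj] at hk
    simp only [Prod.mk.injEq] at hk
    obtain ⟨hx, hy, hJ, rfl⟩ := hk
    have := k.coords
    exact absurd (mem_range_relabel (by omega)) hi

theorem hasSymbol_bTildePlus : HasSymbol q (bTildePlus q) (symBPlus q) := by
  refine .of_shift (diagPart_mem_decayAlg (spinOp_mem_decayAlg _ _ (by norm_num)))
    (fun i => (((q : ℝ) ^ i.2.1 * √(1 - (q : ℝ) ^ (2 * i.1 + 2)) : ℝ) : ℂ))
    (fun i => some (i.1 + 1, i.2.1, i.2.2.1 + 1, i.2.2.2))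
    (fun k => ((bPlusMat q k.j k.μ k.n k.s k.s : ℝ) : ℂ))
    (fun i => symBPlus_act q _ _ _ _) (fun k => ?_) ?_ ?_ ⟨1, fun i => ?_⟩ (symbolConst q)
    (zero_le_one.trans (one_le_symbolConst q)) (fun k => ?_) ?_
  · obtain ⟨hM, hN, h0, hx, hy⟩ := k.coords
    rw [bTildePlus, bPlus, diagPart_spinOp_basisVec, map_smul,
      incl_ket_of_eq (k.x + 1) k.y (by push_cast; omega) (by omega),
      if_pos (by push_cast; omega)]
    rfl
  · intro i i' k h h'
    obtain ⟨x, y, J, s⟩ := i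
    obtain ⟨x', y', J', s'⟩ := i'
    have := (Option.some.inj h).trans (Option.some.inj h').symm
    simpa using this
  · intro i k h
    obtain rfl := Option.some.inj h
    exact bigDeg_shift_le (by simp)
  · have h0 := q.2.1
    rw [Complex.norm_real, Real.norm_of_nonneg (by positivity)]
    exact mul_le_one₀ (pow_le_one₀ h0.le q.2.2.le) (Real.sqrt_nonneg _) (sqrt_one_sub_pow_le _ _)
  · obtain ⟨c, hc, hd, e⟩ := bPlusMat_diag q k
    have y0 : (0 : ℝ) ≤ k.y := by positivity
    have x1 := k.x_le
    have y1 := k.y_le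
    have s1 : (spinSign k.s : ℝ) ≤ 1 ∧ (-1 : ℝ) ≤ spinSign k.s := by
      rcases spinSign_cases k.s with ⟨-, h⟩ | ⟨-, h⟩ <;> rw [h] <;> norm_num
    have hX : (q : ℝ) ^ k.deg = (q : ℝ) ^ (k.deg : ℝ) := (Real.rpow_natCast _ _).symm
    have hP : (q : ℝ) ^ k.y = (q : ℝ) ^ (k.y : ℝ) := (Real.rpow_natCast _ _).symm
    rw [e, relabel_eq]
    dsimp only
    rw [hP, pow_add_two_eq, ← Complex.ofReal_sub, Complex.norm_real, Real.norm_eq_abs, hX]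
    -- The root in x belongs to the symbol and goes into S. Only the root in v has to be
    -- compensated, by the factor q^y.
    have := abs_coeff_sub_le (q := (q : ℝ)) (P := (q : ℝ) ^ (k.y : ℝ))
      (S := √(1 - (q : ℝ) ^ (2 * (k.x + 1 : ℝ)))) (u := 0)
      (v := (q : ℝ) ^ (2 * (k.deg - k.y + 1 + spinSign k.s : ℝ))) (w := (q : ℝ) ^ (2 * c))
      (X := (q : ℝ) ^ (k.deg : ℝ)) q.2.2 (rpow_par_nonneg _ _) (rpow_par_le_one q y0)
      (Real.sqrt_nonneg _) (sqrt_one_sub_rpow_le _ _) le_rfl zero_le_one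
      (rpow_par_nonneg _ _) (rpow_par_le_one q (by linarith)) (rpow_par_nonneg _ _)
      (rpow_two_mul_le q hc) (by rw [mul_zero]; exact rpow_par_nonneg _ _)
      (by rw [← Real.rpow_add q.2.1]; exact rpow_par_anti q (by linarith))
      (rpow_par_anti q (by linarith))
    simpa only [symbolConst, sub_zero, Real.sqrt_one, one_mul, mul_assoc] using this
  · rintro ⟨x, y, J, s⟩ hi k hk
    rw [relabel_eq, Option.some_inj] at hk
    simp only [Prod.mk.injEq] at hk
    obtain ⟨hx, hy, hJ, rfl⟩ := hk
    have hk := k.coords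
    have hs : spinSign k.s = 1 ∨ spinSign k.s = -1 := (spinSign_cases k.s).imp And.right And.right
    -- This shift does enter the spinors from outside, through the face y = 2j + 1 ± 1 (sign + for
    -- ↑). There y ≥ 2j, so the weight q^y is small enough.
    have hy' : J.natAbs ≤ y := by
      by_contra hlt
      exact hi (mem_range_relabel (by omega))
    have h0 := q.2.1
    rw [Complex.norm_real, Real.norm_of_nonneg (by positivity)]
    calc (q : ℝ) ^ y * √(1 - (q : ℝ) ^ (2 * x + 2)) ≤ (q : ℝ) ^ J.natAbs * 1 := by
          exact mul_le_mul (pow_le_pow_of_le_one h0.le q.2.2.le hy') (sqrt_one_sub_pow_le _ _)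
            (Real.sqrt_nonneg _) (by positivity)
      _ ≤ symbolConst q * (q : ℝ) ^ bigDeg (x, y, J, k.s) := by
          rw [mul_one]
          exact le_mul_of_one_le_left (by positivity) (one_le_symbolConst q)

theorem hasSymbol_bTildeMinus : HasSymbol q (bTildeMinus q) (symBMinus q) := by
  refine .of_shift (diagPart_mem_decayAlg (spinOp_mem_decayAlg _ _ (by norm_num)))
    (fun i => ((-((q : ℝ) ^ i.1 * √(1 - (q : ℝ) ^ (2 * i.2.1))) : ℝ) : ℂ))
    (fun i => if i.2.1 = 0 then none else some (i.1, i.2.1 - 1, i.2.2.1 - 1, i.2.2.2))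
    (fun k => ((bMinusMat q k.j k.μ k.n k.s k.s : ℝ) : ℂ))
    ?_ (fun k => ?_) ?_ ?_ ⟨1, fun i => ?_⟩ (symbolConst q)
    (zero_le_one.trans (one_le_symbolConst q)) (fun k => ?_) ?_
  · rintro ⟨x, y, J, s⟩
    cases y with
    | zero => rw [symBMinus_act_zero]; simp
    | succ y => exact symBMinus_act_succ q _ _ _ _
  · obtain ⟨hM, hN, h0, hx, hy⟩ := k.coords
    obtain ⟨c, -, -, e⟩ := bMinusMat_diag q k
    rw [bTildeMinus, bMinus, diagPart_spinOp_basisVec, map_smul, relabel_eq]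
    dsimp only
    -- At y = 0 the shift is undefined since π_-(a^*) kills ε_0, and the coefficient contains √(1 -
    -- q^(2y)) = 0. For y > 0 the target label is missing only if x = 2j, where the other root
    -- vanishes.
    by_cases hy0 : k.y = 0
    · rw [e, hy0]
      simp
    · rw [incl_ket_of_eq k.x (k.y - 1) (by omega) (by omega), if_neg hy0]
      split_ifs with h
      · rfl
      · have hz : (k.deg : ℝ) - k.x = 0 := by
          have hJ := k.deg_cast
          have : (k.deg : ℤ) - k.x = 0 := by omega
          exact_mod_cast this
        rw [e]
        simp [hz]
  · intro i i' k h h'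
    obtain ⟨x, y, J, s⟩ := i
    obtain ⟨x', y', J', s'⟩ := i'
    split_ifs at h h'
    have := (Option.some.inj h).trans (Option.some.inj h').symm
    simp only [Prod.mk.injEq] at *
    omega
  · intro i k h
    split_ifs at h
    obtain rfl := Option.some.inj h
    exact bigDeg_shift_le (by simp)
  · have h0 := q.2.1
    rw [Complex.norm_real, norm_neg, Real.norm_of_nonneg (by positivity)]
    exact mul_le_one₀ (pow_le_one₀ h0.le q.2.2.le) (Real.sqrt_nonneg _) (sqrt_one_sub_pow_le _ _)
  · obtain ⟨c, hc, hd, e⟩ := bMinusMat_diag q k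
    have x0 : (0 : ℝ) ≤ k.x := by positivity
    have x1 := k.x_le
    have hX : (q : ℝ) ^ k.deg = (q : ℝ) ^ (k.deg : ℝ) := (Real.rpow_natCast _ _).symm
    have hP : (q : ℝ) ^ k.x = (q : ℝ) ^ (k.x : ℝ) := (Real.rpow_natCast _ _).symm
    have hS : (q : ℝ) ^ (2 * k.y) = (q : ℝ) ^ (2 * (k.y : ℝ)) := by
      rw [← Real.rpow_natCast]; push_cast; rfl
    rw [e, relabel_eq]
    dsimp only
    rw [hP, hS, ← Complex.ofReal_sub, Complex.norm_real, Real.norm_eq_abs, hX, neg_sub_neg,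
      abs_sub_comm]
    have := abs_coeff_sub_le (q := (q : ℝ)) (P := (q : ℝ) ^ (k.x : ℝ))
      (S := √(1 - (q : ℝ) ^ (2 * (k.y : ℝ)))) (u := (q : ℝ) ^ (2 * (k.deg - k.x : ℝ)))
      (v := 0) (w := (q : ℝ) ^ (2 * c))
      (X := (q : ℝ) ^ (k.deg : ℝ)) q.2.2 (rpow_par_nonneg _ _) (rpow_par_le_one q x0)
      (Real.sqrt_nonneg _) (sqrt_one_sub_rpow_le _ _)
      (rpow_par_nonneg _ _) (rpow_par_le_one q (by linarith)) le_rfl zero_le_one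
      (rpow_par_nonneg _ _) (rpow_two_mul_le q hc)
      (by rw [← Real.rpow_add q.2.1]; exact rpow_par_anti q (by linarith))
      (by rw [mul_zero]; exact rpow_par_nonneg _ _)
      (rpow_par_anti q (by linarith))
    rw [sub_zero, Real.sqrt_one, mul_one] at this
    rw [symbolConst]
    convert this using 3
    ring
  · rintro ⟨x, y, J, s⟩ hi k hk
    dsimp only at hk
    split_ifs at hk
    rw [relabel_eq, Option.some_inj] at hk
    simp only [Prod.mk.injEq] at hk
    obtain ⟨hx, hy, hJ, rfl⟩ := hk
    have := k.coords
    exact absurd (mem_range_relabel (by omega)) hi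

end Generators

/-! ### The derivation on the generators -/

/-- The eigenvalue of |D| depends on 2j and the spin only, so an operator that changes it by a fixed
g on every basis vector is an eigenvector of δ. -/
theorem isDelta_of_ket {T : BSpinor} (g : ℝ)
    (h : ∀ l, ∃ (c : ℂ) (J M N : ℤ) (s : Fin 2), T (basisVec l) = c • ket J M N s ∧
      ∀ k : SpinIdx, k.J = J → k.s = s → |diracEv k| = |diracEv l| + g) :
    IsDelta T ((g : ℂ) • T) := by
  refine .of_coeff fun l k => ?_
  obtain ⟨c, J, M, N, s, e, hk⟩ := h l
  rw [smul_apply, lp.coeFn_smul, Pi.smul_apply, smul_eq_mul, e, lp.coeFn_smul, Pi.smul_apply, ket]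
  cases hJ : mkIdx J M N s with
  | none => simp
  | some k' =>
    obtain ⟨h1, -, -, h2⟩ := mkIdx_some hJ
    by_cases hkk : k = k'
    · subst hkk
      rw [hk k h1 h2]
      push_cast
      ring
    · rw [Option.elim_some, basisVec_ne hkk]
      simp

section Delta
variable {m m' : ℝ → ℝ → ℝ → Matrix (Fin 2) (Fin 2) ℝ} {dM dN dM' dN' : ℤ}
  (hm : MatBounded m) (hm' : MatBounded m')

theorem isDelta_diagPart (dJ : ℤ) : IsDelta (diagPart (spinOp m dJ dM dN hm))
    (((dJ : ℝ) : ℂ) • diagPart (spinOp m dJ dM dN hm)) :=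
  isDelta_of_ket _ fun l => ⟨_, _, _, _, _, diagPart_spinOp_basisVec hm l, fun k hJ hs => by
    rw [abs_diracEv_eq, abs_diracEv_eq, hJ, hs]
    push_cast
    ring⟩

/-- The flip ↑ → ↓ lowers |D| by one at fixed j, and raising 2j by one restores it. The flip ↓ → ↑
is the mirror image. -/
theorem isDelta_offDiag :
    IsDelta (offDiag (spinOp m 1 dM dN hm) (spinOp m' (-1) dM' dN' hm')) 0 := by
  have h := isDelta_of_ket (T := offDiag (spinOp m 1 dM dN hm) (spinOp m' (-1) dM' dN' hm')) 0
    fun l => ?_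
  · rwa [Complex.ofReal_zero, zero_smul] at h
  · have e := offDiag_spinOp_basisVec (dJ := 1) (dM := dM) (dN := dN) (dJ' := -1) (dM' := dM')
      (dN' := dN') hm hm' l
    by_cases hl : l.s = 0
    · rw [if_pos hl] at e
      refine ⟨_, _, _, _, _, e, fun k hJ hs => ?_⟩
      rw [abs_diracEv_eq, abs_diracEv_eq, hJ, if_neg (by rw [hs]; decide), if_pos hl]
      push_cast
      ring
    · rw [if_neg hl] at e
      refine ⟨_, _, _, _, _, e, fun k hJ hs => ?_⟩
      rw [abs_diracEv_eq, abs_diracEv_eq, hJ, if_pos hs, if_neg hl]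
      push_cast
      ring

/-- The matrix of the raising part is lower triangular and that of the lowering part is upper
triangular. -/
theorem spinOp_add_spinOp (h : ∀ j μ n, m j μ n 0 1 = 0) (h' : ∀ j μ n, m' j μ n 1 0 = 0)
    (dJ dJ' : ℤ) :
    spinOp m dJ dM dN hm + spinOp m' dJ' dM' dN' hm'
      = diagPart (spinOp m dJ dM dN hm) + diagPart (spinOp m' dJ' dM' dN' hm')
        + offDiag (spinOp m dJ dM dN hm) (spinOp m' dJ' dM' dN' hm') := by
  refine clm_ext fun k => ?_
  have hs : k.s = 0 ∨ k.s = 1 := by omega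
  simp only [add_apply, diagPart_spinOp_basisVec, offDiag_spinOp_basisVec, spinOp_basisVec,
    Fin.sum_univ_two]
  rcases hs with hs | hs
  · rw [hs, h', if_pos rfl, Complex.ofReal_zero, zero_smul]
    abel
  · rw [hs, h, if_neg one_ne_zero, Complex.ofReal_zero, zero_smul]
    abel

end Delta

/-! ### The generators of `𝓑` -/

section Generators
variable (q : Par)

/-- The six generators of `𝓑`. -/
def symGens : Set BSpinor :=
  {aTildePlus q, aTildeMinus q, bTildePlus q, bTildeMinus q, aOff q, bOff q}

theorem isDelta_aTildePlus : IsDelta (aTildePlus q) (aTildePlus q) := by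
  have := isDelta_diagPart (dM := 1) (dN := 1) (aPlus_bounded q.2.1 q.2.2) 1
  rwa [Int.cast_one, Complex.ofReal_one, one_smul] at this

theorem isDelta_bTildePlus : IsDelta (bTildePlus q) (bTildePlus q) := by
  have := isDelta_diagPart (dM := 1) (dN := -1) (bPlus_bounded q.2.1 q.2.2) 1
  rwa [Int.cast_one, Complex.ofReal_one, one_smul] at this

theorem isDelta_aTildeMinus : IsDelta (aTildeMinus q) (-aTildeMinus q) := by
  have := isDelta_diagPart (dM := 1) (dN := 1) (aMinus_bounded q.2.1 q.2.2) (-1)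
  rwa [Int.cast_neg, Int.cast_one, Complex.ofReal_neg, Complex.ofReal_one, neg_one_smul] at this

theorem isDelta_bTildeMinus : IsDelta (bTildeMinus q) (-bTildeMinus q) := by
  have := isDelta_diagPart (dM := 1) (dN := -1) (bMinus_bounded q.2.1 q.2.2) (-1)
  rwa [Int.cast_neg, Int.cast_one, Complex.ofReal_neg, Complex.ofReal_one, neg_one_smul] at this

theorem isDelta_aOff : IsDelta (aOff q) 0 := isDelta_offDiag _ _

theorem isDelta_bOff : IsDelta (bOff q) 0 := isDelta_offDiag _ _

theorem spin_a_eq : aPlus q + aMinus q = aTildePlus q + aTildeMinus q + aOff q :=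
  spinOp_add_spinOp _ _ (fun j μ n => by simp [aPlusMat]) (fun j μ n => by simp [aMinusMat]) _ _

theorem spin_b_eq : bPlus q + bMinus q = bTildePlus q + bTildeMinus q + bOff q :=
  spinOp_add_spinOp _ _ (fun j μ n => by simp [bPlusMat]) (fun j μ n => by simp [bMinusMat]) _ _

/-- The generators are eigenvectors of δ, δ obeys the Leibniz rule and δ(T^*) = -δ(T)^*. Hence the
generated algebra is stable under δ and contains all δⁿ(A). -/
theorem exists_isDelta_of_mem_adjoin (T : BSpinor) (hT : T ∈ StarAlgebra.adjoin ℂ (symGens q)) :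
    ∃ S, S ∈ StarAlgebra.adjoin ℂ (symGens q) ∧ IsDelta T S := by
  induction hT using StarAlgebra.adjoin_induction with
  | mem T h =>
    have hT := StarAlgebra.subset_adjoin ℂ _ h
    rcases h with rfl | rfl | rfl | rfl | rfl | rfl
    · exact ⟨_, hT, isDelta_aTildePlus q⟩
    · exact ⟨_, neg_mem hT, isDelta_aTildeMinus q⟩
    · exact ⟨_, hT, isDelta_bTildePlus q⟩
    · exact ⟨_, neg_mem hT, isDelta_bTildeMinus q⟩
    · exact ⟨_, zero_mem _, isDelta_aOff q⟩
    · exact ⟨_, zero_mem _, isDelta_bOff q⟩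
  | algebraMap c => exact ⟨0, zero_mem _, .algebraMap c⟩
  | add T T' _ _ h h' =>
    obtain ⟨S, hS, h⟩ := h
    obtain ⟨S', hS', h'⟩ := h'
    exact ⟨_, add_mem hS hS', h.add h'⟩
  | mul T T' hT hT' h h' =>
    obtain ⟨S, hS, h⟩ := h
    obtain ⟨S', hS', h'⟩ := h'
    exact ⟨_, add_mem (mul_mem hS hT') (mul_mem hT hS'), h.mul h'⟩
  | star T _ h =>
    obtain ⟨S, hS, h⟩ := h
    exact ⟨_, neg_mem (star_mem hS), h.star⟩

/-- An algebra that contains `T = X + Y + Z`, `δ(T)` and `δ²(T)`, where `δ` is `1`, `-1`, `0` on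
`X`, `Y`, `Z`, contains `X`, `Y`, `Z`. -/
theorem parts_mem_algB {X Y Z : BSpinor} (hX : IsDelta X X) (hY : IsDelta Y (-Y))
    (hZ : IsDelta Z 0) (h : X + Y + Z ∈ spinAlg q) : X ∈ algB q ∧ Y ∈ algB q ∧ Z ∈ algB q := by
  have key : ∀ n S, IsDeltaPow n (X + Y + Z) S → S ∈ algB q := fun n S hS =>
    StarAlgebra.subset_adjoin ℂ _ (Set.mem_iUnion.mpr ⟨n, _, h, hS⟩)
  have d1 : IsDelta (X + Y + Z) (X + -Y + 0) := (hX.add hY).add hZ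
  have hY' : IsDelta (-Y) Y := by
    have := hY.smul (-1)
    rwa [neg_one_smul, neg_one_smul, neg_neg] at this
  have d2 : IsDelta (X + -Y + 0) (X + Y + 0) := (hX.add hY').add .zero
  have m0 := key 0 _ rfl
  have m1 := key 1 _ ⟨_, rfl, d1⟩
  have m2 := key 2 _ ⟨_, ⟨_, rfl, d1⟩, d2⟩
  -- The polynomial (s + s²)/2 is 1 at the eigenvalue 1 and 0 at -1 and 0, so (δ + δ²)/2 isolates X.
  have hXm : X ∈ algB q := by
    have : X = (2⁻¹ : ℂ) • ((X + -Y + 0) + (X + Y + 0)) := by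
      have e : (X + -Y + 0) + (X + Y + 0) = (2 : ℂ) • X := by rw [two_smul]; abel
      rw [e, smul_smul, inv_mul_cancel₀ two_ne_zero, one_smul]
    rw [this]
    exact SMulMemClass.smul_mem _ (add_mem m1 m2)
  have hYm : Y ∈ algB q := by
    have : Y = (X + Y + 0) - X := by abel
    rw [this]
    exact sub_mem m2 hXm
  refine ⟨hXm, hYm, ?_⟩
  have : Z = (X + Y + Z) - X - Y := by abel
  rw [this]
  exact sub_mem (sub_mem m0 hXm) hYm

theorem a_parts_mem : aTildePlus q ∈ algB q ∧ aTildeMinus q ∈ algB q ∧ aOff q ∈ algB q :=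
  parts_mem_algB q (isDelta_aTildePlus q) (isDelta_aTildeMinus q) (isDelta_aOff q) (by
    rw [← spin_a_eq]; exact StarAlgebra.subset_adjoin ℂ _ (Or.inl rfl))

theorem b_parts_mem : bTildePlus q ∈ algB q ∧ bTildeMinus q ∈ algB q ∧ bOff q ∈ algB q :=
  parts_mem_algB q (isDelta_bTildePlus q) (isDelta_bTildeMinus q) (isDelta_bOff q) (by
    rw [← spin_b_eq]; exact StarAlgebra.subset_adjoin ℂ _ (Or.inr rfl))

theorem spinAlg_le : spinAlg q ≤ StarAlgebra.adjoin ℂ (symGens q) := by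
  have h : symGens q ⊆ StarAlgebra.adjoin ℂ (symGens q) := StarAlgebra.subset_adjoin ℂ _
  refine StarAlgebra.adjoin_le ?_
  rintro _ (rfl | rfl)
  · rw [spin_a_eq]
    exact add_mem (add_mem (h (by simp [symGens])) (h (by simp [symGens])))
      (h (by simp [symGens]))
  · rw [spin_b_eq]
    exact add_mem (add_mem (h (by simp [symGens])) (h (by simp [symGens])))
      (h (by simp [symGens]))

theorem algB_eq : algB q = StarAlgebra.adjoin ℂ (symGens q) := by
  refine le_antisymm (StarAlgebra.adjoin_le (Set.iUnion_subset fun n => ?_))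
    (StarAlgebra.adjoin_le ?_)
  · rintro S ⟨T, hT, h⟩
    obtain ⟨S', hS', h'⟩ :=
      isDeltaPow_of_closed (exists_isDelta_of_mem_adjoin q) (spinAlg_le q hT) n
    rwa [h.unique h']
  · rintro _ (rfl | rfl | rfl | rfl | rfl | rfl)
    exacts [(a_parts_mem q).1, (a_parts_mem q).2.1, (b_parts_mem q).1, (b_parts_mem q).2.1,
      (a_parts_mem q).2.2, (b_parts_mem q).2.2]

/-! ### The symbol map -/

/-- The graph of the symbol map on the generators. -/
def symPairs : Set (BSpinor × SymbolAlg q) :=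
  {(aTildePlus q, symAPlus q), (aTildeMinus q, symAMinus q), (bTildePlus q, symBPlus q),
    (bTildeMinus q, symBMinus q), (aOff q, 0), (bOff q, 0)}

/-- The graph of the symbol map. -/
abbrev symbolGraph : StarSubalgebra ℂ (BSpinor × SymbolAlg q) := StarAlgebra.adjoin ℂ (symPairs q)

/-- The analytic estimates are needed for the six generators only, because `HasSymbol` survives the
operations of a *-algebra. -/
theorem hasSymbol_of_mem_graph {p : BSpinor × SymbolAlg q} (hp : p ∈ symbolGraph q) :
    HasSymbol q p.1 p.2 := by
  induction hp using StarAlgebra.adjoin_induction with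
  | mem p h =>
    rcases h with rfl | rfl | rfl | rfl | rfl | rfl
    exacts [hasSymbol_aTildePlus q, hasSymbol_aTildeMinus q, hasSymbol_bTildePlus q,
      hasSymbol_bTildeMinus q, hasSymbol_aOff q, hasSymbol_bOff q]
  | algebraMap c => rw [Algebra.algebraMap_eq_smul_one]; exact .scalar c
  | add p p' _ _ h h' => exact h.add h'
  | mul p p' _ _ h h' => exact h.mul h'
  | star p _ h => exact h.star

theorem map_fst_graph : (symbolGraph q).map (StarAlgHom.fst ℂ BSpinor (SymbolAlg q)) = algB q := by
  rw [symbolGraph, StarAlgHom.map_adjoin, algB_eq, symPairs, symGens]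
  simp [Set.image_insert_eq]

/-- The off-diagonal pairs have second entry 0 and contribute nothing, which leaves the four
tensors. -/
theorem map_snd_graph : (symbolGraph q).map (StarAlgHom.snd ℂ BSpinor (SymbolAlg q))
    = StarAlgebra.adjoin ℂ {symAPlus q, symAMinus q, symBPlus q, symBMinus q} := by
  have h0 : (0 : SymbolAlg q)
      ∈ StarAlgebra.adjoin ℂ {symAPlus q, symAMinus q, symBPlus q, symBMinus q} := zero_mem _
  rw [symbolGraph, StarAlgHom.map_adjoin, symPairs]
  simp only [Set.image_insert_eq, Set.image_singleton, StarAlgHom.snd_apply]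
  refine le_antisymm (StarAlgebra.adjoin_le ?_) (StarAlgebra.adjoin_mono ?_)
  · rintro _ (rfl | rfl | rfl | rfl | rfl | rfl)
    on_goal 5 => exact h0
    on_goal 5 => exact h0
    all_goals exact StarAlgebra.subset_adjoin ℂ _ (by simp)
  · rintro _ (rfl | rfl | rfl | rfl) <;> simp

/-- The graph projects to `𝓑`. -/
def graphFst : symbolGraph q →⋆ₐ[ℂ] algB q :=
  ((StarAlgHom.fst ℂ BSpinor (SymbolAlg q)).comp (symbolGraph q).subtype).codRestrict (algB q)
    fun p => by
      rw [← map_fst_graph]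
      exact ⟨p, p.2, rfl⟩

/-- Injectivity is the uniqueness of symbols, that is, the well-definedness of ρ. Surjectivity holds
because the first entries of the pairs generate 𝓑. -/
theorem graphFst_bijective : Function.Bijective (graphFst q) := by
  refine ⟨?_, ?_⟩
  · rintro ⟨⟨T, z⟩, hp⟩ ⟨⟨T', z'⟩, hp'⟩ h
    obtain rfl : T = T' := congrArg Subtype.val h
    obtain rfl : z = z' := (hasSymbol_of_mem_graph q hp).unique (hasSymbol_of_mem_graph q hp')
    rfl
  · rintro ⟨T, hT⟩
    have hT' := hT
    rw [← map_fst_graph] at hT'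
    obtain ⟨p, hp, rfl⟩ := hT'
    exact ⟨⟨p, hp⟩, rfl⟩

/-- The symbol map. -/
def symbolMap : algB q →⋆ₐ[ℂ] SymbolAlg q :=
  ((StarAlgHom.snd ℂ BSpinor (SymbolAlg q)).comp (symbolGraph q).subtype).comp
    (StarAlgEquiv.ofBijective (graphFst q) (graphFst_bijective q)).symm

theorem mem_graph (T : algB q) : ((T : BSpinor), symbolMap q T) ∈ symbolGraph q := by
  have h := (StarAlgEquiv.ofBijective (graphFst q) (graphFst_bijective q)).apply_symm_apply T
  set p := (StarAlgEquiv.ofBijective (graphFst q) (graphFst_bijective q)).symm T with hp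
  have h1 : (p : BSpinor × SymbolAlg q).1 = T := congrArg Subtype.val h
  have h2 : (p : BSpinor × SymbolAlg q).2 = symbolMap q T := rfl
  rw [← h1, ← h2]
  exact p.2

theorem symbolMap_eq {T : BSpinor} {z : SymbolAlg q} (h : (T, z) ∈ symPairs q) :
    ∃ hT : T ∈ algB q, symbolMap q ⟨T, hT⟩ = z := by
  have hp : (T, z) ∈ symbolGraph q := StarAlgebra.subset_adjoin ℂ _ h
  have hT : T ∈ algB q := by
    rw [← map_fst_graph]
    exact ⟨_, hp, rfl⟩
  exact ⟨hT, (hasSymbol_of_mem_graph q (mem_graph q ⟨T, hT⟩)).unique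
    (hasSymbol_of_mem_graph q hp)⟩

theorem isSymbolMap_symbolMap : IsSymbolMap q (symbolMap q) where
  aPlus := symbolMap_eq q (by simp [symPairs])
  aMinus := symbolMap_eq q (by simp [symPairs])
  bPlus := symbolMap_eq q (by simp [symPairs])
  bMinus := symbolMap_eq q (by simp [symPairs])
  aOff := symbolMap_eq q (by simp [symPairs])
  bOff := symbolMap_eq q (by simp [symPairs])

theorem IsSymbolMap.unique {q : Par} {ρ ρ' : algB q →⋆ₐ[ℂ] SymbolAlg q} (h : IsSymbolMap q ρ)
    (h' : IsSymbolMap q ρ') : ρ' = ρ := by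
  have key : ∀ T (hT : T ∈ StarAlgebra.adjoin ℂ (symGens q)), ∀ hB : T ∈ algB q,
      ρ' ⟨T, hB⟩ = ρ ⟨T, hB⟩ := by
    intro T hT
    induction hT using StarAlgebra.adjoin_induction with
    | mem T h1 =>
      intro hB
      rcases h1 with rfl | rfl | rfl | rfl | rfl | rfl
      exacts [h'.aPlus.2.trans h.aPlus.2.symm, h'.aMinus.2.trans h.aMinus.2.symm,
        h'.bPlus.2.trans h.bPlus.2.symm, h'.bMinus.2.trans h.bMinus.2.symm,
        h'.aOff.2.trans h.aOff.2.symm, h'.bOff.2.trans h.bOff.2.symm]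
    | algebraMap c =>
      intro hB
      exact (ρ'.commutes' c).trans (ρ.commutes' c).symm
    | add T T' hT hT' e e' =>
      rw [← algB_eq] at hT hT'
      intro hB
      refine (ρ'.map_add' ⟨T, hT⟩ ⟨T', hT'⟩).trans
        (Eq.trans ?_ (ρ.map_add' ⟨T, hT⟩ ⟨T', hT'⟩).symm)
      congr 1
      exacts [e hT, e' hT']
    | mul T T' hT hT' e e' =>
      rw [← algB_eq] at hT hT'
      intro hB
      refine (ρ'.map_mul' ⟨T, hT⟩ ⟨T', hT'⟩).trans
        (Eq.trans ?_ (ρ.map_mul' ⟨T, hT⟩ ⟨T', hT'⟩).symm)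
      congr 1
      exacts [e hT, e' hT']
    | star T hT e =>
      rw [← algB_eq] at hT
      intro hB
      refine (ρ'.map_star' ⟨T, hT⟩).trans (Eq.trans ?_ (ρ.map_star' ⟨T, hT⟩).symm)
      congr 1
      exact e hT
  refine StarAlgHom.ext ?_
  rintro ⟨T, hT⟩
  exact key T (algB_eq q ▸ hT) hT

theorem cosphereBundle_symbolMap : cosphereBundle q (symbolMap q)
    = StarAlgebra.adjoin ℂ {symAPlus q, symAMinus q, symBPlus q, symBMinus q} := by
  rw [← map_snd_graph]
  refine SetLike.ext fun z => ⟨?_, ?_⟩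
  · rintro ⟨T, rfl⟩
    exact ⟨_, mem_graph q T, rfl⟩
  · rintro ⟨p, hp, rfl⟩
    have hT : p.1 ∈ algB q := by
      rw [← map_fst_graph]
      exact ⟨_, hp, rfl⟩
    exact ⟨⟨p.1, hT⟩, (hasSymbol_of_mem_graph q (mem_graph q ⟨p.1, hT⟩)).unique
      (hasSymbol_of_mem_graph q hp)⟩

end Generators

end QSU2
end

/-- Existence (and uniqueness) of the symbol map `ρ` of quantum `SU(2)` on the algebra `𝓑` generated
by all `δⁿ(A)`, its values on the generators of `𝓑`, its range (the cosphere bundle), and the fact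
that `T - Q (ρ(T) ⊗ 1₂) Q` is smoothing for every `T` in `𝓑`. -/
theorem mainTheorem4 (q : Set.Ioo (0 : ℝ) 1) :
    QSU2.algB q = StarAlgebra.adjoin ℂ
      {QSU2.aTildePlus q, QSU2.aTildeMinus q, QSU2.bTildePlus q, QSU2.bTildeMinus q,
        QSU2.aOff q, QSU2.bOff q} ∧
    ∃ ρ : QSU2.algB q →⋆ₐ[ℂ] QSU2.SymbolAlg q,
      QSU2.IsSymbolMap q ρ ∧
      (∀ ρ' : QSU2.algB q →⋆ₐ[ℂ] QSU2.SymbolAlg q, QSU2.IsSymbolMap q ρ' → ρ' = ρ) ∧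
      QSU2.cosphereBundle q ρ = StarAlgebra.adjoin ℂ
        {QSU2.symAPlus q, QSU2.symAMinus q, QSU2.symBPlus q, QSU2.symBMinus q} ∧
      ∀ T : QSU2.algB q,
        QSU2.IsSmoothing ((T : QSU2.BSpinor) - QSU2.compress (QSU2.symbolAct q (ρ T))) :=
  ⟨QSU2.algB_eq q, QSU2.symbolMap q, QSU2.isSymbolMap_symbolMap q,
    fun _ h => (QSU2.isSymbolMap_symbolMap q).unique h, QSU2.cosphereBundle_symbolMap q,
    fun T => (QSU2.hasSymbol_of_mem_graph q (QSU2.mem_graph q T)).isSmoothing⟩
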